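/- **Theorem 7.** For $r\in\mathbb{R}$ let $$H(u,v)=\tfrac12(u^2+v^2)-\tfrac12u^3+v^3+\tfrac18u^4-uv^3+r\,v^4,$$ which has an elementary center at the origin, and consider the cubic near-Hamiltonian system $$\dot u=H_v+\varepsilon\,p(u,v),\qquad \dot v=-H_u+\varepsilon\,q(u,v),\tag{esc}$$ where $p,q$ are real polynomials of degree at most $3$ with $$p_u+q_v=c_{00}+c_{10}u+c_{01}v+c_{20}u^2+c_{11}uv+c_{02}v^2 .$$ Put $\delta=(c_{00},c_{10},c_{01},c_{02},c_{11},c_{20})$. Let $$f(r)=780900831-459924741\,r-2093583104\,r^2-1597844992\,r^3-108363776\,r^4+1381957632\,r^5,$$ let $r^*$ be any real root of $f$, and let $\delta_0=(c_{00}^*,c_{10}^*,c_{01}^*,c_{02}^*,c_{11}^*,c_{20}^*)$ satisfy $c_{01}^*\neq0$, $c_{00}^*=0$ and $$c_{20}^*=\frac{6544683+11682846r^*+30378720(r^*)^2-40278528(r^*)^3-21471232(r^*)^4}{2\,(2770317-11417834r^*+11442688(r^*)^2+442880(r^*)^3)}\,c_{01}^*,$$ $$c_{10}^*=\frac{2}{17680r^*-43347}\big[(1792(r^*)^2-17328r^*-696)c_{01}^*+(11107-5680r^*)c_{20}^*\big],$$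 $$c_{11}^*=(12r^*-\tfrac{191}{4})c_{10}^*+(40r^*+3)c_{01}^*+(8r^*-\tfrac{47}{2})c_{20}^*,\qquad c_{02}^*=-\tfrac32c_{10}^*+3c_{01}^*-c_{20}^*.$$ Then for some $(\varepsilon,\delta,r)$ arbitrarily near $(0,\delta_0,r^*)$ with $\varepsilon>0$, system (esc) has (at least) $6$ limit cycles near the origin. Precisely: for every $\eta>0$ there are $r$ and $\delta$ within $\eta$ of $r^*$ and $\delta_0$ (coordinatewise) such that for all $p,q$ of degree at most $3$ whose divergence $p_u+q_v$ has coefficients $\delta$ there is $\varepsilon\in(0,\eta)$ for which (esc) has at least $6$ distinct limit cycles (periodic orbits isolated among all periodic orbits) contained in the open $\eta$-neighbourhood $\{\max(|u|,|v|)<\eta\}$ of the origin. -/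

import Mathlib

noncomputable section

open MvPolynomial

/-- `Γ` is (the image of) a non-constant periodic orbit of the autonomous system `z' = X z`. -/
def IsPeriodicOrbit (X : ℝ × ℝ → ℝ × ℝ) (Γ : Set (ℝ × ℝ)) : Prop :=
  ∃ (γ : ℝ → ℝ × ℝ) (T : ℝ), 0 < T ∧ (∀ t, HasDerivAt γ (X (γ t)) t) ∧
    (∀ t, γ (t + T) = γ t) ∧ (∃ t, γ t ≠ γ 0) ∧ Γ = Set.range γ

/-- A limit cycle: a periodic orbit that is isolated among all periodic orbits, i.e. some
neighbourhood of it contains no other periodic orbit. -/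
def IsLimitCycle (X : ℝ × ℝ → ℝ × ℝ) (Γ : Set (ℝ × ℝ)) : Prop :=
  IsPeriodicOrbit X Γ ∧
    ∃ U : Set (ℝ × ℝ), IsOpen U ∧ Γ ⊆ U ∧ ∀ Γ', IsPeriodicOrbit X Γ' → Γ' ⊆ U → Γ' = Γ

/-- The Hamiltonian
`H(u,v) = (u² + v²)/2 - u³/2 + v³ + u⁴/8 - u v³ + r v⁴`; here `u = X 0` and `v = X 1`. -/
def hamiltonian (r : ℝ) : MvPolynomial (Fin 2) ℝ :=
  C (1 / 2) * (X 0 ^ 2 + X 1 ^ 2) - C (1 / 2) * X 0 ^ 3 + X 1 ^ 3 + C (1 / 8) * X 0 ^ 4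
    - X 0 * X 1 ^ 3 + C r * X 1 ^ 4

/-- The near-Hamiltonian vector field `(H_v + ε p, -H_u + ε q)`. -/
def nearHamiltonianField (H p q : MvPolynomial (Fin 2) ℝ) (ε : ℝ) (z : ℝ × ℝ) : ℝ × ℝ :=
  (eval ![z.1, z.2] (pderiv 1 H + C ε * p), eval ![z.1, z.2] (-pderiv 0 H + C ε * q))

/-- The quadratic polynomial `c₀₀ + c₁₀ u + c₀₁ v + c₂₀ u² + c₁₁ u v + c₀₂ v²`. -/
def divergencePoly (c00 c10 c01 c02 c11 c20 : ℝ) : MvPolynomial (Fin 2) ℝ :=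
  C c00 + C c10 * X 0 + C c01 * X 1 + C c20 * X 0 ^ 2 + C c11 * (X 0 * X 1) + C c02 * X 1 ^ 2

/-- The quintic `f(r)`. -/
def quintic (r : ℝ) : ℝ :=
  780900831 - 459924741 * r - 2093583104 * r ^ 2 - 1597844992 * r ^ 3 - 108363776 * r ^ 4
    + 1381957632 * r ^ 5

end

/-! The Hamiltonian is a sum of squares: H = (w² + z²)/2 with w = u - u²/2 and z = v √(1 + 2(1 - u)v
+ 2rv²). In the polar coordinates w = σ sin φ, z = σ cos φ the unperturbed orbits near the origin
are the circles σ = const, and the perturbed system becomes a scalar 2π-periodic equation dσ/dφ = ε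
`polarField`. Averaging (`exists_periodic_solution_of_averaged_simple_zero`) turns each simple zero
σ > 0 of the first-order Melnikov function `melnikov` into a periodic solution. It is unique nearby
even among solutions that close up only after several turns, and this makes the orbit a limit cycle
(`exists_limitCycle_of_simple_zero`). An exact-differential argument (`integral_perturbDot`) shows
that the averaged function depends on the perturbation only through its divergence, linearly in the
six coefficients.

It remains to find six simple zeros near σ = 0. Truncated power series with rational coefficients,
with remainders controlled together with their derivatives (`FlatOn`), give `melnikov` = 2π ∑ b_m
σ^(2m) + O(σ^15) with m = 1, …, 7 (`melnikov_expansion`). Each b_m is linear in the divergence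
coefficients and polynomial in r. The relations on c₀₀, c₀₂, c₁₁, c₁₀, c₂₀ annihilate b₁, …, b₅ one
after the other. Then b₆ is the quintic f(r) times a factor that does not vanish at the roots of f,
and b₇ ≠ 0 at those roots. As f has simple roots, r and the defects in the five relations control
b₁, …, b₆ in a triangular way.

`exists_focal_family` uses this control to impose b_m ~ B a_m s^(7-m), where the a_m are the
coefficients of ∏ (x - j²), j = 1, …, 6. With s = τ² and σ = τ ξ, the quotient of `melnikov` by 2π
τ^14 tends to B ξ² ∏ (ξ² - j²), together with its derivative near ξ = 1, …, 6. The simple zeros 1,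
…, 6 of the limit persist for small τ (`exists_six_simple_zeros`). -/

open Set Filter Topology MeasureTheory
open scoped NNReal

/-! ### Scalar periodic equations and first-order averaging -/

/-- A scalar periodic equation with globally Lipschitz bounded right-hand side has a periodic
solution as soon as the displacement over one period changes sign. -/
lemma exists_periodic_solution {g : ℝ → ℝ → ℝ} {P x₁ x₂ : ℝ} {K L : ℝ≥0} (hP : 0 < P)
    (hper : ∀ t x, g (t + P) x = g t x) (hlip : ∀ t, LipschitzWith K (g t))
    (hcont : ∀ x, Continuous fun t => g t x) (hbd : ∀ t x, |g t x| ≤ L) (hx : x₁ ≤ x₂)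
    (hsign : ∀ α β : ℝ → ℝ, α 0 = x₁ → β 0 = x₂ →
      (∀ t ∈ Icc 0 P, HasDerivWithinAt α (g t (α t)) (Icc 0 P) t) →
      (∀ t ∈ Icc 0 P, HasDerivWithinAt β (g t (β t)) (Icc 0 P) t) →
      (α P - x₁) * (β P - x₂) ≤ 0) :
    ∃ s : ℝ → ℝ, (∀ t, HasDerivAt s (g t (s t)) t) ∧ (∀ t, s (t + P) = s t) ∧
      s 0 ∈ Icc x₁ x₂ := by
  have h0 : (0 : ℝ) ∈ Icc (-P) (2 * P) := ⟨by linarith, by linarith⟩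
  obtain ⟨rr, hrr⟩ : ∃ rr : ℝ≥0, (rr : ℝ) = x₂ - x₁ := ⟨⟨x₂ - x₁, by linarith⟩, rfl⟩
  obtain ⟨PP, hPP⟩ : ∃ PP : ℝ≥0, (PP : ℝ) = 2 * P := ⟨⟨2 * P, by linarith⟩, rfl⟩
  -- The time window exceeds [0, P] by a full period on each side: solutions are then differentiable
  -- at the endpoints of [0, P], and their translates by multiples of P overlap. The radius `rr + L
  -- * PP` is the spread of the initial values plus the largest possible drift.
  have hpl : IsPicardLindelof g (⟨0, h0⟩ : Icc (-P) (2 * P)) x₁ (rr + L * PP) rr L K := by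
    refine ⟨fun t _ => (hlip t).lipschitzOnWith, fun x _ => (hcont x).continuousOn,
      fun t _ x _ => by simpa using hbd t x, ?_⟩
    have : max (2 * P - 0) (0 - -P) = 2 * P := by
      rw [max_eq_left]; ring; linarith
    simp only [this]
    push_cast
    rw [hPP]
    simp
  obtain ⟨α, hα, L', hL'⟩ := hpl.exists_forall_mem_closedBall_eq_hasDerivWithinAt_lipschitzOnWith
  have hball : Icc x₁ x₂ ⊆ Metric.closedBall x₁ rr := by
    intro x hx
    rw [Metric.mem_closedBall, Real.dist_eq, abs_of_nonneg (by linarith [hx.1])]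
    rw [hrr]; linarith [hx.2]
  have hPm : P ∈ Icc (-P) (2 * P) := ⟨by linarith, by linarith⟩
  -- Lipschitz dependence on the initial value makes the displacement continuous, so its sign change
  -- yields a fixed point of the period map.
  have hc : ContinuousOn (fun x => α x P - x) (Icc x₁ x₂) :=
    ((hL' P hPm).continuousOn.mono hball).sub continuousOn_id
  have hs := hsign (α x₁) (α x₂) (hα _ (hball ⟨le_rfl, hx⟩)).1 (hα _ (hball ⟨hx, le_rfl⟩)).1
    (fun t ht => ((hα _ (hball ⟨le_rfl, hx⟩)).2 t ⟨by linarith [ht.1], by linarith [ht.2]⟩).mono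
      (Icc_subset_Icc (by linarith) (by linarith)))
    (fun t ht => ((hα _ (hball ⟨hx, le_rfl⟩)).2 t ⟨by linarith [ht.1], by linarith [ht.2]⟩).mono
      (Icc_subset_Icc (by linarith) (by linarith)))
  obtain ⟨x, hxm, hx0⟩ : ∃ x ∈ Icc x₁ x₂, α x P - x = 0 := by
    rcases mul_nonpos_iff.1 hs with ⟨h1, h2⟩ | ⟨h1, h2⟩
    · exact intermediate_value_Icc' hx hc ⟨h2, h1⟩
    · exact intermediate_value_Icc hx hc ⟨h1, h2⟩
  obtain ⟨ha0, had⟩ := hα x (hball hxm)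
  set a := α x
  have hda : ∀ t ∈ Ioo (-P) (2 * P), HasDerivAt a (g t (a t)) t := fun t ht =>
    (had t (Ioo_subset_Icc_self ht)).hasDerivAt (Icc_mem_nhds ht.1 ht.2)
  have haper : ∀ t ∈ Ioo (-P) P, a (t + P) = a t := by
    have := ODE_solution_unique_of_mem_Ioo (v := g) (s := fun _ => univ) (K := K)
      (f := fun t => a (t + P)) (g := a) (a := -P) (b := P) (t₀ := 0)
      (fun t _ => (hlip t).lipschitzOnWith) ⟨by linarith, by linarith⟩
      (fun t ht => ⟨by
        have := (hda (t + P) ⟨by linarith [ht.1], by linarith [ht.2]⟩).comp_add_const t P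
        rwa [hper] at this, trivial⟩)
      (fun t ht => ⟨hda t ⟨ht.1, by linarith [ht.2]⟩, trivial⟩)
      (by simp only [zero_add]; rw [show a 0 = x from ha0]; linarith)
    exact this
  -- On each window of length 3P the P-periodic extension coincides with one translate of the
  -- solution. The windows are open and overlap, so no kink can appear at multiples of P.
  have hmod : ∀ k : ℤ, ∀ t ∈ Ioo (k * P - P) (k * P + 2 * P),
      a (toIcoMod hP 0 t) = a (t - k * P) := by
    intro k t ht
    have hm : ∀ j : ℤ, t - j * P ∈ Ico 0 P → toIcoMod hP 0 t = t - j * P := by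
      intro j hj
      have := (toIcoMod_eq_iff hP (a := 0) (b := t) (c := t - j * P)).2
        ⟨by simpa using hj, j, by simp⟩
      exact this
    rcases lt_trichotomy (t - k * P) 0 with h | h | h
    · rw [hm (k - 1) ⟨by push_cast; nlinarith [ht.1], by push_cast; nlinarith⟩]
      have := haper (t - k * P) ⟨by linarith [ht.1], by linarith⟩
      rw [← this]; congr 1; push_cast; ring
    · rw [hm k ⟨by linarith, by linarith⟩]
    · rcases lt_or_ge (t - k * P) P with h' | h'
      · rw [hm k ⟨by linarith, by linarith⟩]
      · rw [hm (k + 1) ⟨by push_cast; nlinarith [ht.1], by push_cast; nlinarith [ht.2]⟩]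
        have := haper (t - (k + 1) * P) ⟨by linarith [ht.1], by linarith [ht.2]⟩
        push_cast
        rw [← this]; congr 1; ring
  have hgper : ∀ (k : ℤ) t x, g (t - k * P) x = g t x := by
    intro k t x
    have : Function.Periodic (fun t => g t x) P := fun t => hper t x
    exact this.sub_int_mul_eq k
  refine ⟨fun t => a (toIcoMod hP 0 t), fun t => ?_, fun t => ?_, ?_⟩
  · set k := toIcoDiv hP 0 t
    have hk : t - k * P ∈ Ico 0 P := by
      have := toIcoMod_mem_Ico hP 0 t
      rwa [toIcoMod, zsmul_eq_mul, zero_add] at this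
    have ht : t ∈ Ioo (k * P - P) (k * P + 2 * P) := ⟨by linarith [hk.1], by linarith [hk.2]⟩
    have h1 := (hda (t - k * P) ⟨by linarith [ht.1], by linarith [ht.2]⟩).comp_sub_const t (k * P)
    rw [hgper] at h1
    change HasDerivAt _ (g t (a (toIcoMod hP 0 t))) t
    rw [hmod k t ht]
    exact h1.congr_of_eventuallyEq
      (eventually_of_mem (Ioo_mem_nhds ht.1 ht.2) fun t' ht' => hmod k t' ht')
  · simp
  · have : toIcoMod hP 0 (0 : ℝ) = 0 := by simp
    simp only [this]
    rw [show a 0 = x from ha0]; exact hxm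

/-- Comparison of two periodic trajectories of a scalar periodic equation whose right-hand side is
uniformly close to an affine function with non-zero mean slope. -/
lemma periodic_solution_unique {F : ℝ → ℝ → ℝ} {D s φ σ κ : ℝ → ℝ} {I : Set ℝ}
    {P ε μ m T : ℝ} {n : ℕ} (hD : Continuous D) (hDP : ∀ t, D (t + P) = D t)
    (hm : ∫ t in 0..P, D t = m) (hμ : P * μ < |m|) (hε : 0 < ε) (hP : 0 < P)
    (hF : ∀ t, ∀ x ∈ I, ∀ y ∈ I, |F t x - F t y - D t * (x - y)| ≤ μ * |x - y|)
    (hs : ∀ t, HasDerivAt s (ε * F t (s t)) t) (hsP : ∀ t, s (t + P) = s t) (hsI : ∀ t, s t ∈ I)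
    (hφ : ∀ t, HasDerivAt φ (κ t) t) (hκ : ∀ t, 0 < κ t)
    (hσ : ∀ t, HasDerivAt σ (κ t * (ε * F (φ t) (σ t))) t) (hσI : ∀ t, σ t ∈ I)
    (hn : 0 < n) (hφT : φ T = φ 0 + n * P) (hσT : σ T = σ 0) (t : ℝ) :
    σ t = s (φ t) := by
  -- A negative `μ` is compatible with `hF` only if `I` has at most one point, and then the claim is
  -- trivial.
  have hμ0 : 0 ≤ μ ∨ ∀ x ∈ I, ∀ y ∈ I, x = y := by
    by_contra! h
    obtain ⟨h1, x, hx, y, hy, hxy⟩ := h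
    have := hF 0 x hx y hy
    have h2 : 0 < |x - y| := abs_pos.2 (sub_ne_zero.2 hxy)
    nlinarith [abs_nonneg (F 0 x - F 0 y - D 0 * (x - y))]
  rcases hμ0 with hμ0 | hμ0
  swap
  · exact hμ0 _ (hσI t) _ (hsI _)
  -- the integrated slope
  set Λ : ℝ → ℝ := fun x => ∫ t in 0..x, D t with hΛ
  have hΛd : ∀ x, HasDerivAt Λ (D x) x := fun x =>
    intervalIntegral.integral_hasDerivAt_right (hD.intervalIntegrable _ _)
      (hD.stronglyMeasurableAtFilter _ _) hD.continuousAt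
  have hsn : ∀ x, s (x + n * P) = s x := fun x =>
    (Function.Periodic.nat_mul (f := s) (c := P) hsP n) x
  have hΛn : ∀ x, Λ (x + n * P) = Λ x + n * m := by
    intro x
    have h1 := Function.Periodic.intervalIntegral_add_eq (f := D) (T := P) hDP x 0
    have h2 : ∀ k : ℕ, Λ (x + k * P) = Λ x + k * m := by
      intro k
      induction k with
      | zero => simp
      | succ k ih =>
        have h3 := Function.Periodic.intervalIntegral_add_eq (f := D) (T := P) hDP (x + k * P) 0
        rw [zero_add, hm] at h3
        have h4 := intervalIntegral.integral_add_adjacent_intervals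
          (hD.intervalIntegrable (μ := volume) 0 (x + k * P))
          (hD.intervalIntegrable (x + k * P) (x + k * P + P))
        rw [h3] at h4
        have h5 : x + ((k + 1 : ℕ) : ℝ) * P = x + k * P + P := by push_cast; ring
        rw [h5]
        change _ = Λ (x + k * P + P) at h4
        rw [← h4]
        change Λ (x + k * P) + m = _
        rw [ih]; push_cast; ring
    exact h2 n
  set e : ℝ → ℝ := fun t => σ t - s (φ t) with he
  -- The exponential weight cancels the linear part `D` of the equation for the difference. What is
  -- left grows or decays, measured in φ, at rate at most 2εμ, so multiplying by exp(±2εμφ) gives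
  -- one increasing and one decreasing function.
  set f : ℝ → ℝ := fun t => e t ^ 2 * Real.exp (-(2 * ε) * Λ (φ t)) with hf
  have hed : ∀ t, HasDerivAt e (κ t * (ε * (F (φ t) (σ t) - F (φ t) (s (φ t))))) t := by
    intro t
    have := (hσ t).sub ((hs (φ t)).comp t (hφ t))
    convert! this using 1
    ring
  have key : ∀ c : ℝ, ∀ t, HasDerivAt (fun t => f t * Real.exp (c * φ t))
      (κ t * Real.exp (-(2 * ε) * Λ (φ t)) * Real.exp (c * φ t) *
        (2 * ε * (e t * (F (φ t) (σ t) - F (φ t) (s (φ t)) - D (φ t) * e t)) + c * e t ^ 2)) t := by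
    intro c t
    have h1 := ((hed t).pow 2).mul ((((hΛd (φ t)).comp t (hφ t)).const_mul (-(2 * ε))).exp)
    have h2 := h1.mul (((hφ t).const_mul c).exp)
    convert! h2 using 1
    simp only [Function.comp, Pi.mul_apply, Pi.pow_apply]
    push_cast
    ring
  have hb : ∀ t, |e t * (F (φ t) (σ t) - F (φ t) (s (φ t)) - D (φ t) * e t)| ≤ μ * e t ^ 2 := by
    intro t
    have := hF (φ t) _ (hσI t) _ (hsI (φ t))
    rw [abs_mul, ← sq_abs (e t)]
    have h0 := abs_nonneg (e t)
    calc _ ≤ |e t| * (μ * |e t|) := mul_le_mul_of_nonneg_left this h0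
      _ = _ := by ring
  have hmono : Monotone fun t => f t * Real.exp (2 * ε * μ * φ t) := by
    apply monotone_of_deriv_nonneg (fun t => (key _ t).differentiableAt)
    intro t
    rw [(key _ t).deriv]
    have := (abs_le.1 (hb t)).1
    have h2 : 0 ≤ 2 * ε * (e t * (F (φ t) (σ t) - F (φ t) (s (φ t)) - D (φ t) * e t) + μ * e t ^ 2) :=
      mul_nonneg (by linarith) (by linarith)
    have := hκ t
    refine mul_nonneg (by positivity) (by linarith)
  have hanti : Antitone fun t => f t * Real.exp (-(2 * ε * μ) * φ t) := by
    apply antitone_of_deriv_nonpos (fun t => (key _ t).differentiableAt)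
    intro t
    rw [(key _ t).deriv]
    have := (abs_le.1 (hb t)).2
    have h2 : 0 ≤ 2 * ε * (μ * e t ^ 2 - e t * (F (φ t) (σ t) - F (φ t) (s (φ t)) - D (φ t) * e t)) :=
      mul_nonneg (by linarith) (by linarith)
    have := hκ t
    refine mul_nonpos_of_nonneg_of_nonpos (by positivity) (by linarith)
  have hT : 0 ≤ T := by
    by_contra! h
    have hmφ : StrictMono φ := strictMono_of_deriv_pos fun t => by rw [(hφ t).deriv]; exact hκ t
    have := hmφ h
    have : 0 < n * P := by positivity
    linarith
  have heT : e T = e 0 := by simp only [he, hσT, hφT, hsn]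
  have hfT : f T = f 0 * Real.exp (-(2 * ε) * (n * m)) := by
    simp only [hf, heT, hφT, hΛn, mul_assoc, ← Real.exp_add]
    congr 2; ring
  -- After n turns the difference `e` returns to its initial value, so `f` is multiplied by exactly
  -- exp(-2εnm). Unless `e 0 = 0`, the two monotonicities then force |m| ≤ Pμ.
  have he0 : e 0 = 0 := by
    by_contra hne
    have hf0 : 0 < f 0 := by simp only [hf]; positivity
    have h1 := hmono hT
    have h2 := hanti hT
    simp only [hfT, hφT] at h1 h2
    rw [mul_assoc (f 0), ← Real.exp_add, mul_le_mul_iff_right₀ hf0, Real.exp_le_exp] at h1 h2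
    have hn' : (0 : ℝ) < n := by exact_mod_cast hn
    have h3 : m ≤ P * μ := by
      have : (2 * ε * n) * m ≤ (2 * ε * n) * (P * μ) := by linarith
      exact le_of_mul_le_mul_left this (by positivity)
    have h4 : -m ≤ P * μ := by
      have : (2 * ε * n) * (-m) ≤ (2 * ε * n) * (P * μ) := by linarith
      exact le_of_mul_le_mul_left this (by positivity)
    exact absurd (abs_le.2 ⟨by linarith, h3⟩) (not_le.2 hμ)
  have hf0 : f 0 = 0 := by simp [hf, he0]
  -- From the zero at time 0, the decreasing function controls later times and the increasing one
  -- controls earlier times.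
  have hft : f t ≤ 0 := by
    rcases le_total 0 t with h | h
    · have := hanti h
      simp only [hf0, zero_mul] at this
      exact nonpos_of_mul_nonpos_left this (Real.exp_pos _)
    · have := hmono h
      simp only [hf0, zero_mul] at this
      exact nonpos_of_mul_nonpos_left this (Real.exp_pos _)
  have : e t ^ 2 ≤ 0 := nonpos_of_mul_nonpos_left hft (Real.exp_pos _)
  have : e t = 0 := by nlinarith [sq_nonneg (e t), pow_eq_zero_iff (two_ne_zero) |>.1 (le_antisymm this (sq_nonneg (e t)))]
  simp only [he] at this
  linarith

/-- Differentiation of an interval integral with respect to a parameter. -/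
lemma hasDerivAt_integral_of_continuousOn {f f' : ℝ → ℝ → ℝ} {s : Set ℝ} (hs : IsOpen s)
    (hf : ContinuousOn (fun p : ℝ × ℝ => f p.1 p.2) (s ×ˢ univ))
    (hf' : ContinuousOn (fun p : ℝ × ℝ => f' p.1 p.2) (s ×ˢ univ))
    (hd : ∀ x ∈ s, ∀ t, HasDerivAt (fun x => f x t) (f' x t) x) (a b : ℝ) {x₀ : ℝ} (hx₀ : x₀ ∈ s) :
    HasDerivAt (fun x => ∫ t in a..b, f x t) (∫ t in a..b, f' x₀ t) x₀ := by
  have hc : ∀ {g : ℝ → ℝ → ℝ}, ContinuousOn (fun p : ℝ × ℝ => g p.1 p.2) (s ×ˢ univ) →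
      ∀ x ∈ s, Continuous (g x) := by
    intro g hg x hx
    have : ContinuousOn (fun t => g x t) univ :=
      hg.comp (f := fun t => (x, t)) (by fun_prop) (fun t _ => ⟨hx, trivial⟩)
    rwa [← continuousOn_univ]
  obtain ⟨δ, hδ, hball⟩ := Metric.nhds_basis_closedBall.mem_iff.1 (hs.mem_nhds hx₀)
  obtain ⟨C, hC⟩ := ((isCompact_closedBall x₀ δ).prod (isCompact_uIcc (a := a) (b := b))).exists_bound_of_continuousOn
    (hf'.mono (prod_mono hball (subset_univ _)))
  refine (intervalIntegral.hasDerivAt_integral_of_dominated_loc_of_deriv_le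
    (bound := fun _ => C) (s := Metric.closedBall x₀ δ)
    (Metric.closedBall_mem_nhds _ hδ) ?_ ?_ ?_ ?_ ?_ ?_).2
  · filter_upwards [hs.mem_nhds hx₀] with x hx
    exact (hc hf x hx).aestronglyMeasurable
  · exact (hc hf _ hx₀).intervalIntegrable _ _
  · exact (hc hf' _ hx₀).aestronglyMeasurable
  · exact Eventually.of_forall fun t ht x hx => hC (x, t) ⟨hx, uIoc_subset_uIcc ht⟩
  · exact intervalIntegrable_const
  · exact Eventually.of_forall fun t _ x hx => hd x (hball hx) t

/-- A function of `(ε, t, x)` which is continuous and periodic in `t` is close to its value at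
`(0, t, x₀)` for `(ε, x)` near `(0, x₀)`, uniformly in `t`. -/
lemma exists_uniform_bound {G : ℝ → ℝ → ℝ → ℝ} {P ε₁ : ℝ} {s : Set ℝ} (hP : 0 < P) (hε₁ : 0 < ε₁)
    (hs : IsOpen s)
    (hG : ContinuousOn (fun x : ℝ × ℝ × ℝ => G x.1 x.2.1 x.2.2) (Ioo (-ε₁) ε₁ ×ˢ univ ×ˢ s))
    (hper : ∀ ε t x, G ε (t + P) x = G ε t x) {x₀ : ℝ} (hx₀ : x₀ ∈ s) {ν : ℝ} (hν : 0 < ν) :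
    ∃ δ, 0 < δ ∧ δ < ε₁ ∧ Metric.closedBall x₀ δ ⊆ s ∧
      ∀ ε t x, |ε| ≤ δ → |x - x₀| ≤ δ → |G ε t x - G 0 t x₀| ≤ ν := by
  obtain ⟨δ, hδ, hball⟩ := Metric.nhds_basis_closedBall.mem_iff.1 (hs.mem_nhds hx₀)
  have hK : IsCompact (Icc (-(ε₁ / 2)) (ε₁ / 2) ×ˢ Icc 0 P ×ˢ Metric.closedBall x₀ δ) :=
    isCompact_Icc.prod (isCompact_Icc.prod (isCompact_closedBall _ _))
  have huc := hK.uniformContinuousOn_of_continuous (hG.mono (prod_mono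
    (Icc_subset_Ioo (by linarith) (by linarith)) (prod_mono (subset_univ _) hball)))
  obtain ⟨δ', hδ', hu⟩ := Metric.uniformContinuousOn_iff.1 huc ν hν
  set d := min (δ' / 2) (min δ (ε₁ / 2)) with hd
  have hd0 : 0 < d := by positivity
  have hd1 : d ≤ δ' / 2 := min_le_left _ _
  have hd2 : d ≤ δ := (min_le_right _ _).trans (min_le_left _ _)
  have hd3 : d ≤ ε₁ / 2 := (min_le_right _ _).trans (min_le_right _ _)
  refine ⟨d, hd0, by linarith, (Metric.closedBall_subset_closedBall hd2).trans hball, ?_⟩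
  intro ε t x hε hx
  have hp : ∀ ε x, Function.Periodic (fun t => G ε t x) P := fun ε x t => hper ε t x
  obtain ⟨t', ht', h1⟩ : ∃ t' ∈ Icc 0 P, ∀ ε x, G ε t x = G ε t' x := by
    refine ⟨toIcoMod hP 0 t, ?_, fun ε x => ?_⟩
    · have := toIcoMod_mem_Ico hP 0 t
      rw [zero_add] at this
      exact Ico_subset_Icc_self this
    · have := (hp ε x).sub_zsmul_eq (x := t) (toIcoDiv hP 0 t)
      exact this.symm
  rw [h1, h1 0]
  have h2 := hu (ε, t', x) ⟨⟨by linarith [(abs_le.1 hε).1], by linarith [(abs_le.1 hε).2]⟩, ht', by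
      rw [Metric.mem_closedBall, Real.dist_eq]; linarith⟩ (0, t', x₀)
    ⟨⟨by linarith, by linarith⟩, ht', Metric.mem_closedBall_self hδ.le⟩ (by
      simp only [Prod.dist_eq, Real.dist_eq, dist_self]
      simp only [sub_zero, sup_lt_iff]
      exact ⟨by linarith, by linarith, by linarith⟩)
  rw [Real.dist_eq] at h2
  exact h2.le

/-- **Averaging for scalar periodic equations.** Near a simple zero of the averaged function, the
equation `x' = ε F ε t x` has for small `ε > 0` exactly one periodic solution; uniqueness is stated
for reparametrised solutions closing up after any number of periods. -/
theorem exists_periodic_solution_of_averaged_simple_zero {F F' : ℝ → ℝ → ℝ → ℝ} {P ε₁ : ℝ}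
    {s : Set ℝ} (hP : 0 < P) (hε₁ : 0 < ε₁) (hs : IsOpen s)
    (hF : ContinuousOn (fun x : ℝ × ℝ × ℝ => F x.1 x.2.1 x.2.2) (Ioo (-ε₁) ε₁ ×ˢ univ ×ˢ s))
    (hF' : ContinuousOn (fun x : ℝ × ℝ × ℝ => F' x.1 x.2.1 x.2.2) (Ioo (-ε₁) ε₁ ×ˢ univ ×ˢ s))
    (hd : ∀ ε ∈ Ioo (-ε₁) ε₁, ∀ t, ∀ x ∈ s, HasDerivAt (F ε t) (F' ε t x) x)
    (hper : ∀ ε t x, F ε (t + P) x = F ε t x) (hper' : ∀ ε t x, F' ε (t + P) x = F' ε t x)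
    {x₀ m : ℝ} (hx₀ : x₀ ∈ s) (h0 : ∫ t in 0..P, F 0 t x₀ = 0)
    (hm : HasDerivAt (fun x => ∫ t in 0..P, F 0 t x) m x₀) (hm0 : m ≠ 0) {δ₀ : ℝ} (hδ₀ : 0 < δ₀) :
    ∃ δ, 0 < δ ∧ δ ≤ δ₀ ∧ Metric.closedBall x₀ δ ⊆ s ∧ ∃ ε₀, 0 < ε₀ ∧ ε₀ ≤ ε₁ ∧
      ∀ ε, 0 < ε → ε < ε₀ → ∃ y : ℝ → ℝ,
        (∀ t, HasDerivAt y (ε * F ε t (y t)) t) ∧ (∀ t, y (t + P) = y t) ∧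
        (∀ t, |y t - x₀| < δ) ∧
        ∀ (φ σ κ : ℝ → ℝ) (T : ℝ) (n : ℕ), (∀ t, HasDerivAt φ (κ t) t) → (∀ t, 0 < κ t) →
          (∀ t, HasDerivAt σ (κ t * (ε * F ε (φ t) (σ t))) t) → (∀ t, |σ t - x₀| < δ) →
          0 < n → φ T = φ 0 + n * P → σ T = σ 0 → ∀ t, σ t = y (φ t) := by
  have h0m : (0 : ℝ) ∈ Ioo (-ε₁) ε₁ := ⟨by linarith, hε₁⟩
  have hcF : ∀ {G : ℝ → ℝ → ℝ → ℝ}, ContinuousOn (fun x : ℝ × ℝ × ℝ => G x.1 x.2.1 x.2.2)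
      (Ioo (-ε₁) ε₁ ×ˢ univ ×ˢ s) → ∀ ε ∈ Ioo (-ε₁) ε₁, ∀ x ∈ s, Continuous fun t => G ε t x := by
    intro G hG ε hε x hx
    have : ContinuousOn (fun t => G ε t x) univ :=
      hG.comp (f := fun t => (ε, t, x)) (by fun_prop) (fun t _ => ⟨hε, trivial, hx⟩)
    rwa [← continuousOn_univ]
  set D : ℝ → ℝ := fun t => F' 0 t x₀ with hDdef
  have hDc : Continuous D := hcF hF' 0 h0m x₀ hx₀
  have hDm : ∫ t in 0..P, D t = m := by
    refine (hasDerivAt_integral_of_continuousOn (f := fun x t => F 0 t x)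
      (f' := fun x t => F' 0 t x) hs ?_ ?_ (fun x hx t => hd 0 h0m t x hx) 0 P hx₀).unique hm
    · exact hF.comp (f := fun p : ℝ × ℝ => ((0 : ℝ), p.2, p.1)) (by fun_prop)
        (fun p hp => ⟨h0m, trivial, hp.1⟩)
    · exact hF'.comp (f := fun p : ℝ × ℝ => ((0 : ℝ), p.2, p.1)) (by fun_prop)
        (fun p hp => ⟨h0m, trivial, hp.1⟩)
  have hmpos : 0 < |m| := abs_pos.2 hm0
  -- This choice gives Pμ = |m|/2, strictly below |m| as uniqueness requires.
  set μ := |m| / (2 * P) with hμ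
  have hμ0 : 0 < μ := by positivity
  have hPμ : P * μ = |m| / 2 := by rw [hμ]; field_simp
  obtain ⟨δ₁, hδ₁, hδ₁ε, hδ₁s, hu1⟩ := exists_uniform_bound hP hε₁ hs hF' hper' hx₀ hμ0
  obtain ⟨δ₂, hδ₂, hδ₂ε, hδ₂s, hu2⟩ := exists_uniform_bound hP hε₁ hs hF hper hx₀ one_pos
  set δ := min δ₀ (min δ₁ δ₂) with hδdef
  have hδ : 0 < δ := by positivity
  have hδa : δ ≤ δ₀ := min_le_left _ _
  have hδb : δ ≤ δ₁ := (min_le_right _ _).trans (min_le_left _ _)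
  have hδc : δ ≤ δ₂ := (min_le_right _ _).trans (min_le_right _ _)
  have hIs : ∀ x, |x - x₀| ≤ δ → x ∈ s := fun x hx => hδ₁s (by
    rw [Metric.mem_closedBall, Real.dist_eq]; linarith)
  -- the affine approximation
  have haff : ∀ ε, |ε| ≤ δ₁ → ∀ t, ∀ x ∈ Icc (x₀ - δ) (x₀ + δ), ∀ y ∈ Icc (x₀ - δ) (x₀ + δ),
      |F ε t x - F ε t y - D t * (x - y)| ≤ μ * |x - y| := by
    intro ε hε t x hx y hy
    have hεm : ε ∈ Ioo (-ε₁) ε₁ := abs_lt.1 (by linarith)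
    have := Convex.norm_image_sub_le_of_norm_hasDerivWithin_le (f := fun x => F ε t x - D t * x)
      (f' := fun x => F' ε t x - D t * 1) (C := μ) (s := Icc (x₀ - δ) (x₀ + δ)) (x := y) (y := x)
      (fun z hz => ((hd ε hεm t z (hIs z (abs_le.2 ⟨by linarith [hz.1], by linarith [hz.2]⟩))).sub
        ((hasDerivAt_id z).const_mul (D t))).hasDerivWithinAt)
      (fun z hz => by
        rw [mul_one, Real.norm_eq_abs]
        exact hu1 ε t z hε (abs_le.2 ⟨by linarith [hz.1], by linarith [hz.2]⟩))
      (convex_Icc _ _) hy hx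
    simp only [Real.norm_eq_abs] at this
    rwa [show F ε t x - F ε t y - D t * (x - y) = F ε t x - D t * x - (F ε t y - D t * y) by ring]
  obtain ⟨L₀, hL₀⟩ : ∃ L₀, ∀ t, |F 0 t x₀| ≤ L₀ := by
    have hc := hcF hF 0 h0m x₀ hx₀
    obtain ⟨C, hC⟩ := isCompact_Icc.exists_bound_of_continuousOn (s := Icc 0 P) hc.continuousOn
    refine ⟨C, fun t => ?_⟩
    have hp : Function.Periodic (fun t => F 0 t x₀) P := fun t => hper 0 t x₀
    have := hp.sub_zsmul_eq (x := t) (toIcoDiv hP 0 t)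
    rw [← show F 0 (toIcoMod hP 0 t) x₀ = F 0 t x₀ from this]
    have h2 := toIcoMod_mem_Ico hP 0 t
    rw [zero_add] at h2
    exact hC _ (Ico_subset_Icc_self h2)
  obtain ⟨L₁, hL₁⟩ : ∃ L₁, ∀ t, |D t| ≤ L₁ := by
    obtain ⟨C, hC⟩ := isCompact_Icc.exists_bound_of_continuousOn (s := Icc 0 P) hDc.continuousOn
    refine ⟨C, fun t => ?_⟩
    have hp : Function.Periodic D P := fun t => hper' 0 t x₀
    have := hp.sub_zsmul_eq (x := t) (toIcoDiv hP 0 t)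
    rw [← this]
    have h2 := toIcoMod_mem_Ico hP 0 t
    rw [zero_add] at h2
    exact hC _ (Ico_subset_Icc_self h2)
  have hL₀' : 0 ≤ L₀ := (abs_nonneg _).trans (hL₀ 0)
  have hL₁' : 0 ≤ L₁ := (abs_nonneg _).trans (hL₁ 0)
  have hFbd : ∀ ε, |ε| ≤ δ₂ → ∀ t x, |x - x₀| ≤ δ → |F ε t x| ≤ L₀ + 1 := by
    intro ε hε t x hx
    have h1 := hu2 ε t x hε (by linarith)
    have h2 := hL₀ t
    rw [abs_le] at *
    constructor <;> linarith [h1.1, h1.2, h2.1, h2.2]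
  -- At x₀ ± ρ the averaged function has opposite signs and size at least |m|ρ/2. The displacement
  -- over a period equals ε times it up to ε|m|ρ/4 (the choice of `ν` below), so the displacement
  -- changes sign too.
  set ρ := δ / 2 with hρ
  have hρ0 : 0 < ρ := by positivity
  set M₀ : ℝ → ℝ := fun x => ∫ t in 0..P, F 0 t x with hM₀
  have hM₀b : ∀ x, |x - x₀| ≤ δ → |M₀ x - m * (x - x₀)| ≤ |m| / 2 * |x - x₀| := by
    intro x hx
    have h1 : M₀ x - m * (x - x₀) = ∫ t in 0..P, (F 0 t x - F 0 t x₀ - D t * (x - x₀)) := by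
      have i1 := (hcF hF 0 h0m x (hIs x hx)).intervalIntegrable (μ := volume) 0 P
      have i2 := (hcF hF 0 h0m x₀ hx₀).intervalIntegrable (μ := volume) 0 P
      have i3 : IntervalIntegrable (fun t => D t * (x - x₀)) volume 0 P :=
        (hDc.mul continuous_const).intervalIntegrable 0 P
      rw [intervalIntegral.integral_sub (i1.sub i2) i3, intervalIntegral.integral_sub i1 i2, h0,
        intervalIntegral.integral_mul_const, hDm, sub_zero]
    rw [h1]
    have := intervalIntegral.norm_integral_le_of_norm_le_const (a := 0) (b := P)
      (f := fun t => F 0 t x - F 0 t x₀ - D t * (x - x₀)) (C := μ * |x - x₀|)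
      (fun t _ => haff 0 (by rw [abs_zero]; exact hδ₁.le) t x
        ⟨by linarith [(abs_le.1 hx).1], by linarith [(abs_le.1 hx).2]⟩ x₀
        ⟨by linarith, by linarith⟩)
    rw [Real.norm_eq_abs, sub_zero, abs_of_pos hP] at this
    calc _ ≤ _ := this
      _ = P * μ * |x - x₀| := by ring
      _ = _ := by rw [hPμ]
  set ν := |m| * ρ / (4 * P) with hν
  have hν0 : 0 < ν := by positivity
  have hPν : ν * P = |m| * ρ / 4 := by rw [hν]; field_simp
  have hx1 : x₀ - ρ ∈ s := hIs _ (by rw [sub_sub_cancel_left, abs_neg, abs_of_pos hρ0]; linarith)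
  have hx2 : x₀ + ρ ∈ s := hIs _ (by rw [add_sub_cancel_left, abs_of_pos hρ0]; linarith)
  obtain ⟨δ₃, hδ₃, -, -, hu3⟩ := exists_uniform_bound hP hε₁ hs hF hper hx1 hν0
  obtain ⟨δ₄, hδ₄, -, -, hu4⟩ := exists_uniform_bound hP hε₁ hs hF hper hx2 hν0
  -- Within one period a solution drifts by at most `d ≤ δ/4`. Starting within δ/2 of x₀ it stays
  -- within 3δ/4, where the cut-off introduced below is inactive.
  set d := min (min δ₃ δ₄) (δ / 4) with hddef
  have hd0 : 0 < d := by positivity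
  have hd3 : d ≤ δ₃ := (min_le_left _ _).trans (min_le_left _ _)
  have hd4 : d ≤ δ₄ := (min_le_left _ _).trans (min_le_right _ _)
  have hdδ : d ≤ δ / 4 := min_le_right _ _
  set ε₀ := min d (d / ((L₀ + 1) * P)) with hε₀def
  have hε₀ : 0 < ε₀ := by positivity
  have hε₀d : ε₀ ≤ d := min_le_left _ _
  have hε₀L : ε₀ * ((L₀ + 1) * P) ≤ d := by
    rw [← le_div_iff₀ (by positivity)]; exact min_le_right _ _
  refine ⟨δ, hδ, hδa, (Metric.closedBall_subset_closedBall hδb).trans hδ₁s, ε₀, hε₀,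
    by linarith, fun ε hε hεlt => ?_⟩
  have hεabs : |ε| = ε := abs_of_pos hε
  have hle : x₀ - δ ≤ x₀ + δ := by linarith
  -- Composing with the projection onto [x₀ - δ, x₀ + δ] makes the right-hand side globally bounded
  -- and Lipschitz.
  set g : ℝ → ℝ → ℝ := fun t x => ε * F ε t (projIcc (x₀ - δ) (x₀ + δ) hle x) with hg
  have hproj : ∀ x, |(projIcc (x₀ - δ) (x₀ + δ) hle x : ℝ) - x₀| ≤ δ := fun x => by
    have := (projIcc (x₀ - δ) (x₀ + δ) hle x).2
    exact abs_le.2 ⟨by linarith [this.1], by linarith [this.2]⟩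
  have hprojeq : ∀ x, |x - x₀| ≤ δ → (projIcc (x₀ - δ) (x₀ + δ) hle x : ℝ) = x := fun x hx => by
    rw [projIcc_of_mem hle ⟨by linarith [(abs_le.1 hx).1], by linarith [(abs_le.1 hx).2]⟩]
  have hgbd : ∀ t x, |g t x| ≤ ε * (L₀ + 1) := by
    intro t x
    simp only [hg]
    rw [abs_mul, hεabs]
    exact mul_le_mul_of_nonneg_left (hFbd ε (by linarith) t _ (hproj x)) hε.le
  have hεm : ε ∈ Ioo (-ε₁) ε₁ := abs_lt.1 (by linarith)
  -- a solution moves little over a period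
  have hmove : ∀ α : ℝ → ℝ, (∀ t ∈ Icc 0 P, HasDerivWithinAt α (g t (α t)) (Icc 0 P) t) →
      ∀ t ∈ Icc 0 P, |α t - α 0| ≤ d := by
    intro α hα t ht
    have := norm_image_sub_le_of_norm_deriv_le_segment' (C := ε * (L₀ + 1)) hα
      (fun t _ => hgbd t (α t)) t ht
    rw [Real.norm_eq_abs, sub_zero] at this
    have h3 : ε * (L₀ + 1) * t ≤ ε₀ * (L₀ + 1) * P :=
      mul_le_mul (mul_le_mul_of_nonneg_right hεlt.le (by linarith)) ht.2 ht.1 (by positivity)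
    linarith
  -- displacement of a solution starting at `x₁`
  have hdisp : ∀ x₁ δ', (∀ ε t x, |ε| ≤ δ' → |x - x₁| ≤ δ' → |F ε t x - F 0 t x₁| ≤ ν) → d ≤ δ' →
      |x₁ - x₀| ≤ ρ → ∀ α : ℝ → ℝ, α 0 = x₁ →
      (∀ t ∈ Icc 0 P, HasDerivWithinAt α (g t (α t)) (Icc 0 P) t) →
      |α P - x₁ - ε * M₀ x₁| ≤ ε * (|m| * ρ / 4) := by
    intro x₁ δ' hu hδ' hx₁ α hα0 hα
    have hc1 := hcF hF 0 h0m x₁ (hIs x₁ (by linarith))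
    have hI : ∀ t, HasDerivAt (fun t => ∫ u in 0..t, F 0 u x₁) (F 0 t x₁) t := fun t =>
      intervalIntegral.integral_hasDerivAt_right (hc1.intervalIntegrable _ _)
        (hc1.stronglyMeasurableAtFilter _ _) hc1.continuousAt
    have := norm_image_sub_le_of_norm_deriv_le_segment' (C := ε * ν)
      (f := fun t => α t - ε * ∫ u in 0..t, F 0 u x₁)
      (f' := fun t => g t (α t) - ε * F 0 t x₁) (a := 0) (b := P)
      (fun t ht => (hα t ht).sub (((hI t).const_mul ε).hasDerivWithinAt))
      (fun t ht => by
        have h1 := hmove α hα t (Ico_subset_Icc_self ht)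
        rw [hα0] at h1
        have h2 : |α t - x₀| ≤ δ := by
          have := abs_sub_le (α t) x₁ x₀
          linarith
        simp only [hg, hprojeq _ h2]
        rw [← mul_sub, Real.norm_eq_abs, abs_mul, hεabs]
        exact mul_le_mul_of_nonneg_left (hu ε t _ (by linarith) (by linarith)) hε.le) P ⟨hP.le, le_rfl⟩
    simp only [intervalIntegral.integral_same, mul_zero, sub_zero, hα0, Real.norm_eq_abs] at this
    calc |α P - x₁ - ε * M₀ x₁| = |α P - ε * M₀ x₁ - x₁| := by congr 1; ring
      _ ≤ ε * ν * P := this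
      _ = ε * (|m| * ρ / 4) := by rw [mul_assoc, hPν]
  obtain ⟨Kc, hKc⟩ : ∃ K : ℝ≥0, (K : ℝ) = ε * (L₁ + μ) := ⟨⟨_, by positivity⟩, rfl⟩
  obtain ⟨Lc, hLc⟩ : ∃ K : ℝ≥0, (K : ℝ) = ε * (L₀ + 1) := ⟨⟨_, by positivity⟩, rfl⟩
  obtain ⟨y, hyd, hyP, hy0⟩ := exists_periodic_solution (g := g) (P := P) (x₁ := x₀ - ρ)
    (x₂ := x₀ + ρ) (K := Kc) (L := Lc) hP (fun t x => by simp only [hg, hper])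
    (fun t => by
      refine LipschitzWith.of_dist_le_mul fun x z => ?_
      have h1 := haff ε (by linarith) t _ (projIcc (x₀ - δ) (x₀ + δ) hle x).2 _
        (projIcc (x₀ - δ) (x₀ + δ) hle z).2
      have h2 : |(projIcc (x₀ - δ) (x₀ + δ) hle x : ℝ) - projIcc (x₀ - δ) (x₀ + δ) hle z| ≤ |x - z| := by
        have := (LipschitzWith.projIcc hle).dist_le_mul x z
        simpa [Real.dist_eq, Subtype.dist_eq] using this
      rw [Real.dist_eq, Real.dist_eq, hKc]
      simp only [hg]
      rw [← mul_sub, abs_mul, hεabs, mul_assoc]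
      refine mul_le_mul_of_nonneg_left ?_ hε.le
      set a := (projIcc (x₀ - δ) (x₀ + δ) hle x : ℝ)
      set b := (projIcc (x₀ - δ) (x₀ + δ) hle z : ℝ)
      have h3 : |D t * (a - b)| ≤ L₁ * |a - b| := by
        rw [abs_mul]; exact mul_le_mul_of_nonneg_right (hL₁ t) (abs_nonneg _)
      have h4 : |F ε t a - F ε t b| ≤ (L₁ + μ) * |a - b| := by
        have := abs_add_le (F ε t a - F ε t b - D t * (a - b)) (D t * (a - b))
        rw [sub_add_cancel] at this
        linarith
      exact h4.trans (mul_le_mul_of_nonneg_left h2 (by positivity)))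
    (fun x => (hcF hF ε hεm _ (hIs _ (hproj x))).const_mul ε |>.congr fun t => rfl)
    (fun t x => by rw [hLc]; exact hgbd t x) (by linarith)
    (by
      intro α β hα0 hβ0 hα hβ
      have a1 := hdisp (x₀ - ρ) δ₃ hu3 hd3 (by rw [sub_sub_cancel_left, abs_neg, abs_of_pos hρ0])
        α hα0 hα
      have b1 := hdisp (x₀ + ρ) δ₄ hu4 hd4 (by rw [add_sub_cancel_left, abs_of_pos hρ0]) β hβ0 hβ
      have a2 := hM₀b (x₀ - ρ) (by rw [sub_sub_cancel_left, abs_neg, abs_of_pos hρ0]; linarith)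
      have b2 := hM₀b (x₀ + ρ) (by rw [add_sub_cancel_left, abs_of_pos hρ0]; linarith)
      rw [sub_sub_cancel_left, abs_neg, abs_of_pos hρ0] at a2
      rw [add_sub_cancel_left, abs_of_pos hρ0] at b2
      rw [abs_le] at a1 b1 a2 b2
      have a3 := mul_le_mul_of_nonneg_left a2.1 hε.le
      have a4 := mul_le_mul_of_nonneg_left a2.2 hε.le
      have b3 := mul_le_mul_of_nonneg_left b2.1 hε.le
      have b4 := mul_le_mul_of_nonneg_left b2.2 hε.le
      have hpos : 0 < ε * |m| * ρ := by positivity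
      rcases lt_or_gt_of_ne hm0 with h | h
      · rw [abs_of_neg h] at *
        refine mul_nonpos_iff.2 (Or.inl ⟨by linarith, by linarith⟩)
      · rw [abs_of_pos h] at *
        refine mul_nonpos_iff.2 (Or.inr ⟨by linarith, by linarith⟩))
  have hyb : ∀ t, |y t - x₀| < δ := by
    intro t
    have hp : Function.Periodic y P := hyP
    have h1 := hp.sub_zsmul_eq (x := t) (toIcoDiv hP 0 t)
    have h2 := toIcoMod_mem_Ico hP 0 t
    rw [zero_add] at h2
    have h3 := hmove y (fun t _ => (hyd t).hasDerivWithinAt) _ (Ico_subset_Icc_self h2)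
    rw [show y (toIcoMod hP 0 t) = y t from h1] at h3
    rw [abs_lt]
    rw [abs_le] at h3
    constructor <;> linarith [hy0.1, hy0.2, h3.1, h3.2]
  have hyd' : ∀ t, HasDerivAt y (ε * F ε t (y t)) t := fun t => by
    have := hyd t
    simp only [hg, hprojeq _ (hyb t).le] at this
    exact this
  refine ⟨y, hyd', hyP, hyb, ?_⟩
  intro φ σ κ T n hφ hκ hσ hσb hn hφT hσT
  have hI : ∀ x, |x - x₀| < δ → x ∈ Icc (x₀ - δ) (x₀ + δ) := fun x hx =>
    ⟨by linarith [(abs_lt.1 hx).1], by linarith [(abs_lt.1 hx).2]⟩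
  exact periodic_solution_unique (F := F ε) (I := Icc (x₀ - δ) (x₀ + δ)) hDc
    (fun t => hper' 0 t x₀) hDm (by rw [hPμ]; linarith) hε hP (haff ε (by linarith)) hyd' hyP
    (fun t => hI _ (hyb t)) hφ hκ hσ (fun t => hI _ (hσb t)) hn hφT hσT

/-! ### Remainders of prescribed order in σ, with C¹ control -/

/-- `f` is `x.1 ^ n` times a continuously differentiable function on `O`. -/
def FlatOn (O : Set (ℝ × ℝ × ℝ)) (n : ℕ) (f : ℝ × ℝ × ℝ → ℝ) : Prop :=
  ∃ E : ℝ × ℝ × ℝ → ℝ, ContDiffOn ℝ 1 E O ∧ ∀ x ∈ O, f x = x.1 ^ n * E x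

namespace FlatOn

variable {O : Set (ℝ × ℝ × ℝ)} {m n : ℕ} {f g : ℝ × ℝ × ℝ → ℝ}

lemma congr (hf : FlatOn O n f) (h : ∀ x ∈ O, g x = f x) : FlatOn O n g := by
  obtain ⟨E, hE, he⟩ := hf
  exact ⟨E, hE, fun x hx => (h x hx).trans (he x hx)⟩

lemma of_contDiffOn (hf : ContDiffOn ℝ 1 f O) : FlatOn O 0 f :=
  ⟨f, hf, fun x _ => by simp⟩

lemma contDiffOn (hf : FlatOn O n f) : ContDiffOn ℝ 1 f O := by
  obtain ⟨E, hE, he⟩ := hf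
  exact ((contDiffOn_fst.pow n).mul hE).congr he

lemma const (c : ℝ) : FlatOn O 0 fun _ => c := of_contDiffOn contDiffOn_const

lemma zero : FlatOn O n fun _ => 0 := ⟨fun _ => 0, contDiffOn_const, fun x _ => by simp⟩

lemma mono (hf : FlatOn O n f) (h : m ≤ n) : FlatOn O m f := by
  obtain ⟨E, hE, he⟩ := hf
  refine ⟨fun x => x.1 ^ (n - m) * E x, (contDiffOn_fst.pow _).mul hE, fun x hx => ?_⟩
  rw [he x hx, ← mul_assoc, ← pow_add, Nat.add_sub_cancel' h]

lemma add (hf : FlatOn O n f) (hg : FlatOn O n g) : FlatOn O n fun x => f x + g x := by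
  obtain ⟨E, hE, he⟩ := hf
  obtain ⟨E', hE', he'⟩ := hg
  exact ⟨fun x => E x + E' x, hE.add hE', fun x hx => by simp only [he x hx, he' x hx]; ring⟩

lemma mul (hf : FlatOn O m f) (hg : FlatOn O n g) : FlatOn O (m + n) fun x => f x * g x := by
  obtain ⟨E, hE, he⟩ := hf
  obtain ⟨E', hE', he'⟩ := hg
  exact ⟨fun x => E x * E' x, hE.mul hE', fun x hx => by simp only [he x hx, he' x hx]; ring⟩

lemma mul_left (hf : FlatOn O 0 f) (hg : FlatOn O n g) : FlatOn O n fun x => f x * g x := by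
  simpa using hf.mul hg

lemma const_mul (c : ℝ) (hf : FlatOn O n f) : FlatOn O n fun x => c * f x := (const c).mul_left hf

lemma sub (hf : FlatOn O n f) (hg : FlatOn O n g) : FlatOn O n fun x => f x - g x :=
  (hf.add (hg.const_mul (-1))).congr fun x _ => by ring

lemma pow (hf : FlatOn O m f) (k : ℕ) : FlatOn O (m * k) fun x => f x ^ k := by
  obtain ⟨E, hE, he⟩ := hf
  exact ⟨fun x => E x ^ k, hE.pow k, fun x hx => by simp only [he x hx]; ring⟩

lemma sum {ι : Type*} (s : Finset ι) {F : ι → ℝ × ℝ × ℝ → ℝ} (h : ∀ i ∈ s, FlatOn O n (F i)) :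
    FlatOn O n fun x => ∑ i ∈ s, F i x := by
  classical
  induction s using Finset.induction_on with
  | empty => simpa using zero
  | insert i s hi ih =>
    refine ((h i (Finset.mem_insert_self _ _)).add
      (ih fun j hj => h j (Finset.mem_insert_of_mem hj))).congr fun x _ => ?_
    rw [Finset.sum_insert hi]

lemma div (hf : FlatOn O n f) (hg : ContDiffOn ℝ 1 g O) (h : ∀ x ∈ O, g x ≠ 0) :
    FlatOn O n fun x => f x / g x :=
  ((of_contDiffOn (hg.inv h)).mul_left hf).congr fun x _ => by rw [div_eq_mul_inv, mul_comm]; rfl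

end FlatOn

/-! ### Truncated power series with rational coefficients -/

/-- Exponents `(i, j)` of weight `i + 2 j ≤ 12`. -/
def lowWeight : Finset (ℕ × ℕ) := (Finset.range 13 ×ˢ Finset.range 7).filter fun p => p.1 + 2 * p.2 ≤ 12

lemma mem_lowWeight {p : ℕ × ℕ} : p ∈ lowWeight ↔ p.1 + 2 * p.2 ≤ 12 := by
  simp only [lowWeight, Finset.mem_filter, Finset.mem_product, Finset.mem_range]
  omega

/-- The polynomial in two variables with coefficients `f`, truncated at weight `12`. -/
noncomputable def lowPoly (f : ℕ → ℕ → ℚ) (a b : ℝ) : ℝ :=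
  ∑ p ∈ lowWeight, (f p.1 p.2 : ℝ) * (a ^ p.1 * b ^ p.2)

/-- The Cauchy product of two families of coefficients. -/
def cauchyCoeff (f g : ℕ → ℕ → ℚ) (i j : ℕ) : ℚ :=
  ∑ p ∈ Finset.range (i + 1), ∑ q ∈ Finset.range (j + 1), f p q * g (i - p) (j - q)

lemma lowPoly_congr {f g : ℕ → ℕ → ℚ} (h : ∀ p ∈ lowWeight, f p.1 p.2 = g p.1 p.2) (a b : ℝ) :
    lowPoly f a b = lowPoly g a b :=
  Finset.sum_congr rfl fun p hp => by rw [h p hp]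

lemma lowPoly_add (f g : ℕ → ℕ → ℚ) (a b : ℝ) :
    lowPoly f a b + lowPoly g a b = lowPoly (fun i j => f i j + g i j) a b := by
  simp only [lowPoly, ← Finset.sum_add_distrib]
  refine Finset.sum_congr rfl fun p _ => by push_cast; ring

lemma flatOn_monomial {O : Set (ℝ × ℝ × ℝ)} {a b : ℝ × ℝ × ℝ → ℝ} (ha : FlatOn O 1 a)
    (hb : FlatOn O 2 b) (i j : ℕ) : FlatOn O (i + 2 * j) fun x => a x ^ i * b x ^ j := by
  simpa using (ha.pow i).mul (hb.pow j)

lemma flatOn_lowPoly {O : Set (ℝ × ℝ × ℝ)} {a b : ℝ × ℝ × ℝ → ℝ} (ha : FlatOn O 1 a)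
    (hb : FlatOn O 2 b) (f : ℕ → ℕ → ℚ) : FlatOn O 0 fun x => lowPoly f (a x) (b x) :=
  FlatOn.sum _ fun p _ => ((flatOn_monomial ha hb p.1 p.2).mono (Nat.zero_le _)).const_mul _

set_option linter.constructorNameAsVariable false in
/-- Truncated multiplication: the product of truncated series is the truncated Cauchy product up to
terms of weight at least `13`. -/
lemma flatOn_lowPoly_mul {O : Set (ℝ × ℝ × ℝ)} {a b : ℝ × ℝ × ℝ → ℝ} (ha : FlatOn O 1 a)
    (hb : FlatOn O 2 b) (f g : ℕ → ℕ → ℚ) : FlatOn O 13 fun x =>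
      lowPoly f (a x) (b x) * lowPoly g (a x) (b x) - lowPoly (cauchyCoeff f g) (a x) (b x) := by
  classical
  -- Truncation loses exactly the products whose exponents add up to weight at least 13. Weight
  -- bounds the order in σ from below, because `a` has order 1 and `b` has order 2.
  set S := (lowWeight ×ˢ lowWeight).filter fun q => ¬ (q.1 + q.2 ∈ lowWeight) with hS
  have hflat : FlatOn O 13 fun x => ∑ q ∈ S, ((f q.1.1 q.1.2 * g q.2.1 q.2.2 : ℚ) : ℝ) *
      (a x ^ (q.1.1 + q.2.1) * b x ^ (q.1.2 + q.2.2)) := by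
    refine FlatOn.sum _ fun q hq => ((flatOn_monomial ha hb _ _).mono ?_).const_mul _
    rw [hS, Finset.mem_filter, mem_lowWeight] at hq
    have := hq.2
    simp only [Prod.fst_add, Prod.snd_add] at this
    omega
  refine hflat.congr fun x _ => ?_
  rw [sub_eq_iff_eq_add, lowPoly, lowPoly, Finset.sum_mul_sum, ← Finset.sum_product',
    ← Finset.sum_filter_add_sum_filter_not (lowWeight ×ˢ lowWeight) (fun q => q.1 + q.2 ∈ lowWeight),
    add_comm]
  congr 1
  · refine Finset.sum_congr rfl fun q _ => ?_
    push_cast; ring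
  · have h1 : lowPoly (cauchyCoeff f g) (a x) (b x) = ∑ t ∈ lowWeight,
        ∑ p ∈ Finset.range (t.1 + 1) ×ˢ Finset.range (t.2 + 1),
          ((f p.1 p.2 * g (t.1 - p.1) (t.2 - p.2) : ℚ) : ℝ) * (a x ^ t.1 * b x ^ t.2) := by
      refine Finset.sum_congr rfl fun t _ => ?_
      rw [cauchyCoeff, ← Finset.sum_product', Rat.cast_sum, Finset.sum_mul]
    rw [h1, Finset.sum_sigma']
    refine Finset.sum_bij' (fun q _ => ⟨q.1 + q.2, q.1⟩) (fun s _ => (s.2, s.1 - s.2)) ?_ ?_ ?_ ?_ ?_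
    · rintro ⟨p, q⟩ h
      simp only [Finset.mem_filter, Finset.mem_product] at h
      simp only [Finset.mem_sigma, Finset.mem_product, Finset.mem_range, Prod.fst_add, Prod.snd_add]
      exact ⟨h.2, by omega, by omega⟩
    · rintro ⟨t, p⟩ h
      simp only [Finset.mem_sigma, Finset.mem_product, Finset.mem_range] at h
      have hle : p ≤ t := ⟨by omega, by omega⟩
      simp only [Finset.mem_filter, Finset.mem_product, add_tsub_cancel_of_le hle]
      rw [mem_lowWeight] at *
      simp only [mem_lowWeight, Prod.fst_sub, Prod.snd_sub]
      refine ⟨⟨?_, ?_⟩, ?_⟩ <;> omega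
    · rintro ⟨p, q⟩ h
      simp
    · rintro ⟨t, p⟩ h
      simp only [Finset.mem_sigma, Finset.mem_product, Finset.mem_range] at h
      have hle : p ≤ t := ⟨by omega, by omega⟩
      simp [add_tsub_cancel_of_le hle]
    · rintro ⟨p, q⟩ h
      simp only [Prod.fst_add, Prod.snd_add, add_tsub_cancel_left]
      push_cast; ring

/-- Generalised binomial coefficients. -/
def genBinom (a : ℚ) : ℕ → ℚ
  | 0 => 1
  | m + 1 => genBinom a m * (a - m) / (m + 1)

/-- Taylor coefficients of `X ^ k`, where `X ^ 2 * (1 + 2 a X + 2 b X ^ 2) = 1`. -/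
def radialCoeff (k i j : ℕ) : ℚ :=
  k / (i + 2 * j + k : ℕ) * genBinom (-((i + 2 * j + k : ℕ) : ℚ) / 2) (i + j) *
    (i + j).choose i * 2 ^ (i + j)

/-- Taylor coefficients in `w` of `y ^ l / y`, where `y ^ 2 = 1 - 2 w`. -/
def rootCoeff : ℕ → ℕ → ℚ
  | 0, a => (2 * a).choose a / 2 ^ a
  | 1, a => if a = 0 then 1 else 0
  | l + 2, 0 => rootCoeff l 0
  | l + 2, a + 1 => rootCoeff l (a + 1) - 2 * rootCoeff l a

/-- The coefficients of a single monomial. -/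
def monoCoeff (c : ℚ) (m n i j : ℕ) : ℚ := if i = m ∧ j = n then c else 0

lemma lowPoly_monoCoeff (c : ℚ) {m n : ℕ} (h : m + 2 * n ≤ 12) (a b : ℝ) :
    lowPoly (monoCoeff c m n) a b = c * (a ^ m * b ^ n) := by
  rw [lowPoly, Finset.sum_eq_single (m, n)]
  · simp [monoCoeff]
  · intro p _ hp
    have : ¬ (p.1 = m ∧ p.2 = n) := fun h => hp (Prod.ext h.1 h.2)
    simp [monoCoeff, this]
  · intro hn
    exact absurd (mem_lowWeight.2 h) hn

/-- The closed form is what Lagrange inversion gives for v = zX, that is, for v = z (1 + 2αv +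
2βv²)^(-1/2). It is not derived here: it is only checked, through weight 12, that the families for
X², X³, X⁴ are the powers of the family for X. -/
lemma radialCoeff_conv_one_one : ∀ p ∈ lowWeight,
    cauchyCoeff (radialCoeff 1) (radialCoeff 1) p.1 p.2 = radialCoeff 2 p.1 p.2 := by
  decide +kernel

lemma radialCoeff_conv_one_two : ∀ p ∈ lowWeight,
    cauchyCoeff (radialCoeff 1) (radialCoeff 2) p.1 p.2 = radialCoeff 3 p.1 p.2 := by
  decide +kernel

lemma radialCoeff_conv_one_three : ∀ p ∈ lowWeight,
    cauchyCoeff (radialCoeff 1) (radialCoeff 3) p.1 p.2 = radialCoeff 4 p.1 p.2 := by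
  decide +kernel

/-- This is X² + 2aX³ + 2bX⁴ = 1 coefficient by coefficient. Together with the convolution
identities it makes the truncated series an approximate root of the defining equation. -/
lemma radialCoeff_equation : ∀ p ∈ lowWeight,
    radialCoeff 2 p.1 p.2 + cauchyCoeff (monoCoeff 2 1 0) (radialCoeff 3) p.1 p.2 +
      cauchyCoeff (monoCoeff 2 0 1) (radialCoeff 4) p.1 p.2 = monoCoeff 1 0 0 p.1 p.2 := by
  decide +kernel

/-! ### The radial factor X = v / z -/

/-- Local solution `X` of `X ^ 2 * (1 + 2 a X + 2 b X ^ 2) = 1` near `a = b = 0`, `X = 1`. -/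
lemma exists_radialFactor : ∃ (X : ℝ × ℝ → ℝ) (ρ : ℝ), 0 < ρ ∧
    ContDiffOn ℝ 1 X (Metric.ball 0 ρ) ∧
    (∀ p ∈ Metric.ball (0 : ℝ × ℝ) ρ, 1 / 2 < X p ∧ X p < 2 ∧
      X p ^ 2 * (1 + 2 * p.1 * X p + 2 * p.2 * X p ^ 2) = 1) ∧
    ∃ ρ', 0 < ρ' ∧ ∀ q ∈ Metric.ball (0 : ℝ × ℝ) ρ', 0 < 1 + 2 * q.1 + 2 * q.2 ∧
      (q.1 * √(1 + 2 * q.1 + 2 * q.2), q.2 * (1 + 2 * q.1 + 2 * q.2)) ∈ Metric.ball (0 : ℝ × ℝ) ρ ∧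
      X (q.1 * √(1 + 2 * q.1 + 2 * q.2), q.2 * (1 + 2 * q.1 + 2 * q.2)) *
        √(1 + 2 * q.1 + 2 * q.2) = 1 := by
  set ℓ : ℝ × ℝ → ℝ := fun q => 1 + 2 * q.1 + 2 * q.2 with hℓ
  -- In the parameters q = (aX, bX²) the equation is solved explicitly by X = ℓ(q)^(-1/2), with a =
  -- q₁ √ℓ and b = q₂ ℓ. The map `Θ : q ↦ (a, b)` has identity derivative at 0, so the inverse
  -- function theorem gives both X and its local uniqueness, which is the last clause of the
  -- statement.
  set Θ : ℝ × ℝ → ℝ × ℝ := fun q => (q.1 * √(ℓ q), q.2 * ℓ q) with hΘ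
  have hℓ0 : ℓ 0 = 1 := by simp [hℓ]
  have hℓc : ContDiff ℝ 1 ℓ := by simp only [hℓ]; fun_prop
  have hsq : ContDiffAt ℝ 1 (fun q => √(ℓ q)) 0 :=
    hℓc.contDiffAt.sqrt (by rw [hℓ0]; exact one_ne_zero)
  have hΘc : ContDiffAt ℝ 1 Θ 0 := (contDiffAt_fst.mul hsq).prodMk (contDiffAt_snd.mul hℓc.contDiffAt)
  have hΘ' : HasFDerivAt Θ ((ContinuousLinearEquiv.refl ℝ (ℝ × ℝ) : (ℝ × ℝ) ≃L[ℝ] (ℝ × ℝ)) :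
      (ℝ × ℝ) →L[ℝ] (ℝ × ℝ)) 0 := by
    have h1 := (hasFDerivAt_fst (𝕜 := ℝ) (p := (0 : ℝ × ℝ))).mul
      (hsq.differentiableAt one_ne_zero).hasFDerivAt
    have h2 := (hasFDerivAt_snd (𝕜 := ℝ) (p := (0 : ℝ × ℝ))).mul
      (hℓc.contDiffAt.differentiableAt (x := 0) one_ne_zero).hasFDerivAt
    refine (h1.prodMk h2).congr_fderiv ?_
    ext <;> simp [hℓ0]
  set e := hΘc.toOpenPartialHomeomorph Θ hΘ' one_ne_zero with he
  have heΘ : ∀ q, e q = Θ q := fun q => rfl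
  have h0s : (0 : ℝ × ℝ) ∈ e.source := hΘc.mem_toOpenPartialHomeomorph_source hΘ' one_ne_zero
  have hΘ0 : Θ 0 = 0 := by simp [hΘ]
  have h0t : (0 : ℝ × ℝ) ∈ e.target := by
    have := e.map_source h0s
    rwa [heΘ, hΘ0] at this
  have hs0 : e.symm 0 = 0 := by
    have := e.left_inv h0s
    rwa [heΘ, hΘ0] at this
  have hsc : ContDiffAt ℝ 1 e.symm 0 := by
    have := hΘc.to_localInverse hΘ' one_ne_zero
    rw [hΘ0] at this
    exact this
  set X : ℝ × ℝ → ℝ := fun p => (√(ℓ (e.symm p)))⁻¹ with hX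
  have hX0 : X 0 = 1 := by simp [hX, hs0, hℓ0]
  have hXc : ContDiffAt ℝ 1 X 0 := by
    have hℓs : ContDiffAt ℝ 1 (fun p => ℓ (e.symm p)) 0 := hℓc.contDiffAt.comp _ hsc
    refine (hℓs.sqrt ?_).inv ?_ <;> simp [hs0, hℓ0]
  have ev1 : ∀ᶠ p in 𝓝 (0 : ℝ × ℝ), ContDiffAt ℝ 1 X p := hXc.eventually (by simp)
  have ev2 : ∀ᶠ p in 𝓝 (0 : ℝ × ℝ), p ∈ e.target := e.open_target.mem_nhds h0t
  have ev3 : ∀ᶠ p in 𝓝 (0 : ℝ × ℝ), X p ∈ Ioo (1 / 2) 2 :=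
    hXc.continuousAt (Ioo_mem_nhds (by rw [hX0]; norm_num) (by rw [hX0]; norm_num))
  obtain ⟨ρ, hρ, hball⟩ := Metric.eventually_nhds_iff_ball.1 (ev1.and (ev2.and ev3))
  refine ⟨X, ρ, hρ, fun p hp => (hball p hp).1.contDiffWithinAt, fun p hp => ?_, ?_⟩
  · obtain ⟨-, hpt, h1, h2⟩ := hball p hp
    refine ⟨h1, h2, ?_⟩
    have hXpos : 0 < X p := by linarith
    have hsqpos : 0 < √(ℓ (e.symm p)) := inv_pos.1 hXpos
    have hr := e.right_inv hpt
    rw [heΘ] at hr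
    have hr1 : (e.symm p).1 * √(ℓ (e.symm p)) = p.1 := congrArg Prod.fst hr
    have hr2 : (e.symm p).2 * ℓ (e.symm p) = p.2 := congrArg Prod.snd hr
    have hXs : X p * √(ℓ (e.symm p)) = 1 := inv_mul_cancel₀ hsqpos.ne'
    have hsq : √(ℓ (e.symm p)) ^ 2 = ℓ (e.symm p) := Real.sq_sqrt (Real.sqrt_pos.1 hsqpos).le
    set S := √(ℓ (e.symm p))
    have hA : p.1 * X p = (e.symm p).1 := by
      rw [← hr1]; linear_combination (e.symm p).1 * hXs
    have hB : p.2 * X p ^ 2 = (e.symm p).2 := by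
      rw [← hr2, ← hsq]; linear_combination (e.symm p).2 * (X p * S + 1) * hXs
    calc X p ^ 2 * (1 + 2 * p.1 * X p + 2 * p.2 * X p ^ 2)
        = X p ^ 2 * ℓ (e.symm p) := by
          simp only [hℓ]; linear_combination 2 * X p ^ 2 * hA + 2 * X p ^ 2 * hB
      _ = 1 := by rw [← hsq]; linear_combination (X p * S + 1) * hXs
  · have hΘcont : ContinuousAt Θ 0 := hΘc.continuousAt
    have ev4 : ∀ᶠ q in 𝓝 (0 : ℝ × ℝ), Θ q ∈ Metric.ball (0 : ℝ × ℝ) ρ :=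
      hΘcont (by rw [hΘ0]; exact Metric.ball_mem_nhds _ hρ)
    have ev5 : ∀ᶠ q in 𝓝 (0 : ℝ × ℝ), q ∈ e.source := e.open_source.mem_nhds h0s
    have ev6 : ∀ᶠ q in 𝓝 (0 : ℝ × ℝ), 0 < ℓ q :=
      hℓc.continuous.continuousAt (Ioi_mem_nhds (by rw [hℓ0]; exact one_pos))
    obtain ⟨ρ', hρ', hb⟩ := Metric.eventually_nhds_iff_ball.1 (ev4.and (ev5.and ev6))
    refine ⟨ρ', hρ', fun q hq => ?_⟩
    obtain ⟨h1, h2, h3⟩ := hb q hq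
    refine ⟨h3, h1, ?_⟩
    have hl : e.symm (Θ q) = q := e.left_inv h2
    change X (Θ q) * √(ℓ q) = 1
    simp only [hX, hl]
    exact inv_mul_cancel₀ (Real.sqrt_pos.2 h3).ne'

/-- The solution `X` of `X ^ 2 * (1 + 2 a X + 2 b X ^ 2) = 1` near `a = b = 0`, `X = 1`. -/
noncomputable def radialFactor : ℝ × ℝ → ℝ := exists_radialFactor.choose

/-- The radius of a ball on which `radialFactor` is smooth. -/
noncomputable def radialRadius : ℝ := exists_radialFactor.choose_spec.choose

lemma radialRadius_pos : 0 < radialRadius := exists_radialFactor.choose_spec.choose_spec.1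

lemma contDiffOn_radialFactor : ContDiffOn ℝ 1 radialFactor (Metric.ball 0 radialRadius) :=
  exists_radialFactor.choose_spec.choose_spec.2.1

lemma radialFactor_spec {p : ℝ × ℝ} (hp : p ∈ Metric.ball (0 : ℝ × ℝ) radialRadius) :
    1 / 2 < radialFactor p ∧ radialFactor p < 2 ∧
      radialFactor p ^ 2 * (1 + 2 * p.1 * radialFactor p + 2 * p.2 * radialFactor p ^ 2) = 1 :=
  exists_radialFactor.choose_spec.choose_spec.2.2.1 p hp

lemma radialFactor_mul_sqrt : ∃ ρ', 0 < ρ' ∧ ∀ q ∈ Metric.ball (0 : ℝ × ℝ) ρ',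
    0 < 1 + 2 * q.1 + 2 * q.2 ∧
      (q.1 * √(1 + 2 * q.1 + 2 * q.2), q.2 * (1 + 2 * q.1 + 2 * q.2)) ∈
        Metric.ball (0 : ℝ × ℝ) radialRadius ∧
      radialFactor (q.1 * √(1 + 2 * q.1 + 2 * q.2), q.2 * (1 + 2 * q.1 + 2 * q.2)) *
        √(1 + 2 * q.1 + 2 * q.2) = 1 :=
  exists_radialFactor.choose_spec.choose_spec.2.2.2

/-! ### Polar coordinates adapted to the Hamiltonian

A point `x = (σ, φ, r)` stands for the point with coordinates `w = σ sin φ`, `z = σ cos φ`, where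
`w = u - u ^ 2 / 2` and `z = v * √(1 + 2 (1 - u) v + 2 r v ^ 2)`. -/

/-- The coordinate `w = σ sin φ`. -/
noncomputable def polarW (x : ℝ × ℝ × ℝ) : ℝ := x.1 * Real.sin x.2.1

/-- The coordinate `z = σ cos φ`. -/
noncomputable def polarZ (x : ℝ × ℝ × ℝ) : ℝ := x.1 * Real.cos x.2.1

/-- The function `y = 1 - u = √(1 - 2 w)`. -/
noncomputable def polarY (x : ℝ × ℝ × ℝ) : ℝ := √(1 - 2 * polarW x)

/-- The quotient `v / z`. -/
noncomputable def polarX (x : ℝ × ℝ × ℝ) : ℝ :=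
  radialFactor (polarY x * polarZ x, x.2.2 * polarZ x ^ 2)

/-- The set of points `(σ, φ, r)` with `|σ| < ρ` and `|r| < R`. -/
def polarDomain (ρ R : ℝ) : Set (ℝ × ℝ × ℝ) := {x | |x.1| < ρ ∧ |x.2.2| < R}

lemma isOpen_polarDomain (ρ R : ℝ) : IsOpen (polarDomain ρ R) :=
  (isOpen_lt (continuous_abs.comp continuous_fst) continuous_const).inter
    (isOpen_lt (continuous_abs.comp (continuous_snd.comp continuous_snd)) continuous_const)

lemma abs_polarW_le (x : ℝ × ℝ × ℝ) : |polarW x| ≤ |x.1| := by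
  rw [polarW, abs_mul]
  exact mul_le_of_le_one_right (abs_nonneg _) (Real.abs_sin_le_one _)

lemma abs_polarZ_le (x : ℝ × ℝ × ℝ) : |polarZ x| ≤ |x.1| := by
  rw [polarZ, abs_mul]
  exact mul_le_of_le_one_right (abs_nonneg _) (Real.abs_cos_le_one _)

lemma polarY_spec {x : ℝ × ℝ × ℝ} (hx : |x.1| < 1 / 4) :
    0 < polarY x ∧ polarY x < 2 ∧ polarY x ^ 2 = 1 - 2 * polarW x := by
  have h := abs_le.1 ((abs_polarW_le x).trans hx.le)
  have h1 : 0 < 1 - 2 * polarW x := by linarith [h.2]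
  refine ⟨Real.sqrt_pos.2 h1, ?_, Real.sq_sqrt h1.le⟩
  rw [polarY, Real.sqrt_lt' (by norm_num)]
  linarith [h.1]

/-- Since y < 2, |z| ≤ |σ| and |σ| < 1/4, one has |yz| ≤ 2|σ| and |rz²| ≤ |R||σ|; hence the
denominator 2 + |R|. -/
lemma exists_polarDomain_small {d : ℝ} (hd : 0 < d) (R : ℝ) : ∃ ρ, 0 < ρ ∧ ρ ≤ 1 / 4 ∧
    ∀ x ∈ polarDomain ρ R, |polarW x| < d ∧ |polarZ x| < d ∧
      (polarY x * polarZ x, x.2.2 * polarZ x ^ 2) ∈ Metric.ball (0 : ℝ × ℝ) d := by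
  refine ⟨min (1 / 4) (d / (2 + |R|)), by positivity, min_le_left _ _, fun x hx => ?_⟩
  have h1 : |x.1| < 1 / 4 := hx.1.trans_le (min_le_left _ _)
  have h2 : |x.1| * (2 + |R|) < d := by
    rw [← lt_div_iff₀ (by positivity)]; exact hx.1.trans_le (min_le_right _ _)
  have h3 := abs_nonneg x.1
  have h4 := abs_nonneg R
  have h5 : |x.1| * 2 ≤ |x.1| * (2 + |R|) := by gcongr; linarith
  have h6 : |x.1| * |R| ≤ |x.1| * (2 + |R|) := by gcongr; linarith
  obtain ⟨hy0, hy2, -⟩ := polarY_spec h1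
  have hz := abs_polarZ_le x
  have hw := abs_polarW_le x
  have hz0 := abs_nonneg (polarZ x)
  refine ⟨by linarith, by linarith, ?_⟩
  rw [mem_ball_zero_iff, Prod.norm_def, sup_lt_iff]
  simp only [Real.norm_eq_abs, abs_mul, abs_pow, abs_of_pos hy0]
  constructor
  · calc polarY x * |polarZ x| ≤ 2 * |x.1| := by gcongr
      _ < d := by linarith
  · calc |x.2.2| * |polarZ x| ^ 2 ≤ |R| * |x.1| ^ 2 := by
          have := hx.2.le.trans (le_abs_self R)
          gcongr
      _ ≤ |R| * |x.1| := by
          gcongr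
          nlinarith
      _ < d := by linarith

lemma contDiff_polarW : ContDiff ℝ 1 polarW := by unfold polarW; fun_prop

lemma contDiff_polarZ : ContDiff ℝ 1 polarZ := by unfold polarZ; fun_prop

lemma contDiffOn_polarY {ρ R : ℝ} (hρ : ρ ≤ 1 / 4) : ContDiffOn ℝ 1 polarY (polarDomain ρ R) := by
  refine ContDiffOn.sqrt (contDiffOn_const.sub (contDiffOn_const.mul contDiff_polarW.contDiffOn)) ?_
  intro x hx
  have := polarY_spec (hx.1.trans_le hρ)
  have h2 := pow_pos this.1 2
  rw [this.2.2] at h2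
  exact h2.ne'

lemma contDiffOn_polarX {ρ R : ℝ} (hρ : ρ ≤ 1 / 4)
    (h : ∀ x ∈ polarDomain ρ R,
      (polarY x * polarZ x, x.2.2 * polarZ x ^ 2) ∈ Metric.ball (0 : ℝ × ℝ) radialRadius) :
    ContDiffOn ℝ 1 polarX (polarDomain ρ R) := by
  refine contDiffOn_radialFactor.comp (f := fun x : ℝ × ℝ × ℝ =>
    (polarY x * polarZ x, x.2.2 * polarZ x ^ 2)) ?_ h
  exact ((contDiffOn_polarY hρ).mul contDiff_polarZ.contDiffOn).prodMk
    ((contDiff_snd.snd.contDiffOn).mul (contDiff_polarZ.contDiffOn.pow 2))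

lemma flatOn_polarW (O : Set (ℝ × ℝ × ℝ)) : FlatOn O 1 polarW :=
  ⟨fun x => Real.sin x.2.1, by fun_prop, fun x _ => by simp [polarW]⟩

lemma flatOn_polarZ (O : Set (ℝ × ℝ × ℝ)) : FlatOn O 1 polarZ :=
  ⟨fun x => Real.cos x.2.1, by fun_prop, fun x _ => by simp [polarZ]⟩

/-! ### Expansions of X^k and y^l / y in polar coordinates -/

lemma continuous_lowPoly (f : ℕ → ℕ → ℚ) : Continuous fun p : ℝ × ℝ => lowPoly f p.1 p.2 := by
  unfold lowPoly; fun_prop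

lemma lowPoly_zero_zero (f : ℕ → ℕ → ℚ) : lowPoly f 0 0 = f 0 0 := by
  rw [lowPoly, Finset.sum_eq_single (0, 0)]
  · simp
  · intro p _ hp
    by_cases h1 : p.1 = 0
    · have h2 : p.2 ≠ 0 := fun h2 => hp (Prod.ext h1 h2)
      simp [h2]
    · simp [h1]
  · intro hn
    exact absurd (mem_lowWeight.2 (by simp)) hn

/-- The coefficients of a series in the first variable only. -/
def firstCoeff (c : ℕ → ℚ) (i j : ℕ) : ℚ := if j = 0 then c i else 0

lemma lowPoly_firstCoeff (c : ℕ → ℚ) (a b : ℝ) :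
    lowPoly (firstCoeff c) a b = ∑ i ∈ Finset.range 13, (c i : ℝ) * a ^ i := by
  have : (Finset.range 13).map ⟨fun i => (i, 0), fun i j h => (Prod.ext_iff.1 h).1⟩ ⊆ lowWeight := by
    intro p hp
    simp only [Finset.mem_map, Finset.mem_range] at hp
    obtain ⟨i, hi, rfl⟩ := hp
    rw [mem_lowWeight]
    change i + 2 * 0 ≤ 12
    omega
  rw [lowPoly, ← Finset.sum_subset this, Finset.sum_map]
  · refine Finset.sum_congr rfl fun i _ => ?_
    change ((if 0 = 0 then c i else 0 : ℚ) : ℝ) * (a ^ i * b ^ 0) = _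
    simp
  · intro p hp hn
    have : p.2 ≠ 0 := by
      intro h
      apply hn
      rw [mem_lowWeight] at hp
      simp only [Finset.mem_map, Finset.mem_range]
      exact ⟨p.1, by omega, Prod.ext rfl h.symm⟩
    simp [firstCoeff, this]

/-- The central binomial series for (1 - 2w)^(-1/2) squares to the geometric series of (1 -
2w)^(-1). -/
lemma rootCoeff_conv_zero : ∀ p ∈ lowWeight,
    cauchyCoeff (firstCoeff (rootCoeff 0)) (firstCoeff (rootCoeff 0)) p.1 p.2 =
      firstCoeff (fun i => 2 ^ i) p.1 p.2 := by
  decide +kernel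

lemma geometric_conv : ∀ p ∈ lowWeight,
    cauchyCoeff (firstCoeff (fun i => 2 ^ i)) (firstCoeff fun i => monoCoeff 1 0 0 i 0 - monoCoeff 2 1 0 i 0)
      p.1 p.2 = monoCoeff 1 0 0 p.1 p.2 := by
  decide +kernel

/-- On a small polar domain all the expansions below are valid. -/
lemma exists_polarDomain (R : ℝ) : ∃ ρ, 0 < ρ ∧ ρ ≤ 1 / 4 ∧
    (∀ x ∈ polarDomain ρ R,
      (polarY x * polarZ x, x.2.2 * polarZ x ^ 2) ∈ Metric.ball (0 : ℝ × ℝ) radialRadius) ∧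
    (∀ k ∈ ({1, 2, 3} : Finset ℕ), FlatOn (polarDomain ρ R) 13 fun x => polarX x ^ k -
      lowPoly (radialCoeff k) (polarY x * polarZ x) (x.2.2 * polarZ x ^ 2)) ∧
    (∀ l, FlatOn (polarDomain ρ R) 13 fun x => polarY x ^ l / polarY x -
      ∑ i ∈ Finset.range 13, (rootCoeff l i : ℝ) * polarW x ^ i) := by
  have hc0 : (radialCoeff 1 0 0 : ℝ) = 1 := by
    have : radialCoeff 1 0 0 = 1 := by decide +kernel
    rw [this]; norm_num
  have hc1 : (firstCoeff (rootCoeff 0) 0 0 : ℝ) = 1 := by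
    have : firstCoeff (rootCoeff 0) 0 0 = 1 := by decide +kernel
    rw [this]; norm_num
  have ev1 : ∀ᶠ p in 𝓝 (0 : ℝ × ℝ), lowPoly (radialCoeff 1) p.1 p.2 ∈ Ioo (1 / 2) 2 :=
    (continuous_lowPoly _).continuousAt (Ioo_mem_nhds
      (by simp only [Prod.fst_zero, Prod.snd_zero]; rw [lowPoly_zero_zero, hc0]; norm_num)
      (by simp only [Prod.fst_zero, Prod.snd_zero]; rw [lowPoly_zero_zero, hc0]; norm_num))
  have ev2 : ∀ᶠ p in 𝓝 (0 : ℝ × ℝ), lowPoly (firstCoeff (rootCoeff 0)) p.1 p.2 ∈ Ioi 0 :=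
    (continuous_lowPoly _).continuousAt (Ioi_mem_nhds
      (by simp only [Prod.fst_zero, Prod.snd_zero]; rw [lowPoly_zero_zero, hc1]; norm_num))
  obtain ⟨d, hd, hball⟩ := Metric.eventually_nhds_iff_ball.1 (ev1.and ev2)
  obtain ⟨ρ, hρ, hρ4, hsm⟩ := exists_polarDomain_small
    (d := min d (min (1 / 100) radialRadius))
    (lt_min hd (lt_min (by norm_num) radialRadius_pos)) R
  set O := polarDomain ρ R with hO
  have hY : ContDiffOn ℝ 1 polarY O := contDiffOn_polarY hρ4
  have hrad : ∀ x ∈ O,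
      (polarY x * polarZ x, x.2.2 * polarZ x ^ 2) ∈ Metric.ball (0 : ℝ × ℝ) radialRadius :=
    fun x hx => Metric.ball_subset_ball ((min_le_right _ _).trans (min_le_right _ _)) (hsm x hx).2.2
  have hX : ContDiffOn ℝ 1 polarX O := contDiffOn_polarX hρ4 hrad
  set a : ℝ × ℝ × ℝ → ℝ := fun x => polarY x * polarZ x with ha
  set b : ℝ × ℝ × ℝ → ℝ := fun x => x.2.2 * polarZ x ^ 2 with hb
  have hfa : FlatOn O 1 a := (FlatOn.of_contDiffOn hY).mul_left (flatOn_polarZ O)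
  have hfb : FlatOn O 2 b :=
    (FlatOn.of_contDiffOn contDiff_snd.snd.contDiffOn).mul_left ((flatOn_polarZ O).pow 2)
  have hXspec : ∀ x ∈ O, 1 / 2 < polarX x ∧ polarX x < 2 ∧
      polarX x ^ 2 * (1 + 2 * a x * polarX x + 2 * b x * polarX x ^ 2) = 1 :=
    fun x hx => radialFactor_spec (hrad x hx)
  set S : ℕ → ℝ × ℝ × ℝ → ℝ := fun k x => lowPoly (radialCoeff k) (a x) (b x) with hS
  have hSf : ∀ k, FlatOn O 0 (S k) := fun k => flatOn_lowPoly hfa hfb _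
  have hS12 : ∀ x ∈ O, 1 / 2 < S 1 x ∧ S 1 x < 2 := fun x hx =>
    (hball (a x, b x) (Metric.ball_subset_ball (min_le_left _ _) (hsm x hx).2.2)).1
  have hab : ∀ x ∈ O, |a x| < 1 / 100 ∧ |b x| < 1 / 100 := by
    intro x hx
    have := Metric.ball_subset_ball ((min_le_right _ _).trans (min_le_left _ _)) (hsm x hx).2.2
    rw [mem_ball_zero_iff, Prod.norm_def, sup_lt_iff] at this
    exact this
  have hS11 : FlatOn O 13 fun x => S 1 x * S 1 x - S 2 x :=
    (flatOn_lowPoly_mul hfa hfb (radialCoeff 1) (radialCoeff 1)).congr fun x _ => by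
      simp only [hS, lowPoly_congr radialCoeff_conv_one_one]
  have hS13 : FlatOn O 13 fun x => S 1 x * S 2 x - S 3 x :=
    (flatOn_lowPoly_mul hfa hfb (radialCoeff 1) (radialCoeff 2)).congr fun x _ => by
      simp only [hS, lowPoly_congr radialCoeff_conv_one_two]
  have hS14 : FlatOn O 13 fun x => S 1 x * S 3 x - S 4 x :=
    (flatOn_lowPoly_mul hfa hfb (radialCoeff 1) (radialCoeff 3)).congr fun x _ => by
      simp only [hS, lowPoly_congr radialCoeff_conv_one_three]
  have heq : FlatOn O 13 fun x => S 2 x + 2 * a x * S 3 x + 2 * b x * S 4 x - 1 := by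
    refine ((flatOn_lowPoly_mul hfa hfb (monoCoeff 2 1 0) (radialCoeff 3)).add
      (flatOn_lowPoly_mul hfa hfb (monoCoeff 2 0 1) (radialCoeff 4))).congr fun x _ => ?_
    have h1 := lowPoly_congr (f := fun i j => radialCoeff 2 i j +
      cauchyCoeff (monoCoeff 2 1 0) (radialCoeff 3) i j +
      cauchyCoeff (monoCoeff 2 0 1) (radialCoeff 4) i j) radialCoeff_equation (a x) (b x)
    rw [← lowPoly_add, ← lowPoly_add, lowPoly_monoCoeff 1 (by norm_num)] at h1
    rw [lowPoly_monoCoeff 2 (by norm_num), lowPoly_monoCoeff 2 (by norm_num)]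
    simp only [hS]
    push_cast at h1 ⊢
    linear_combination h1
  have hgS : FlatOn O 13 fun x => S 1 x ^ 2 + 2 * a x * S 1 x ^ 3 + 2 * b x * S 1 x ^ 4 - 1 := by
    have hfa0 : FlatOn O 0 a := hfa.mono (Nat.zero_le _)
    have hfb0 : FlatOn O 0 b := hfb.mono (Nat.zero_le _)
    have c3 : FlatOn O 13 fun x => S 1 x ^ 3 - S 3 x :=
      (((hSf 1).mul_left hS11).add hS13).congr fun x _ => by ring
    have c4 : FlatOn O 13 fun x => S 1 x ^ 4 - S 4 x :=
      (((hSf 1).mul_left c3).add hS14).congr fun x _ => by ring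
    refine (((hS11.add ((hfa0.mul_left c3).const_mul 2)).add ((hfb0.mul_left c4).const_mul 2)).add
      heq).congr fun x _ => by ring
  -- the divided difference of `t ↦ t ^ 2 + 2 a t ^ 3 + 2 b t ^ 4`
  set Q : ℝ × ℝ × ℝ → ℝ := fun x => polarX x + S 1 x
    + 2 * a x * (polarX x ^ 2 + polarX x * S 1 x + S 1 x ^ 2)
    + 2 * b x * (polarX x ^ 3 + polarX x ^ 2 * S 1 x + polarX x * S 1 x ^ 2 + S 1 x ^ 3) with hQ
  have hQc : ContDiffOn ℝ 1 Q O := by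
    have h1 := (hSf 1).contDiffOn
    have h2 := hfa.contDiffOn
    have h3 := hfb.contDiffOn
    simp only [hQ]
    fun_prop
  -- With both arguments in (1/2, 2) and |a|, |b| < 1/100, the divided difference exceeds 1 -
  -- 2·12/100 - 2·32/100 > 0.
  have hQ0 : ∀ x ∈ O, Q x ≠ 0 := by
    intro x hx
    obtain ⟨x1, x2, -⟩ := hXspec x hx
    obtain ⟨s1, s2⟩ := hS12 x hx
    obtain ⟨a1, b1⟩ := hab x hx
    have hb1 : polarX x ^ 2 + polarX x * S 1 x + S 1 x ^ 2 ≤ 12 := by nlinarith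
    have hb2 : polarX x ^ 3 + polarX x ^ 2 * S 1 x + polarX x * S 1 x ^ 2 + S 1 x ^ 3 ≤ 32 := by
      have : polarX x ^ 3 + polarX x ^ 2 * S 1 x + polarX x * S 1 x ^ 2 + S 1 x ^ 3 =
        (polarX x + S 1 x) * (polarX x ^ 2 + S 1 x ^ 2) := by ring
      rw [this]
      have h3 : polarX x ^ 2 + S 1 x ^ 2 ≤ 8 := by nlinarith
      nlinarith [sq_nonneg (polarX x), sq_nonneg (S 1 x)]
    have hp1 : 0 ≤ polarX x ^ 2 + polarX x * S 1 x + S 1 x ^ 2 := by positivity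
    have hp2 : 0 ≤ polarX x ^ 3 + polarX x ^ 2 * S 1 x + polarX x * S 1 x ^ 2 + S 1 x ^ 3 := by
      positivity
    set A := polarX x ^ 2 + polarX x * S 1 x + S 1 x ^ 2
    set B := polarX x ^ 3 + polarX x ^ 2 * S 1 x + polarX x * S 1 x ^ 2 + S 1 x ^ 3
    have k1 : -(1 / 100 * 12) ≤ a x * A := by
      have := mul_le_mul a1.le hb1 hp1 (by norm_num)
      rw [← abs_of_nonneg hp1, ← abs_mul] at this
      linarith [(abs_le.1 this).1]
    have k2 : -(1 / 100 * 32) ≤ b x * B := by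
      have := mul_le_mul b1.le hb2 hp2 (by norm_num)
      rw [← abs_of_nonneg hp2, ← abs_mul] at this
      linarith [(abs_le.1 this).1]
    simp only [hQ]
    apply ne_of_gt
    nlinarith
  -- X is an exact root and `S 1` a root up to order 13. Dividing the defect by the nonvanishing
  -- divided difference transfers that order, and the C¹ control, to X - `S 1`.
  have hX1 : FlatOn O 13 fun x => polarX x - S 1 x :=
    ((hgS.const_mul (-1)).div hQc hQ0).congr fun x hx => by
      rw [eq_div_iff (hQ0 x hx)]
      obtain ⟨-, -, x3⟩ := hXspec x hx
      simp only [hQ]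
      linear_combination x3
  have hX0 : FlatOn O 0 polarX := FlatOn.of_contDiffOn hX
  have hX2 : FlatOn O 13 fun x => polarX x ^ 2 - S 2 x :=
    ((((hX0.add (hSf 1)).mul_left hX1)).add hS11).congr fun x _ => by ring
  have hX3 : FlatOn O 13 fun x => polarX x ^ 3 - S 3 x :=
    (((hX0.mul_left hX2).add ((hSf 2).mul_left hX1)).add hS13).congr fun x _ => by ring
  refine ⟨ρ, hρ, hρ4, hrad, ?_, ?_⟩
  · intro k hk
    simp only [Finset.mem_insert, Finset.mem_singleton] at hk
    rcases hk with rfl | rfl | rfl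
    · exact hX1.congr fun x _ => by simp only [hS, ha, hb, pow_one]
    · exact hX2
    · exact hX3
  · have hw := flatOn_polarW O
    have hw0 : FlatOn O 0 polarW := hw.mono (Nat.zero_le _)
    have hz2 : FlatOn O 2 fun _ => (0 : ℝ) := FlatOn.zero
    have hyspec : ∀ x ∈ O, 0 < polarY x ∧ polarY x < 2 ∧ polarY x ^ 2 = 1 - 2 * polarW x :=
      fun x hx => polarY_spec (hx.1.trans_le hρ4)
    set T : ℝ × ℝ × ℝ → ℝ := fun x => lowPoly (firstCoeff (rootCoeff 0)) (polarW x) 0 with hT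
    have hTf : FlatOn O 0 T := flatOn_lowPoly hw hz2 _
    have hTpos : ∀ x ∈ O, 0 < T x := by
      intro x hx
      refine (hball (polarW x, 0) ?_).2
      rw [mem_ball_zero_iff, Prod.norm_def, sup_lt_iff]
      refine ⟨(hsm x hx).1.trans_le (min_le_left _ _), by simpa using hd⟩
    set U : ℝ × ℝ × ℝ → ℝ := fun x => lowPoly (firstCoeff fun i => 2 ^ i) (polarW x) 0 with hU
    have hTT : FlatOn O 13 fun x => T x * T x - U x :=
      (flatOn_lowPoly_mul hw hz2 (firstCoeff (rootCoeff 0)) (firstCoeff (rootCoeff 0))).congr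
        fun x _ => by simp only [hT, hU, lowPoly_congr rootCoeff_conv_zero]
    have hlin : ∀ x, lowPoly (firstCoeff fun i => monoCoeff 1 0 0 i 0 - monoCoeff 2 1 0 i 0)
        (polarW x) 0 = 1 - 2 * polarW x := by
      intro x
      rw [lowPoly_firstCoeff]
      simp [Finset.sum_range_succ', monoCoeff]
      ring
    have hUl : FlatOn O 13 fun x => U x * (1 - 2 * polarW x) - 1 :=
      (flatOn_lowPoly_mul hw hz2 (firstCoeff fun i => 2 ^ i)
        (firstCoeff fun i => monoCoeff 1 0 0 i 0 - monoCoeff 2 1 0 i 0)).congr fun x _ => by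
        rw [lowPoly_congr geometric_conv, hlin, lowPoly_monoCoeff 1 (by norm_num)]
        simp [hU]
    have hl0 : FlatOn O 0 fun x => 1 - 2 * polarW x := (FlatOn.const 1).sub (hw0.const_mul 2)
    have hT1 : FlatOn O 13 fun x => T x ^ 2 * (1 - 2 * polarW x) - 1 :=
      ((hl0.mul_left hTT).add hUl).congr fun x _ => by ring
    -- Rationalisation: 1/y - T = (1 - T²y²) / (y (Ty + 1)).
    have hTy : FlatOn O 13 fun x => 1 / polarY x - T x := by
      have hc : ContDiffOn ℝ 1 (fun x => polarY x * (T x * polarY x + 1)) O :=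
        hY.mul ((hTf.contDiffOn.mul hY).add contDiffOn_const)
      refine ((hT1.const_mul (-1)).div hc fun x hx => ?_).congr fun x hx => ?_
      · have := hTpos x hx
        have := (hyspec x hx).1
        positivity
      · have h1 := hTpos x hx
        have h2 := (hyspec x hx).1
        rw [← (hyspec x hx).2.2]
        field_simp
        ring
    intro l
    induction l using Nat.twoStepInduction with
    | zero =>
      refine hTy.congr fun x _ => ?_
      simp only [hT, lowPoly_firstCoeff, pow_zero]
    | one =>
      refine FlatOn.zero.congr fun x hx => ?_
      rw [pow_one, div_self (hyspec x hx).1.ne']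
      simp [Finset.sum_range_succ', rootCoeff]
    | more l ih _ =>
      -- Multiplying a truncation at degree 12 by 1 - 2w creates a single surplus term, in w^13,
      -- which is absorbed by the remainder.
      have h13 : FlatOn O 13 fun x => (-2 * (rootCoeff l 12 : ℝ)) * polarW x ^ 13 :=
        ((hw.pow 13).mono (by norm_num)).const_mul _
      refine ((hl0.mul_left ih).add h13).congr fun x hx => ?_
      have h1 : polarY x ^ (l + 2) / polarY x = (1 - 2 * polarW x) * (polarY x ^ l / polarY x) := by
        rw [← (hyspec x hx).2.2]; ring
      rw [h1]
      have h2 : ∑ i ∈ Finset.range 13, (rootCoeff (l + 2) i : ℝ) * polarW x ^ i =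
          (1 - 2 * polarW x) * ∑ i ∈ Finset.range 13, (rootCoeff l i : ℝ) * polarW x ^ i
            - (-2 * (rootCoeff l 12 : ℝ)) * polarW x ^ 13 := by
        rw [Finset.sum_range_succ' _ 12]
        simp only [rootCoeff]
        push_cast
        simp only [sub_mul, Finset.sum_sub_distrib]
        rw [Finset.sum_range_succ' (fun i => (rootCoeff l i : ℝ) * polarW x ^ i) 12]
        rw [one_mul, ← Finset.sum_range_succ' (fun i => (rootCoeff l i : ℝ) * polarW x ^ i) 12,
          Finset.sum_range_succ (fun i => (rootCoeff l i : ℝ) * polarW x ^ i) 12, mul_add,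
          Finset.mul_sum, ← Finset.sum_range_succ (fun i => (rootCoeff l i : ℝ) * polarW x ^ i) 12,
          Finset.sum_range_succ' (fun i => (rootCoeff l i : ℝ) * polarW x ^ i) 12]
        have h3 : ∀ i, 2 * (rootCoeff l i : ℝ) * polarW x ^ (i + 1) =
            2 * polarW x * ((rootCoeff l i : ℝ) * polarW x ^ i) := fun i => by ring
        simp only [h3]
        ring
      rw [h2]
      ring

/-! ### Averages over the angle -/

/-- The mean value of `cos ^ b` over a period. -/
def cosMean : ℕ → ℚ
  | 0 => 1
  | 1 => 0
  | b + 2 => (b + 1) / (b + 2) * cosMean b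

/-- The mean value of `sin ^ a * cos ^ b` over a period. -/
def trigMean : ℕ → ℕ → ℚ
  | 0, b => cosMean b
  | 1, _ => 0
  | a + 2, b => (a + 1) / (a + b + 2) * trigMean a b

/-- Integrating the derivative of sin^(a+1) cos^(b+1) over a period gives 0, hence a recursion
lowering the power of sin by two. The derivatives of cos^(b+1) and of sin · cos^(b+1) settle the
base cases. -/
lemma integral_sin_pow_mul_cos_pow_eq_trigMean (a b : ℕ) :
    ∫ t in 0..2 * Real.pi, Real.sin t ^ a * Real.cos t ^ b = 2 * Real.pi * trigMean a b := by
  have hinteg : ∀ a b : ℕ, IntervalIntegrable (fun t => Real.sin t ^ a * Real.cos t ^ b) volume 0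
      (2 * Real.pi) := fun a b => Continuous.intervalIntegrable (by fun_prop) _ _
  have hftc : ∀ {f f' : ℝ → ℝ}, (∀ t, HasDerivAt f (f' t) t) → Continuous f' →
      f (2 * Real.pi) = f 0 → ∫ t in 0..2 * Real.pi, f' t = 0 := by
    intro f f' hf hc h
    rw [intervalIntegral.integral_eq_sub_of_hasDerivAt (fun t _ => hf t)
      (hc.intervalIntegrable _ _), h, sub_self]
  have hrec : ∀ a b : ℕ, ((a : ℝ) + b + 2) * ∫ t in 0..2 * Real.pi, Real.sin t ^ (a + 2) * Real.cos t ^ b =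
      (a + 1) * ∫ t in 0..2 * Real.pi, Real.sin t ^ a * Real.cos t ^ b := by
    intro a b
    have h := hftc (f := fun t => Real.sin t ^ (a + 1) * Real.cos t ^ (b + 1))
      (f' := fun t => (a + 1) * (Real.sin t ^ a * Real.cos t ^ b) -
        (a + b + 2) * (Real.sin t ^ (a + 2) * Real.cos t ^ b)) (fun t => by
          have := ((Real.hasDerivAt_sin t).fun_pow (a + 1)).fun_mul ((Real.hasDerivAt_cos t).fun_pow (b + 1))
          convert! this using 1
          have hs := Real.sin_sq_add_cos_sq t
          simp only [Nat.add_sub_cancel]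
          push_cast
          have hc : Real.cos t ^ 2 = 1 - Real.sin t ^ 2 := by linarith
          calc _ = (a + 1) * Real.sin t ^ a * Real.cos t ^ b * (1 - Real.sin t ^ 2)
                - (b + 1) * Real.sin t ^ a * Real.cos t ^ b * Real.sin t ^ 2 := by ring
            _ = _ := by rw [← hc]; ring) (by fun_prop) (by simp)
    rw [intervalIntegral.integral_sub ((hinteg _ _).const_mul _) ((hinteg _ _).const_mul _),
      intervalIntegral.integral_const_mul, intervalIntegral.integral_const_mul] at h
    linarith
  have hone : ∀ b : ℕ, ∫ t in 0..2 * Real.pi, Real.sin t ^ 1 * Real.cos t ^ b = 0 := by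
    intro b
    have h := hftc (f := fun t => Real.cos t ^ (b + 1))
      (f' := fun t => -(b + 1) * (Real.sin t ^ 1 * Real.cos t ^ b)) (fun t => by
          have := (Real.hasDerivAt_cos t).fun_pow (b + 1)
          convert! this using 1
          simp only [Nat.add_sub_cancel]
          push_cast
          ring) (by fun_prop) (by simp)
    rw [intervalIntegral.integral_const_mul] at h
    rcases mul_eq_zero.1 h with h | h
    · have : (0 : ℝ) < b + 1 := by positivity
      linarith
    · exact h
  have hzero : ∀ b : ℕ, ((b : ℝ) + 2) * ∫ t in 0..2 * Real.pi, Real.sin t ^ 0 * Real.cos t ^ (b + 2) =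
      (b + 1) * ∫ t in 0..2 * Real.pi, Real.sin t ^ 0 * Real.cos t ^ b := by
    intro b
    have h := hftc (f := fun t => Real.sin t * Real.cos t ^ (b + 1))
      (f' := fun t => (b + 2) * (Real.sin t ^ 0 * Real.cos t ^ (b + 2)) -
        (b + 1) * (Real.sin t ^ 0 * Real.cos t ^ b)) (fun t => by
          have := (Real.hasDerivAt_sin t).fun_mul ((Real.hasDerivAt_cos t).fun_pow (b + 1))
          convert! this using 1
          have hs := Real.sin_sq_add_cos_sq t
          simp only [Nat.add_sub_cancel]
          push_cast
          have hc : Real.sin t ^ 2 = 1 - Real.cos t ^ 2 := by linarith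
          calc _ = Real.cos t ^ (b + 2) - (b + 1) * Real.cos t ^ b * (1 - Real.cos t ^ 2) := by ring
            _ = _ := by rw [← hc]; ring) (by fun_prop) (by simp)
    rw [intervalIntegral.integral_sub ((hinteg _ _).const_mul _) ((hinteg _ _).const_mul _),
      intervalIntegral.integral_const_mul, intervalIntegral.integral_const_mul] at h
    linarith
  induction a using Nat.twoStepInduction with
  | zero =>
    induction b using Nat.twoStepInduction with
    | zero => simp [trigMean, cosMean]
    | one => simp [trigMean, cosMean]
    | more b ih _ =>
      have h := hzero b
      rw [ih, trigMean] at h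
      have hb : (0 : ℝ) < b + 2 := by positivity
      simp only [trigMean, cosMean]
      push_cast
      rw [div_mul_eq_mul_div, mul_div_assoc', eq_div_iff hb.ne']
      linarith
  | one => rw [hone b]; simp [trigMean]
  | more a ih _ =>
    have h := hrec a b
    rw [ih] at h
    have hb : (0 : ℝ) < a + b + 2 := by positivity
    simp only [trigMean]
    push_cast
    field_simp
    linarith

/-- The integral over a period in `φ` of a remainder of order `15`. -/
lemma FlatOn.integral_bound {ρ R : ℝ} {f : ℝ × ℝ × ℝ → ℝ} (hρ : 0 < ρ) (hf : FlatOn (polarDomain ρ R) 15 f) :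
    ∃ C, 0 ≤ C ∧ ∀ r, |r| < R / 2 → ∀ σ, |σ| < ρ / 2 →
      |∫ t in 0..2 * Real.pi, f (σ, t, r)| ≤ C * |σ| ^ 15 ∧
      ∃ D, HasDerivAt (fun σ => ∫ t in 0..2 * Real.pi, f (σ, t, r)) D σ ∧ |D| ≤ C * |σ| ^ 14 := by
  obtain ⟨E, hE, he⟩ := hf
  have hO := isOpen_polarDomain ρ R
  set E' : ℝ × ℝ × ℝ → ℝ := fun x => fderiv ℝ E x (1, 0, 0) with hE'
  have hE'c : ContinuousOn E' (polarDomain ρ R) :=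
    (hE.continuousOn_fderiv_of_isOpen hO le_rfl).clm_apply continuousOn_const
  have hEd : ∀ σ t r, (σ, t, r) ∈ polarDomain ρ R →
      HasDerivAt (fun σ => E (σ, t, r)) (E' (σ, t, r)) σ := by
    intro σ t r hx
    have h1 := ((hE.contDiffAt (hO.mem_nhds hx)).differentiableAt one_ne_zero).hasFDerivAt
    exact h1.comp_hasDerivAt σ ((hasDerivAt_id σ).prodMk (hasDerivAt_const σ (t, r)))
  -- Compactness of the box with halved σ- and r-ranges bounds the cofactor `E` and its σ-derivative
  -- by constants independent of r.
  set K : Set (ℝ × ℝ × ℝ) := Icc (-(ρ / 2)) (ρ / 2) ×ˢ Icc 0 (2 * Real.pi) ×ˢ Icc (-(R / 2)) (R / 2)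
  have hK : IsCompact K := isCompact_Icc.prod (isCompact_Icc.prod isCompact_Icc)
  rcases le_or_gt R 0 with hR | hR
  · exact ⟨0, le_rfl, fun r hr => absurd (abs_nonneg r) (by linarith)⟩
  have hKO : K ⊆ polarDomain ρ R := by
    rintro ⟨σ, t, r⟩ ⟨⟨h1, h2⟩, -, h3, h4⟩
    simp only at h1 h2 h3 h4
    exact ⟨abs_lt.2 ⟨by simp only; linarith, by simp only; linarith⟩,
      abs_lt.2 ⟨by simp only; linarith, by simp only; linarith⟩⟩
  obtain ⟨C₁, hC₁⟩ := hK.exists_bound_of_continuousOn (hE.continuousOn.mono hKO)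
  obtain ⟨C₂, hC₂⟩ := hK.exists_bound_of_continuousOn (hE'c.mono hKO)
  have hC₁' : 0 ≤ |C₁| := abs_nonneg _
  have hC₂' : 0 ≤ |C₂| := abs_nonneg _
  have hπ := Real.pi_pos
  refine ⟨(15 * |C₁| + ρ * |C₂|) * (2 * Real.pi), by positivity, fun r hr σ hσ => ?_⟩
  have hmem : ∀ s t, |s| < ρ → (s, t, r) ∈ polarDomain ρ R := fun s t hs =>
    ⟨hs, by change |r| < R; linarith⟩
  have hKm : ∀ t ∈ uIoc 0 (2 * Real.pi), (σ, t, r) ∈ K := by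
    intro t ht
    rw [uIoc_of_le (by positivity)] at ht
    have h1 := abs_lt.1 hσ
    have h2 := abs_lt.1 hr
    exact ⟨⟨h1.1.le, h1.2.le⟩, ⟨ht.1.le, ht.2⟩, ⟨h2.1.le, h2.2.le⟩⟩
  have hσ0 := abs_nonneg σ
  have hEb : ∀ t ∈ uIoc 0 (2 * Real.pi), |E (σ, t, r)| ≤ |C₁| := fun t ht =>
    (hC₁ _ (hKm t ht)).trans (le_abs_self _)
  have hE'b : ∀ t ∈ uIoc 0 (2 * Real.pi), |E' (σ, t, r)| ≤ |C₂| := fun t ht =>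
    (hC₂ _ (hKm t ht)).trans (le_abs_self _)
  constructor
  · have := intervalIntegral.norm_integral_le_of_norm_le_const (a := 0) (b := 2 * Real.pi)
      (f := fun t => f (σ, t, r)) (C := |σ| ^ 15 * |C₁|) (fun t ht => by
        rw [he _ (hmem σ t (by linarith)), Real.norm_eq_abs, abs_mul, abs_pow]
        exact mul_le_mul_of_nonneg_left (hEb t ht) (by positivity))
    rw [Real.norm_eq_abs, sub_zero, abs_of_pos (by positivity : 0 < 2 * Real.pi)] at this
    refine this.trans ?_
    have : |C₁| ≤ 15 * |C₁| + ρ * |C₂| := by nlinarith [mul_nonneg hρ.le hC₂']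
    calc _ = |C₁| * (2 * Real.pi) * |σ| ^ 15 := by ring
      _ ≤ _ := by gcongr
  · have hd := hasDerivAt_integral_of_continuousOn (s := Ioo (-ρ) ρ) isOpen_Ioo
      (f := fun σ t => f (σ, t, r))
      (f' := fun σ t => 15 * σ ^ 14 * E (σ, t, r) + σ ^ 15 * E' (σ, t, r)) ?_ ?_ ?_ 0 (2 * Real.pi)
      (x₀ := σ) (abs_lt.1 (by linarith))
    · refine ⟨_, hd, ?_⟩
      have := intervalIntegral.norm_integral_le_of_norm_le_const (a := 0) (b := 2 * Real.pi)
        (f := fun t => 15 * σ ^ 14 * E (σ, t, r) + σ ^ 15 * E' (σ, t, r))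
        (C := 15 * |σ| ^ 14 * |C₁| + |σ| ^ 15 * |C₂|) (fun t ht => by
          rw [Real.norm_eq_abs]
          refine (abs_add_le _ _).trans ?_
          rw [abs_mul, abs_mul, abs_mul, abs_pow, abs_pow, abs_of_pos (by norm_num : (0 : ℝ) < 15)]
          have h1 := hEb t ht
          have h2 := hE'b t ht
          gcongr)
      rw [Real.norm_eq_abs, sub_zero, abs_of_pos (by positivity : 0 < 2 * Real.pi)] at this
      refine this.trans ?_
      calc _ = (15 * |C₁| + |σ| * |C₂|) * (2 * Real.pi) * |σ| ^ 14 := by ring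
        _ ≤ _ := by gcongr; linarith
    · have hfc : ContinuousOn f (polarDomain ρ R) :=
        (((contDiffOn_fst.pow 15).mul hE).congr he).continuousOn
      exact hfc.comp (f := fun p : ℝ × ℝ => (p.1, p.2, r)) (by fun_prop)
        (fun p hp => hmem _ _ (abs_lt.2 hp.1))
    · have hc1 := hE.continuousOn.comp (f := fun p : ℝ × ℝ => (p.1, p.2, r)) (s := Ioo (-ρ) ρ ×ˢ univ) (by fun_prop)
        (fun p hp => hmem _ _ (abs_lt.2 hp.1))
      have hc2 := hE'c.comp (f := fun p : ℝ × ℝ => (p.1, p.2, r)) (s := Ioo (-ρ) ρ ×ˢ univ) (by fun_prop)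
        (fun p hp => hmem _ _ (abs_lt.2 hp.1))
      have e1 : ContinuousOn (fun p : ℝ × ℝ => 15 * p.1 ^ 14) (Ioo (-ρ) ρ ×ˢ univ) := by fun_prop
      have e2 : ContinuousOn (fun p : ℝ × ℝ => p.1 ^ 15) (Ioo (-ρ) ρ ×ˢ univ) := by fun_prop
      exact (e1.mul hc1).add (e2.mul hc2)
    · intro s hs t
      have h1 := ((hasDerivAt_id s).fun_pow 15).fun_mul (hEd s t r (hmem s t (abs_lt.2 hs)))
      have h2 : HasDerivAt (fun s => s ^ 15 * E (s, t, r))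
          (15 * s ^ 14 * E (s, t, r) + s ^ 15 * E' (s, t, r)) s := by
        convert! h1 using 1
        simp
      refine h2.congr_of_eventuallyEq ?_
      filter_upwards [isOpen_Ioo.mem_nhds hs] with s' hs'
      exact he _ (hmem s' t (abs_lt.2 hs'))

/-- The coefficient of `r ^ j * σ ^ d` in the mean over `φ` of `z ^ (k + 1) * X ^ k * (y ^ e / y)`. -/
def meanCoeff (k e d j : ℕ) : ℚ :=
  ∑ a ∈ Finset.range 13, if k + 1 + 2 * j + a ≤ d then
    radialCoeff k (d - (k + 1 + 2 * j + a)) j * rootCoeff (d - (k + 1 + 2 * j + a) + e) a *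
      trigMean a (d - a) else 0

/-- The integrand `z ^ (k + 1) * X ^ k * (y ^ e / y)`. -/
noncomputable def basicIntegrand (k e : ℕ) (x : ℝ × ℝ × ℝ) : ℝ :=
  polarZ x ^ (k + 1) * polarX x ^ k * (polarY x ^ e / polarY x)

/-- The coefficient of `σ ^ d` in the mean of `basicIntegrand k e`, as a polynomial in `r`. -/
noncomputable def meanPoly (k e d : ℕ) (r : ℝ) : ℝ := ∑ j ∈ Finset.range 7, (meanCoeff k e d j : ℝ) * r ^ j

lemma flatOn_basicIntegrand {ρ R : ℝ} (hρ4 : ρ ≤ 1 / 4)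
    (hX : ∀ k ∈ ({1, 2, 3} : Finset ℕ), FlatOn (polarDomain ρ R) 13 fun x => polarX x ^ k -
      lowPoly (radialCoeff k) (polarY x * polarZ x) (x.2.2 * polarZ x ^ 2))
    (hY : ∀ l, FlatOn (polarDomain ρ R) 13 fun x => polarY x ^ l / polarY x -
      ∑ i ∈ Finset.range 13, (rootCoeff l i : ℝ) * polarW x ^ i)
    {k : ℕ} (hk : k ∈ ({1, 2, 3} : Finset ℕ)) (e : ℕ) :
    FlatOn (polarDomain ρ R) 15 fun x => basicIntegrand k e x -
      ∑ q ∈ (Finset.range 15 ×ˢ Finset.range 7 ×ˢ Finset.range 13).filter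
        (fun q => k + 1 + 2 * q.2.1 + q.2.2 ≤ q.1),
        ((radialCoeff k (q.1 - (k + 1 + 2 * q.2.1 + q.2.2)) q.2.1 *
          rootCoeff (q.1 - (k + 1 + 2 * q.2.1 + q.2.2) + e) q.2.2 : ℚ) : ℝ) * x.2.2 ^ q.2.1 *
          (polarW x ^ q.2.2 * polarZ x ^ (q.1 - q.2.2)) := by
  classical
  have hk1 : 1 ≤ k := by
    simp only [Finset.mem_insert, Finset.mem_singleton] at hk; omega
  set O := polarDomain ρ R
  have hz := flatOn_polarZ O
  have hw := flatOn_polarW O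
  have hr : FlatOn O 0 fun x => x.2.2 := FlatOn.of_contDiffOn contDiff_snd.snd.contDiffOn
  have hy0 : ∀ x ∈ O, 0 < polarY x := fun x hx => (polarY_spec (hx.1.trans_le hρ4)).1
  have hyc : ContDiffOn ℝ 1 polarY O := contDiffOn_polarY hρ4
  have hyl : ∀ l, FlatOn O 0 fun x => polarY x ^ l / polarY x := fun l =>
    (FlatOn.of_contDiffOn (hyc.pow l)).div hyc fun x hx => (hy0 x hx).ne'
  -- replace `X ^ k` and then `y ^ (i + e) / y` by truncated expansions
  have h1 : FlatOn O 15 fun x => basicIntegrand k e x - polarZ x ^ (k + 1) *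
      lowPoly (radialCoeff k) (polarY x * polarZ x) (x.2.2 * polarZ x ^ 2) *
        (polarY x ^ e / polarY x) :=
    (((hz.pow (k + 1)).mul ((hyl e).mul_left (hX k hk))).mono (by omega)).congr fun x _ => by
      rw [basicIntegrand]; ring
  set c : ℕ × ℕ → ℕ → ℝ := fun p a => ((radialCoeff k p.1 p.2 * rootCoeff (p.1 + e) a : ℚ) : ℝ)
    with hc
  have h2 : FlatOn O 15 fun x => polarZ x ^ (k + 1) *
      lowPoly (radialCoeff k) (polarY x * polarZ x) (x.2.2 * polarZ x ^ 2) *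
        (polarY x ^ e / polarY x) - ∑ p ∈ lowWeight, ∑ a ∈ Finset.range 13,
          c p a * x.2.2 ^ p.2 * (polarW x ^ a * polarZ x ^ (k + 1 + p.1 + 2 * p.2)) := by
    have h3 : FlatOn O 15 fun x => ∑ p ∈ lowWeight, (radialCoeff k p.1 p.2 : ℝ) * (x.2.2 ^ p.2 *
        (polarZ x ^ (k + 1 + p.1 + 2 * p.2) * (polarY x ^ (p.1 + e) / polarY x -
          ∑ i ∈ Finset.range 13, (rootCoeff (p.1 + e) i : ℝ) * polarW x ^ i))) := by
      refine FlatOn.sum _ fun p _ => FlatOn.const_mul _ ?_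
      have hrp : FlatOn O 0 fun x => x.2.2 ^ p.2 := by simpa using hr.pow p.2
      exact hrp.mul_left (((hz.pow _).mul (hY (p.1 + e))).mono (by omega))
    refine h3.congr fun x _ => ?_
    rw [lowPoly, Finset.mul_sum, Finset.sum_mul, ← Finset.sum_sub_distrib]
    refine Finset.sum_congr rfl fun p _ => ?_
    rw [mul_sub, mul_sub, mul_sub, Finset.mul_sum, Finset.mul_sum, Finset.mul_sum]
    congr 1
    · rw [pow_add (polarY x) p.1 e]; ring
    · refine Finset.sum_congr rfl fun a _ => ?_
      simp only [hc]; push_cast; ring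
  -- drop the terms of degree at least `15`
  set A := lowWeight ×ˢ Finset.range 13 with hA
  have h4 : FlatOn O 15 fun x => ∑ q ∈ A.filter (fun q => ¬ k + 1 + q.1.1 + 2 * q.1.2 + q.2 ≤ 14),
      c q.1 q.2 * x.2.2 ^ q.1.2 * (polarW x ^ q.2 * polarZ x ^ (k + 1 + q.1.1 + 2 * q.1.2)) := by
    refine FlatOn.sum _ fun q hq => ?_
    rw [Finset.mem_filter] at hq
    have hq2 := hq.2
    have hrp : FlatOn O 0 fun x => c q.1 q.2 * x.2.2 ^ q.1.2 := by
      simpa using (hr.pow q.1.2).const_mul (c q.1 q.2)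
    exact hrp.mul_left (((hw.pow _).mul (hz.pow _)).mono (by omega))
  refine ((h1.add h2).add h4).congr fun x _ => ?_
  rw [← Finset.sum_product', ← hA,
    ← Finset.sum_filter_add_sum_filter_not A (fun q => k + 1 + q.1.1 + 2 * q.1.2 + q.2 ≤ 14)]
  -- Reindexing by total degree d = k + 1 + i + 2j + a in σ. The factor (yz)^i contributes its y^i
  -- to the root series, which explains the index i + e of `rootCoeff`, and the power of z is d - a.
  have h5 : ∑ q ∈ A.filter (fun q => k + 1 + q.1.1 + 2 * q.1.2 + q.2 ≤ 14),
      c q.1 q.2 * x.2.2 ^ q.1.2 * (polarW x ^ q.2 * polarZ x ^ (k + 1 + q.1.1 + 2 * q.1.2)) =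
      ∑ q ∈ (Finset.range 15 ×ˢ Finset.range 7 ×ˢ Finset.range 13).filter
        (fun q => k + 1 + 2 * q.2.1 + q.2.2 ≤ q.1),
        ((radialCoeff k (q.1 - (k + 1 + 2 * q.2.1 + q.2.2)) q.2.1 *
          rootCoeff (q.1 - (k + 1 + 2 * q.2.1 + q.2.2) + e) q.2.2 : ℚ) : ℝ) * x.2.2 ^ q.2.1 *
          (polarW x ^ q.2.2 * polarZ x ^ (q.1 - q.2.2)) := by
    refine Finset.sum_bij' (fun q _ => (k + 1 + q.1.1 + 2 * q.1.2 + q.2, q.1.2, q.2))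
      (fun q _ => ((q.1 - (k + 1 + 2 * q.2.1 + q.2.2), q.2.1), q.2.2)) ?_ ?_ ?_ ?_ ?_
    · rintro ⟨⟨i, j⟩, a⟩ h
      simp only [hA, Finset.mem_filter, Finset.mem_product, mem_lowWeight, Finset.mem_range] at h ⊢
      omega
    · rintro ⟨d, j, a⟩ h
      simp only [hA, Finset.mem_filter, Finset.mem_product, mem_lowWeight, Finset.mem_range] at h ⊢
      omega
    · rintro ⟨⟨i, j⟩, a⟩ h
      simp only [Prod.mk.injEq, and_true]
      omega
    · rintro ⟨d, j, a⟩ h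
      simp only [Finset.mem_filter] at h
      simp only [Prod.mk.injEq, and_true]
      omega
    · rintro ⟨⟨i, j⟩, a⟩ h
      have e1 : k + 1 + i + 2 * j + a - (k + 1 + 2 * j + a) = i := by omega
      have e2 : k + 1 + i + 2 * j + a - a = k + 1 + i + 2 * j := by omega
      simp only [hc, e1, e2]
  rw [h5]
  ring

/-- Expansion of the integral of `basicIntegrand k e` over a period, with a remainder which is
small together with its derivative. -/
lemma basicIntegral_expansion (R : ℝ) : ∃ ρ, 0 < ρ ∧ ρ ≤ 1 / 4 ∧
    (∀ x ∈ polarDomain ρ R,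
      (polarY x * polarZ x, x.2.2 * polarZ x ^ 2) ∈ Metric.ball (0 : ℝ × ℝ) radialRadius) ∧
    ∀ k ∈ ({1, 2, 3} : Finset ℕ), ∀ e, ∃ C, 0 ≤ C ∧ ∀ r, |r| < R → ∀ σ, |σ| < ρ →
      |(∫ t in 0..2 * Real.pi, basicIntegrand k e (σ, t, r)) -
        2 * Real.pi * ∑ d ∈ Finset.range 15, meanPoly k e d r * σ ^ d| ≤ C * |σ| ^ 15 ∧
      ∃ D, HasDerivAt (fun σ => (∫ t in 0..2 * Real.pi, basicIntegrand k e (σ, t, r)) -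
        2 * Real.pi * ∑ d ∈ Finset.range 15, meanPoly k e d r * σ ^ d) D σ ∧ |D| ≤ C * |σ| ^ 14 := by
  -- The integral bound costs half of each range, so the expansion is taken on |r| < 2R.
  obtain ⟨ρ, hρ, hρ4, hrad, hX, hY⟩ := exists_polarDomain (2 * R)
  refine ⟨ρ / 2, by positivity, by linarith, fun x hx => hrad x
    ⟨by linarith [hx.1], by have := hx.2; have h0 := abs_nonneg x.2.2; linarith⟩, fun k hk e => ?_⟩
  have hflat := flatOn_basicIntegrand hρ4 hX hY hk e
  set A := (Finset.range 15 ×ˢ Finset.range 7 ×ˢ Finset.range 13).filter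
        (fun q => k + 1 + 2 * q.2.1 + q.2.2 ≤ q.1) with hA
  set c : ℕ × ℕ × ℕ → ℝ := fun q => ((radialCoeff k (q.1 - (k + 1 + 2 * q.2.1 + q.2.2)) q.2.1 *
          rootCoeff (q.1 - (k + 1 + 2 * q.2.1 + q.2.2) + e) q.2.2 : ℚ) : ℝ) with hc
  have hsum : ∀ σ r : ℝ, ∫ t in 0..2 * Real.pi, ∑ q ∈ A, c q * r ^ q.2.1 *
      (polarW (σ, t, r) ^ q.2.2 * polarZ (σ, t, r) ^ (q.1 - q.2.2)) =
      2 * Real.pi * ∑ d ∈ Finset.range 15, meanPoly k e d r * σ ^ d := by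
    intro σ r
    have hi : ∀ q ∈ A, IntervalIntegrable (fun t => c q * r ^ q.2.1 *
      (polarW (σ, t, r) ^ q.2.2 * polarZ (σ, t, r) ^ (q.1 - q.2.2))) volume 0 (2 * Real.pi) :=
        fun q _ => Continuous.intervalIntegrable (by simp only [polarW, polarZ]; fun_prop) _ _
    rw [intervalIntegral.integral_finsetSum hi]
    have h1 : ∀ q ∈ A, ∫ t in 0..2 * Real.pi, c q * r ^ q.2.1 *
        (polarW (σ, t, r) ^ q.2.2 * polarZ (σ, t, r) ^ (q.1 - q.2.2)) =
        2 * Real.pi * (c q * (trigMean q.2.2 (q.1 - q.2.2) : ℝ) * r ^ q.2.1 * σ ^ q.1) := by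
      intro q hq
      have hq2 : k + 1 + 2 * q.2.1 + q.2.2 ≤ q.1 := (Finset.mem_filter.1 hq).2
      have h2 : ∀ t, c q * r ^ q.2.1 * (polarW (σ, t, r) ^ q.2.2 * polarZ (σ, t, r) ^ (q.1 - q.2.2))
          = c q * r ^ q.2.1 * σ ^ q.1 * (Real.sin t ^ q.2.2 * Real.cos t ^ (q.1 - q.2.2)) := by
        intro t
        simp only [polarW, polarZ, mul_pow]
        have : σ ^ q.1 = σ ^ q.2.2 * σ ^ (q.1 - q.2.2) := by
          rw [← pow_add]; congr 1; omega
        rw [this]; ring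
      simp only [h2]
      rw [intervalIntegral.integral_const_mul, integral_sin_pow_mul_cos_pow_eq_trigMean]
      ring
    rw [Finset.sum_congr rfl h1, ← Finset.mul_sum]
    congr 1
    rw [hA, Finset.sum_filter, Finset.sum_product]
    refine Finset.sum_congr rfl fun d _ => ?_
    rw [Finset.sum_product, meanPoly, Finset.sum_mul]
    refine Finset.sum_congr rfl fun j _ => ?_
    rw [meanCoeff, Rat.cast_sum, Finset.sum_mul, Finset.sum_mul]
    refine Finset.sum_congr rfl fun a _ => ?_
    simp only [hc]
    split_ifs <;> push_cast <;> ring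
  obtain ⟨C, hC, hb⟩ := hflat.integral_bound hρ
  refine ⟨C, hC, fun r hr σ hσ => ?_⟩
  have hfun : ∀ s, |s| < ρ / 2 → (∫ t in 0..2 * Real.pi, basicIntegrand k e (s, t, r)) -
        2 * Real.pi * ∑ d ∈ Finset.range 15, meanPoly k e d r * s ^ d =
      ∫ t in 0..2 * Real.pi, (basicIntegrand k e (s, t, r) - ∑ q ∈ A, c q * r ^ q.2.1 *
      (polarW (s, t, r) ^ q.2.2 * polarZ (s, t, r) ^ (q.1 - q.2.2))) := by
    intro s hs
    rw [← hsum s r, intervalIntegral.integral_sub]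
    · have hcont : ContinuousOn (basicIntegrand k e) (polarDomain ρ (2 * R)) := by
        have hyc := (contDiffOn_polarY (R := 2 * R) hρ4).continuousOn
        have hxc := (contDiffOn_polarX hρ4 hrad).continuousOn
        have hzc := contDiff_polarZ.continuous
        exact ((hzc.pow _).continuousOn.mul (hxc.pow k)).mul ((hyc.pow e).div hyc fun x hx =>
          (polarY_spec (hx.1.trans_le hρ4)).1.ne')
      have : ContinuousOn (fun t => basicIntegrand k e (s, t, r)) univ :=
        hcont.comp (f := fun t : ℝ => (s, t, r)) (by fun_prop)
          (fun t _ => ⟨by change |s| < ρ; linarith, by change |r| < 2 * R; linarith [abs_nonneg r]⟩)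
      exact (continuousOn_univ.1 this).intervalIntegrable _ _
    · exact Continuous.intervalIntegrable (by simp only [polarW, polarZ]; fun_prop) _ _
  obtain ⟨b1, D, hD, b2⟩ := hb r (by linarith) σ hσ
  refine ⟨by rw [hfun σ hσ]; exact b1, D, ?_, b2⟩
  refine hD.congr_of_eventuallyEq ?_
  have : ∀ᶠ s in 𝓝 σ, |s| < ρ / 2 := continuous_abs.continuousAt (Iio_mem_nhds hσ)
  filter_upwards [this] with s hs using hfun s hs

/-! ### Explicit expansion coefficients through σ^14 -/

lemma meanPoly_eq {k e d : ℕ} (l : List ℚ)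
    (h : ∀ j ∈ Finset.range 7, meanCoeff k e d j = l.getD j 0) (r : ℝ) :
    meanPoly k e d r = ∑ j ∈ Finset.range 7, ((l.getD j 0 : ℚ) : ℝ) * r ^ j :=
  Finset.sum_congr rfl fun j hj => by rw [h j hj]

/-- The table covers the six pairs (k, e) that occur in `linComb`, in the even degrees 2 to 14. Each
list contains the coefficients by increasing powers of r, evaluated by the kernel from the closed
forms. -/
lemma meanPoly_1_0_2 (r : ℝ) : meanPoly 1 0 2 r =
    1 / 2 := by
  rw [meanPoly_eq [1 / 2] (by decide +kernel)]
  simp [Finset.sum_range_succ]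

lemma meanPoly_1_0_4 (r : ℝ) : meanPoly 1 0 4 r =
    9 / 8 - 3 / 8 * r := by
  rw [meanPoly_eq [9 / 8, -3 / 8] (by decide +kernel)]
  simp [Finset.sum_range_succ]; ring

lemma meanPoly_1_0_6 (r : ℝ) : meanPoly 1 0 6 r =
    295 / 32 - 159 / 16 * r + 35 / 32 * r ^ 2 := by
  rw [meanPoly_eq [295 / 32, -159 / 16, 35 / 32] (by decide +kernel)]
  simp [Finset.sum_range_succ]; ring

lemma meanPoly_1_0_8 (r : ℝ) : meanPoly 1 0 8 r =
    32475 / 256 - 56175 / 256 * r + 22575 / 256 * r ^ 2 - 1155 / 256 * r ^ 3 := by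
  rw [meanPoly_eq [32475 / 256, -56175 / 256, 22575 / 256, -1155 / 256] (by decide +kernel)]
  simp [Finset.sum_range_succ]; ring

lemma meanPoly_1_0_10 (r : ℝ) : meanPoly 1 0 10 r =
    4377429 / 2048 - 2563029 / 512 * r + 3633063 / 1024 * r ^ 2 - 383229 / 512 * r ^ 3 + 45045 / 2048 * r ^ 4 := by
  rw [meanPoly_eq [4377429 / 2048, -2563029 / 512, 3633063 / 1024, -383229 / 512, 45045 / 2048] (by decide +kernel)]
  simp [Finset.sum_range_succ]; ring

lemma meanPoly_1_0_12 (r : ℝ) : meanPoly 1 0 12 r =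
    327682047 / 8192 - 966652785 / 8192 * r + 489829725 / 4096 * r ^ 2 - 195080655 / 4096 * r ^ 3 + 50945895 / 8192 * r ^ 4 - 969969 / 8192 * r ^ 5 := by
  rw [meanPoly_eq [327682047 / 8192, -966652785 / 8192, 489829725 / 4096, -195080655 / 4096, 50945895 / 8192, -969969 / 8192] (by decide +kernel)]
  simp [Finset.sum_range_succ]; ring

lemma meanPoly_1_0_14 (r : ℝ) : meanPoly 1 0 14 r =
    26238148563 / 32768 - 46672332993 / 16384 * r + 122965765065 / 32768 * r ^ 2 - 18237778515 / 8192 * r ^ 3 + 18816242445 / 32768 * r ^ 4 - 836806113 / 16384 * r ^ 5 + 22309287 / 32768 * r ^ 6 := by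
  rw [meanPoly_eq [26238148563 / 32768, -46672332993 / 16384, 122965765065 / 32768, -18237778515 / 8192, 18816242445 / 32768, -836806113 / 16384, 22309287 / 32768] (by decide +kernel)]
  simp [Finset.sum_range_succ]; ring

lemma meanPoly_1_1_2 (r : ℝ) : meanPoly 1 1 2 r =
    1 / 2 := by
  rw [meanPoly_eq [1 / 2] (by decide +kernel)]
  simp [Finset.sum_range_succ]

lemma meanPoly_1_1_4 (r : ℝ) : meanPoly 1 1 4 r =
    15 / 16 - 3 / 8 * r := by
  rw [meanPoly_eq [15 / 16, -3 / 8] (by decide +kernel)]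
  simp [Finset.sum_range_succ]; ring

lemma meanPoly_1_1_6 (r : ℝ) : meanPoly 1 1 6 r =
    1155 / 128 - 315 / 32 * r + 35 / 32 * r ^ 2 := by
  rw [meanPoly_eq [1155 / 128, -315 / 32, 35 / 32] (by decide +kernel)]
  simp [Finset.sum_range_succ]; ring

lemma meanPoly_1_1_8 (r : ℝ) : meanPoly 1 1 8 r =
    264495 / 2048 - 225225 / 1024 * r + 45045 / 512 * r ^ 2 - 1155 / 256 * r ^ 3 := by
  rw [meanPoly_eq [264495 / 2048, -225225 / 1024, 45045 / 512, -1155 / 256] (by decide +kernel)]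
  simp [Finset.sum_range_succ]; ring

lemma meanPoly_1_1_10 (r : ℝ) : meanPoly 1 1 10 r =
    71828757 / 32768 - 20729709 / 4096 * r + 14549535 / 4096 * r ^ 2 - 765765 / 1024 * r ^ 3 + 45045 / 2048 * r ^ 4 := by
  rw [meanPoly_eq [71828757 / 32768, -20729709 / 4096, 14549535 / 4096, -765765 / 1024, 45045 / 2048] (by decide +kernel)]
  simp [Finset.sum_range_succ]; ring

lemma meanPoly_1_1_12 (r : ℝ) : meanPoly 1 1 12 r =
    10775385621 / 262144 - 15710587893 / 131072 * r + 3942923985 / 32768 * r ^ 2 - 780825045 / 16384 * r ^ 3 + 101846745 / 16384 * r ^ 4 - 969969 / 8192 * r ^ 5 := by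
  rw [meanPoly_eq [10775385621 / 262144, -15710587893 / 131072, 3942923985 / 32768, -780825045 / 16384, 101846745 / 16384, -969969 / 8192] (by decide +kernel)]
  simp [Finset.sum_range_succ]; ring

lemma meanPoly_1_1_14 (r : ℝ) : meanPoly 1 1 14 r =
    1727245553319 / 2097152 - 1521509308605 / 524288 * r + 1987518443625 / 524288 * r ^ 2 - 146460469155 / 65536 * r ^ 3 + 75293843625 / 131072 * r ^ 4 - 1673196525 / 32768 * r ^ 5 + 22309287 / 32768 * r ^ 6 := by
  rw [meanPoly_eq [1727245553319 / 2097152, -1521509308605 / 524288, 1987518443625 / 524288, -146460469155 / 65536, 75293843625 / 131072, -1673196525 / 32768, 22309287 / 32768] (by decide +kernel)]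
  simp [Finset.sum_range_succ]; ring

lemma meanPoly_1_2_2 (r : ℝ) : meanPoly 1 2 2 r =
    1 / 2 := by
  rw [meanPoly_eq [1 / 2] (by decide +kernel)]
  simp [Finset.sum_range_succ]

lemma meanPoly_1_2_4 (r : ℝ) : meanPoly 1 2 4 r =
    7 / 8 - 3 / 8 * r := by
  rw [meanPoly_eq [7 / 8, -3 / 8] (by decide +kernel)]
  simp [Finset.sum_range_succ]; ring

lemma meanPoly_1_2_6 (r : ℝ) : meanPoly 1 2 6 r =
    295 / 32 - 157 / 16 * r + 35 / 32 * r ^ 2 := by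
  rw [meanPoly_eq [295 / 32, -157 / 16, 35 / 32] (by decide +kernel)]
  simp [Finset.sum_range_succ]; ring

lemma meanPoly_1_2_8 (r : ℝ) : meanPoly 1 2 8 r =
    34065 / 256 - 56775 / 256 * r + 22505 / 256 * r ^ 2 - 1155 / 256 * r ^ 3 := by
  rw [meanPoly_eq [34065 / 256, -56775 / 256, 22505 / 256, -1155 / 256] (by decide +kernel)]
  simp [Finset.sum_range_succ]; ring

lemma meanPoly_1_2_10 (r : ℝ) : meanPoly 1 2 10 r =
    4629093 / 2048 - 2630691 / 512 * r + 3650871 / 1024 * r ^ 2 - 382767 / 512 * r ^ 3 + 45045 / 2048 * r ^ 4 := by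
  rw [meanPoly_eq [4629093 / 2048, -2630691 / 512, 3650871 / 1024, -382767 / 512, 45045 / 2048] (by decide +kernel)]
  simp [Finset.sum_range_succ]; ring

lemma meanPoly_1_2_12 (r : ℝ) : meanPoly 1 2 12 r =
    347298105 / 8192 - 1000555857 / 8192 * r + 497112399 / 4096 * r ^ 2 - 195588855 / 4096 * r ^ 3 + 50915865 / 8192 * r ^ 4 - 969969 / 8192 * r ^ 5 := by
  rw [meanPoly_eq [347298105 / 8192, -1000555857 / 8192, 497112399 / 4096, -195588855 / 4096, 50915865 / 8192, -969969 / 8192] (by decide +kernel)]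
  simp [Finset.sum_range_succ]; ring

lemma meanPoly_1_2_14 (r : ℝ) : meanPoly 1 2 14 r =
    27839301699 / 32768 - 48561921243 / 16384 * r + 125752377465 / 32768 * r ^ 2 - 18405202365 / 8192 * r ^ 3 + 18845277165 / 32768 * r ^ 4 - 836528979 / 16384 * r ^ 5 + 22309287 / 32768 * r ^ 6 := by
  rw [meanPoly_eq [27839301699 / 32768, -48561921243 / 16384, 125752377465 / 32768, -18405202365 / 8192, 18845277165 / 32768, -836528979 / 16384, 22309287 / 32768] (by decide +kernel)]
  simp [Finset.sum_range_succ]; ring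

lemma meanPoly_2_0_2 (r : ℝ) : meanPoly 2 0 2 r =
    0 := by
  rw [meanPoly_eq [] (by decide +kernel)]
  simp

lemma meanPoly_2_0_4 (r : ℝ) : meanPoly 2 0 4 r =
    -(3 / 4) := by
  rw [meanPoly_eq [-3 / 4] (by decide +kernel)]
  norm_num [Finset.sum_range_succ]

lemma meanPoly_2_0_6 (r : ℝ) : meanPoly 2 0 6 r =
    -(105 / 16) + 35 / 8 * r := by
  rw [meanPoly_eq [-105 / 16, 35 / 8] (by decide +kernel)]
  simp [Finset.sum_range_succ]; ring

lemma meanPoly_2_0_8 (r : ℝ) : meanPoly 2 0 8 r =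
    -(45045 / 512) + 15015 / 128 * r - 3465 / 128 * r ^ 2 := by
  rw [meanPoly_eq [-45045 / 512, 15015 / 128, -3465 / 128] (by decide +kernel)]
  simp [Finset.sum_range_succ]; ring

lemma meanPoly_2_0_10 (r : ℝ) : meanPoly 2 0 10 r =
    -(2981979 / 2048) + 2909907 / 1024 * r - 765765 / 512 * r ^ 2 + 45045 / 256 * r ^ 3 := by
  rw [meanPoly_eq [-2981979 / 2048, 2909907 / 1024, -765765 / 512, 45045 / 256] (by decide +kernel)]
  simp [Finset.sum_range_succ]; ring

lemma meanPoly_2_0_12 (r : ℝ) : meanPoly 2 0 12 r =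
    -(1766313549 / 65536) + 565491927 / 8192 * r - 468495027 / 8192 * r ^ 2 + 33948915 / 2048 * r ^ 3 - 4849845 / 4096 * r ^ 4 := by
  rw [meanPoly_eq [-1766313549 / 65536, 565491927 / 8192, -468495027 / 8192, 33948915 / 2048, -4849845 / 4096] (by decide +kernel)]
  simp [Finset.sum_range_succ]; ring

lemma meanPoly_2_0_14 (r : ℝ) : meanPoly 2 0 14 r =
    -(140405091255 / 262144) + 222535137825 / 131072 * r - 62921750463 / 32768 * r ^ 2 + 15058768725 / 16384 * r ^ 3 - 2788660875 / 16384 * r ^ 4 + 66927861 / 8192 * r ^ 5 := by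
  rw [meanPoly_eq [-140405091255 / 262144, 222535137825 / 131072, -62921750463 / 32768, 15058768725 / 16384, -2788660875 / 16384, 66927861 / 8192] (by decide +kernel)]
  simp [Finset.sum_range_succ]; ring

lemma meanPoly_2_1_2 (r : ℝ) : meanPoly 2 1 2 r =
    0 := by
  rw [meanPoly_eq [] (by decide +kernel)]
  simp

lemma meanPoly_2_1_4 (r : ℝ) : meanPoly 2 1 4 r =
    -(3 / 4) := by
  rw [meanPoly_eq [-3 / 4] (by decide +kernel)]
  norm_num [Finset.sum_range_succ]

lemma meanPoly_2_1_6 (r : ℝ) : meanPoly 2 1 6 r =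
    -(13 / 2) + 35 / 8 * r := by
  rw [meanPoly_eq [-13 / 2, 35 / 8] (by decide +kernel)]
  simp [Finset.sum_range_succ]; ring

lemma meanPoly_2_1_8 (r : ℝ) : meanPoly 2 1 8 r =
    -(11415 / 128) + 3745 / 32 * r - 3465 / 128 * r ^ 2 := by
  rw [meanPoly_eq [-11415 / 128, 3745 / 32, -3465 / 128] (by decide +kernel)]
  simp [Finset.sum_range_succ]; ring

lemma meanPoly_2_1_10 (r : ℝ) : meanPoly 2 1 10 r =
    -(190323 / 128) + 731955 / 256 * r - 47817 / 32 * r ^ 2 + 45045 / 256 * r ^ 3 := by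
  rw [meanPoly_eq [-190323 / 128, 731955 / 256, -47817 / 32, 45045 / 256] (by decide +kernel)]
  simp [Finset.sum_range_succ]; ring

lemma meanPoly_2_1_12 (r : ℝ) : meanPoly 2 1 12 r =
    -(113056377 / 4096) + 8942031 / 128 * r - 117505773 / 2048 * r ^ 2 + 8483475 / 512 * r ^ 3 - 4849845 / 4096 * r ^ 4 := by
  rw [meanPoly_eq [-113056377 / 4096, 8942031 / 128, -117505773 / 2048, 8483475 / 512, -4849845 / 4096] (by decide +kernel)]
  simp [Finset.sum_range_succ]; ring

lemma meanPoly_2_1_14 (r : ℝ) : meanPoly 2 1 14 r =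
    -(562576311 / 1024) + 14127298185 / 8192 * r - 3961910205 / 2048 * r ^ 2 + 3771958905 / 4096 * r ^ 3 - 348496005 / 2048 * r ^ 4 + 66927861 / 8192 * r ^ 5 := by
  rw [meanPoly_eq [-562576311 / 1024, 14127298185 / 8192, -3961910205 / 2048, 3771958905 / 4096, -348496005 / 2048, 66927861 / 8192] (by decide +kernel)]
  simp [Finset.sum_range_succ]; ring

lemma meanPoly_3_0_2 (r : ℝ) : meanPoly 3 0 2 r =
    0 := by
  rw [meanPoly_eq [] (by decide +kernel)]
  simp

lemma meanPoly_3_0_4 (r : ℝ) : meanPoly 3 0 4 r =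
    3 / 8 := by
  rw [meanPoly_eq [3 / 8] (by decide +kernel)]
  simp [Finset.sum_range_succ]

lemma meanPoly_3_0_6 (r : ℝ) : meanPoly 3 0 6 r =
    27 / 8 - 15 / 16 * r := by
  rw [meanPoly_eq [27 / 8, -15 / 16] (by decide +kernel)]
  simp [Finset.sum_range_succ]; ring

lemma meanPoly_3_0_8 (r : ℝ) : meanPoly 3 0 8 r =
    11235 / 256 - 1305 / 32 * r + 945 / 256 * r ^ 2 := by
  rw [meanPoly_eq [11235 / 256, -1305 / 32, 945 / 256] (by decide +kernel)]
  simp [Finset.sum_range_succ]; ring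

lemma meanPoly_3_0_10 (r : ℝ) : meanPoly 3 0 10 r =
    91791 / 128 - 573363 / 512 * r + 101493 / 256 * r ^ 2 - 9009 / 512 * r ^ 3 := by
  rw [meanPoly_eq [91791 / 128, -573363 / 512, 101493 / 256, -9009 / 512] (by decide +kernel)]
  simp [Finset.sum_range_succ]; ring

lemma meanPoly_3_0_12 (r : ℝ) : meanPoly 3 0 12 r =
    108217809 / 8192 - 29424087 / 1024 * r + 76319145 / 4096 * r ^ 2 - 909909 / 256 * r ^ 3 + 765765 / 8192 * r ^ 4 := by
  rw [meanPoly_eq [108217809 / 8192, -29424087 / 1024, 76319145 / 4096, -909909 / 256, 765765 / 8192] (by decide +kernel)]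
  simp [Finset.sum_range_succ]; ring

lemma meanPoly_3_0_14 (r : ℝ) : meanPoly 3 0 14 r =
    2145219219 / 8192 - 11948537205 / 16384 * r + 707921775 / 1024 * r ^ 2 - 2090467665 / 8192 * r ^ 3 + 251061525 / 8192 * r ^ 4 - 8729721 / 16384 * r ^ 5 := by
  rw [meanPoly_eq [2145219219 / 8192, -11948537205 / 16384, 707921775 / 1024, -2090467665 / 8192, 251061525 / 8192, -8729721 / 16384] (by decide +kernel)]
  simp [Finset.sum_range_succ]; ring

/-- A term of degree d carries sin^a cos^(d-a), whose mean vanishes when d is odd. -/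
lemma meanCoeff_odd : ∀ p ∈ ({(1, 0), (1, 1), (1, 2), (2, 0), (2, 1), (3, 0)} : Finset (ℕ × ℕ)),
    ∀ m ∈ Finset.range 7, ∀ j ∈ Finset.range 7, meanCoeff p.1 p.2 (2 * m + 1) j = 0 := by
  decide +kernel

/-- The integrand is divisible by z^(k+1), so there is no constant term. -/
lemma meanCoeff_zero : ∀ p ∈ ({(1, 0), (1, 1), (1, 2), (2, 0), (2, 1), (3, 0)} : Finset (ℕ × ℕ)),
    ∀ j ∈ Finset.range 7, meanCoeff p.1 p.2 0 j = 0 := by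
  decide +kernel

/-- Only the even powers `σ ^ 2, …, σ ^ 14` occur in the expansion. -/
lemma sum_meanPoly_eq {p : ℕ × ℕ}
    (hp : p ∈ ({(1, 0), (1, 1), (1, 2), (2, 0), (2, 1), (3, 0)} : Finset (ℕ × ℕ))) (r σ : ℝ) :
    ∑ d ∈ Finset.range 15, meanPoly p.1 p.2 d r * σ ^ d =
      ∑ m ∈ Finset.range 7, meanPoly p.1 p.2 (2 * (m + 1)) r * σ ^ (2 * (m + 1)) := by
  have hodd : ∀ m < 7, meanPoly p.1 p.2 (2 * m + 1) r = 0 := fun m hm =>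
    Finset.sum_eq_zero fun j hj => by
      rw [meanCoeff_odd p hp m (Finset.mem_range.2 hm) j hj]; simp
  have h0 : meanPoly p.1 p.2 0 r = 0 := Finset.sum_eq_zero fun j hj => by
    rw [meanCoeff_zero p hp j hj]; simp
  have h1 := hodd 0 (by norm_num)
  have h3 := hodd 1 (by norm_num)
  have h5 := hodd 2 (by norm_num)
  have h7 := hodd 3 (by norm_num)
  have h9 := hodd 4 (by norm_num)
  have h11 := hodd 5 (by norm_num)
  have h13 := hodd 6 (by norm_num)
  norm_num at h1 h3 h5 h7 h9 h11 h13
  simp [Finset.sum_range_succ, h0, h1, h3, h5, h7, h9, h11, h13]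

/-! ### Focal values and the elimination of the divergence coefficients -/

/-- The combination of the basic integrals that yields the first order Melnikov function of a
perturbation with divergence coefficients `c = (c₀₀, c₁₀, c₀₁, c₀₂, c₁₁, c₂₀)`. -/
noncomputable def linComb (c : Fin 6 → ℝ) (g : ℕ → ℕ → ℝ) : ℝ :=
  c 0 * g 1 0 + c 1 * (g 1 0 - g 1 1) + c 2 * (g 2 0 / 2) + c 3 * (g 3 0 / 3) +
    c 4 * ((g 2 0 - g 2 1) / 2) + c 5 * (g 1 0 - 2 * g 1 1 + g 1 2)

/-- The derivative of the quintic. -/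
noncomputable def quinticDeriv (r : ℝ) : ℝ :=
  -459924741 - 4187166208 * r - 4793534976 * r ^ 2 - 433455104 * r ^ 3 + 6909788160 * r ^ 4

/-- The denominator in the relation for `c₁₀`. -/
noncomputable def denTen (r : ℝ) : ℝ := 17680 * r - 43347

/-- The coefficient of `c₀₁` in the relation for `c₁₀`. -/
noncomputable def tenOne (r : ℝ) : ℝ := 1792 * r ^ 2 - 17328 * r - 696

/-- The coefficient of `c₂₀` in the relation for `c₁₀`. -/
noncomputable def tenTwo (r : ℝ) : ℝ := 11107 - 5680 * r

/-- Half the denominator in the relation for `c₂₀`. -/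
noncomputable def denTwenty (r : ℝ) : ℝ :=
  2770317 - 11417834 * r + 11442688 * r ^ 2 + 442880 * r ^ 3

/-- The numerator in the relation for `c₂₀`. -/
noncomputable def numTwenty (r : ℝ) : ℝ :=
  6544683 + 11682846 * r + 30378720 * r ^ 2 - 40278528 * r ^ 3 - 21471232 * r ^ 4

/-- The cofactor of the quintic in the sixth focal value. -/
noncomputable def sixthFactor (r : ℝ) : ℝ :=
  -6372009 / 1024 + 1560027 / 256 * r + 539007 / 256 * r ^ 2 - 23205 / 16 * r ^ 3

/-- The numerator of the seventh focal value. -/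
noncomputable def seventhValue (r : ℝ) : ℝ :=
  -776289021213023703 / 4096 + 1508904713659821291 / 4096 * r
  + 617753543188626999 / 2048 * r ^ 2 - 399373054164970347 / 1024 * r ^ 3
  - 201357711273355329 / 512 * r ^ 4 - 3599838893779293 / 32 * r ^ 5
  + 569073416535525 * r ^ 6 - 73858451102832 * r ^ 7 - 129715368182400 * r ^ 8
  + 35139704371200 * r ^ 9

lemma denTen_ne_zero {r : ℝ} (hr : quintic r = 0) : denTen r ≠ 0 := by
  intro h
  have h1 : r = 43347 / 17680 := by
    rw [denTen] at h
    linarith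
  rw [quintic, h1] at hr
  norm_num at hr

/-- A Bézout certificate: a polynomial combination of the quintic and its derivative is a nonzero
constant. All roots of the quintic are therefore simple, so moving r changes the sixth focal value
to first order. The three lemmas that follow use certificates of the same kind. -/
lemma quinticDeriv_ne_zero {r : ℝ} (hr : quintic r = 0) :
    quinticDeriv r ≠ 0 := by
  intro h
  rw [quintic] at hr
  rw [quinticDeriv] at h
  have : (-378629493710588036122796617600943601556153351348234008531 : ℝ) = 0 := by
    linear_combination
      (-456318804866476373179690992593164429536344579051
       + 83572683720678160250013380385540985456507527336 * r
       - 25227569910761230877144021912151467674095456256 * r ^ 2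
       + 357310551126164939134097404959329839860726282240 * r ^ 3) * hr +
      (48463928557019706545662454722623094571859366150
       + 156999082480632013449350626135884892178009417827 * r
       + 16326965157218397664542499776226364357514792536 * r ^ 2
       + 6166229107655378393114070298113419423204752384 * r ^ 3
       - 71462110225232987826819480991865967972145256448 * r ^ 4) * h
  norm_num at this

lemma denTwenty_ne_zero {r : ℝ} (hr : quintic r = 0) :
    denTwenty r ≠ 0 := by
  intro h
  rw [quintic] at hr
  rw [denTwenty] at h
  have : (4121251266764471229683005690694603251702574168463 : ℝ) = 0 := by
    linear_combination
      (492208144080406360919460315564959686197182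
       - 940188122235446790244171468243578717431488 * r
       - 35756873827273843856669372042281822215680 * r ^ 2) * hr +
      (-137256674045097577941444780075891910630146687
       - 218964663792905686915572015447744122536159904 * r
       - 109565597750818961560473010885351539729456640 * r ^ 2
       + 42231859816576938585526435005810819827310592 * r ^ 3
       + 111575335716361403250768950493313743916695552 * r ^ 4) * h
  norm_num at this

lemma sixthFactor_ne_zero {r : ℝ} (hr : quintic r = 0) :
    sixthFactor r ≠ 0 := by
  intro h
  rw [quintic] at hr
  rw [sixthFactor] at h
  have : (49095603471118740176174962893444436910486197563 : ℝ) = 0 := by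
    linear_combination
      (-29815953343910868287309596218570261792 - 2854714093636878950269645684462740900 * r
       + 6224074768296933409577583440218027200 * r ^ 2) * hr +
      (-11631496434418474486766508191503750522506240
       - 9545236931827197734105968796336361898508288 * r
       - 2259779298261093583945706877188979556876288 * r ^ 2
       + 5424737455988842510854298642567175027556352 * r ^ 3
       + 5930727086877192858478102706365778708398080 * r ^ 4) * h
  norm_num at this

/-- The seventh focal value survives where the first six vanish; it is the leading coefficient of
the limiting polynomial with six positive zeros. -/
lemma seventhValue_ne_zero {r : ℝ} (hr : quintic r = 0) :
    seventhValue r ≠ 0 := by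
  intro h
  rw [quintic] at hr
  rw [seventhValue] at h
  have : (2132021077656283036287909874508967773636080281573263736445154888990262250557005873265240091272456255394382446830284121542940 : ℝ) = 0 := by
    linear_combination
      (-26397847222902366401834585695742090080237313353066537757504898716805625576009304454471366198395895530388857823714903
       + 6056158972319903298653634779229524984365485660772199172619333770508942912951246987350613506747361742188738417897938 * r
       - 1542964533253200657629284287000100255195828787823487163905627880318487053506637383460277672578007193296955206761124 * r ^ 2
       + 64841593390032620136954902619598235147926463610233096449029500921664138050122431762475812779878413749640434913872568 * r ^ 3
       - 7668048229057179216087813447743558018565615919181597192443650921859201849013036408564868682619113844970230830353024 * r ^ 4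
       - 54890121640686004373648482184999016124365531079593984355224161924432626289679009146698428973858341431615061152575488 * r ^ 5
       + 13841363917184829495748418892510730715507918301953383885982728561014092784735723290693973557165955763764615209091072 * r ^ 6
       + 9873883116961618546226302292891881071061342615070883619313547574799691045651149324695909818970085455994921562931200 * r ^ 7
       - 3109190452190258760399417661878105959591147366484125002502402864523700183795219920365572483526560028692075197235200 * r ^ 8) * hr +
      (-120017303864949615793123017408422704466647991413233645898766690056962424464693140865193839054773343324742496256
       - 144268429471698508510965426254086486650279559911728595224650632919622711672315194981034815088604494059510169600 * r
       - 200883732391212187399510703815522705539761692391276778242961890094193276666402485127334214962423137857622245376 * r ^ 2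
       + 53471258525979784888258804646694784949608965460100851935335349181370936700735240844884047844701853908274774016 * r ^ 3
       + 122276767879340217924936012905851341090114244846770190976256369335974634742564208213814238010965566377187868672 * r ^ 4) * h
  norm_num at this

/-- The coefficient of `c₁₀` after eliminating `c₀₂` and `c₁₁`. -/
noncomputable def elimTen (r : ℝ) (g : ℕ → ℕ → ℝ) : ℝ :=
  (g 1 0 - g 1 1) - 3 / 2 * (g 3 0 / 3) + (12 * r - 191 / 4) * ((g 2 0 - g 2 1) / 2)

/-- The coefficient of `c₀₁` after eliminating `c₀₂` and `c₁₁`. -/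
noncomputable def elimOne (r : ℝ) (g : ℕ → ℕ → ℝ) : ℝ :=
  g 2 0 / 2 + 3 * (g 3 0 / 3) + (40 * r + 3) * ((g 2 0 - g 2 1) / 2)

/-- The coefficient of `c₂₀` after eliminating `c₀₂` and `c₁₁`. -/
noncomputable def elimTwo (r : ℝ) (g : ℕ → ℕ → ℝ) : ℝ :=
  (g 1 0 - 2 * g 1 1 + g 1 2) - g 3 0 / 3 + (8 * r - 47 / 2) * ((g 2 0 - g 2 1) / 2)

/-- The numerator of the coefficient of `c₂₀` after eliminating also `c₁₀`. -/
noncomputable def elimTwoNum (r : ℝ) (g : ℕ → ℕ → ℝ) : ℝ :=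
  denTen r * elimTwo r g + 2 * tenTwo r * elimTen r g

/-- The numerator of the coefficient of `c₀₁` after eliminating everything else. -/
noncomputable def elimNum (r : ℝ) (g : ℕ → ℕ → ℝ) : ℝ :=
  2 * denTwenty r * (denTen r * elimOne r g + 2 * tenOne r * elimTen r g) +
    numTwenty r * elimTwoNum r g

/-- The coefficients determined by the relations, with defects `e`. -/
noncomputable def relCoeff (r d e₀ e₂ e₃ e₄ e₅ : ℝ) : Fin 6 → ℝ :=
  let c20 := numTwenty r / (2 * denTwenty r) * d + e₅
  let c10 := 2 / denTen r * (tenOne r * d + tenTwo r * c20) + e₄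
  ![e₀, c10, d, -(3 / 2) * c10 + 3 * d - c20 + e₂,
    (12 * r - 191 / 4) * c10 + (40 * r + 3) * d + (8 * r - 47 / 2) * c20 + e₃, c20]

/-- Substituting the relations successively leaves a form linear in the defects and in `d`. The
factors in front of the defects are the pivots of a triangular elimination. -/
lemma linComb_relCoeff {r : ℝ} (hE : denTen r ≠ 0) (hD : denTwenty r ≠ 0) (d e₀ e₂ e₃ e₄ e₅ : ℝ)
    (g : ℕ → ℕ → ℝ) :
    linComb (relCoeff r d e₀ e₂ e₃ e₄ e₅) g = g 1 0 * e₀ + g 3 0 / 3 * e₂ +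
      (g 2 0 - g 2 1) / 2 * e₃ + elimTen r g * e₄ + elimTwoNum r g / denTen r * e₅ +
      elimNum r g / (2 * denTwenty r * denTen r) * d := by
  simp [linComb, relCoeff, elimNum, elimTwoNum]
  field_simp
  simp only [elimTen, elimOne, elimTwo]
  ring

/-- The coefficients of `σ ^ (2 * m)`. -/
noncomputable def evenMean (m : ℕ) (r : ℝ) (k e : ℕ) : ℝ := meanPoly k e (2 * m) r

lemma continuous_evenMean (m k e : ℕ) : Continuous fun r => evenMean m r k e := by
  simp only [evenMean, meanPoly]
  fun_prop

/-- The relations for c₀₂ and c₁₁ are exactly those that cancel the coefficients of σ⁴ and σ⁶,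
whatever c₁₀, c₀₁, c₂₀ and r are. This accounts for the six vanishing statements here. -/
lemma elimTen_two (r : ℝ) : elimTen r (evenMean 2 r) = 0 := by
  simp only [elimTen, evenMean, Nat.reduceMul,
    meanPoly_1_0_4, meanPoly_1_1_4, meanPoly_2_0_4,
    meanPoly_2_1_4, meanPoly_3_0_4]
  ring

lemma elimTen_three (r : ℝ) : elimTen r (evenMean 3 r) = 0 := by
  simp only [elimTen, evenMean, Nat.reduceMul,
    meanPoly_1_0_6, meanPoly_1_1_6, meanPoly_2_0_6,
    meanPoly_2_1_6, meanPoly_3_0_6]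
  ring

lemma elimOne_two (r : ℝ) : elimOne r (evenMean 2 r) = 0 := by
  simp only [elimOne, evenMean, Nat.reduceMul,
    meanPoly_2_0_4, meanPoly_2_1_4, meanPoly_3_0_4]
  ring

lemma elimOne_three (r : ℝ) : elimOne r (evenMean 3 r) = 0 := by
  simp only [elimOne, evenMean, Nat.reduceMul,
    meanPoly_2_0_6, meanPoly_2_1_6, meanPoly_3_0_6]
  ring

lemma elimTwo_two (r : ℝ) : elimTwo r (evenMean 2 r) = 0 := by
  simp only [elimTwo, evenMean, Nat.reduceMul,
    meanPoly_1_0_4, meanPoly_1_1_4, meanPoly_1_2_4,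
    meanPoly_2_0_4, meanPoly_2_1_4, meanPoly_3_0_4]
  ring

lemma elimTwo_three (r : ℝ) : elimTwo r (evenMean 3 r) = 0 := by
  simp only [elimTwo, evenMean, Nat.reduceMul,
    meanPoly_1_0_6, meanPoly_1_1_6, meanPoly_1_2_6,
    meanPoly_2_0_6, meanPoly_2_1_6, meanPoly_3_0_6]
  ring

/-- The pivot of c₁₀ in the σ⁸ coefficient; it is the denominator in the relation for c₁₀, which
cancels that coefficient. -/
lemma elimTen_four (r : ℝ) : elimTen r (evenMean 4 r) = 5 / 4096 * denTen r := by
  simp only [elimTen, denTen, evenMean, Nat.reduceMul,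
    meanPoly_1_0_8, meanPoly_1_1_8, meanPoly_2_0_8,
    meanPoly_2_1_8, meanPoly_3_0_8]
  ring

lemma elimTwoNum_four (r : ℝ) : elimTwoNum r (evenMean 4 r) = 0 := by
  simp only [elimTwoNum, elimTen, elimTwo, denTen, tenTwo, evenMean, Nat.reduceMul,
    meanPoly_1_0_8, meanPoly_1_1_8, meanPoly_1_2_8,
    meanPoly_2_0_8, meanPoly_2_1_8, meanPoly_3_0_8]
  ring

lemma elimNum_four (r : ℝ) : elimNum r (evenMean 4 r) = 0 := by
  simp only [elimNum, elimTwoNum, elimTen, elimOne, elimTwo, denTen, tenTwo, tenOne, denTwenty,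
    numTwenty, evenMean, Nat.reduceMul,
    meanPoly_1_0_8, meanPoly_1_1_8, meanPoly_1_2_8,
    meanPoly_2_0_8, meanPoly_2_1_8, meanPoly_3_0_8]
  ring

/-- The pivot of c₂₀ in the σ^10 coefficient, giving the denominator in the relation for c₂₀. -/
lemma elimTwoNum_five (r : ℝ) : elimTwoNum r (evenMean 5 r) = -(21 / 1024) * denTwenty r := by
  simp only [elimTwoNum, elimTen, elimTwo, denTen, tenTwo, denTwenty, evenMean, Nat.reduceMul,
    meanPoly_1_0_10, meanPoly_1_1_10, meanPoly_1_2_10,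
    meanPoly_2_0_10, meanPoly_2_1_10, meanPoly_3_0_10]
  ring

lemma elimNum_five (r : ℝ) : elimNum r (evenMean 5 r) = 0 := by
  simp only [elimNum, elimTwoNum, elimTen, elimOne, elimTwo, denTen, tenTwo, tenOne, denTwenty,
    numTwenty, evenMean, Nat.reduceMul,
    meanPoly_1_0_10, meanPoly_1_1_10, meanPoly_1_2_10,
    meanPoly_2_0_10, meanPoly_2_1_10, meanPoly_3_0_10]
  ring

/-- With the linear unknowns used up, only r can annihilate the σ^12 coefficient; this is the origin
of the quintic. -/
lemma elimNum_six (r : ℝ) : elimNum r (evenMean 6 r) = quintic r * sixthFactor r := by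
  simp only [elimNum, elimTwoNum, elimTen, elimOne, elimTwo, denTen, tenTwo, tenOne, denTwenty,
    numTwenty, quintic, sixthFactor, evenMean, Nat.reduceMul,
    meanPoly_1_0_12, meanPoly_1_1_12, meanPoly_1_2_12,
    meanPoly_2_0_12, meanPoly_2_1_12, meanPoly_3_0_12]
  ring

lemma elimNum_seven (r : ℝ) : elimNum r (evenMean 7 r) = seventhValue r := by
  simp only [elimNum, elimTwoNum, elimTen, elimOne, elimTwo, denTen, tenTwo, tenOne, denTwenty,
    numTwenty, seventhValue, evenMean, Nat.reduceMul,
    meanPoly_1_0_14, meanPoly_1_1_14, meanPoly_1_2_14,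
    meanPoly_2_0_14, meanPoly_2_1_14, meanPoly_3_0_14]
  ring

lemma hasDerivAt_quintic (r : ℝ) : HasDerivAt quintic (quinticDeriv r) r := by
  unfold quintic quinticDeriv
  have h (n : ℕ) := hasDerivAt_pow n r
  refine ((((((hasDerivAt_const r 780900831).fun_sub ((hasDerivAt_id' r).const_mul 459924741)).fun_sub
    ((h 2).const_mul 2093583104)).fun_sub ((h 3).const_mul 1597844992)).fun_sub
    ((h 4).const_mul 108363776)).fun_add ((h 5).const_mul 1381957632)).congr_deriv ?_
  norm_num
  ring

/-- The coefficients of `∏ (x - j ^ 2)`, `j = 1, …, 6`. -/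
def sixRootCoeff : Fin 7 → ℝ := ![518400, -773136, 296296, -44473, 3003, -91, 1]

/-- A one-parameter family of coefficients along which the focal values have prescribed sizes. -/
lemma exists_focal_family {r₀ d : ℝ} (hr : quintic r₀ = 0) (hd : d ≠ 0) :
    ∃ B : ℝ, B ≠ 0 ∧ ∃ (r : ℝ → ℝ) (c : ℝ → Fin 6 → ℝ), Tendsto r (𝓝[>] 0) (𝓝 r₀) ∧
      Tendsto c (𝓝[>] 0) (𝓝 (relCoeff r₀ d 0 0 0 0 0)) ∧
      ∀ i : Fin 7, Tendsto (fun s => linComb (c s) (evenMean (i + 1) (r s)) / s ^ (6 - i : ℕ))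
        (𝓝[>] 0) (𝓝 (B * sixRootCoeff i)) := by
  have hE := denTen_ne_zero hr
  have hD := denTwenty_ne_zero hr
  have hf := quinticDeriv_ne_zero hr
  have h6 := sixthFactor_ne_zero hr
  have h7 := seventhValue_ne_zero hr
  set B := seventhValue r₀ / (2 * denTwenty r₀ * denTen r₀) * d with hB
  -- `κ`, `l₄` and `l₅` solve the diagonal equations for the sixth, fourth and fifth focal values.
  -- The numbers -91, -44473 and 3003 are the corresponding entries of `sixRootCoeff`, and `B` is
  -- the limit of the seventh focal value.
  set κ := -91 * B * (2 * denTwenty r₀ * denTen r₀) / (sixthFactor r₀ * quinticDeriv r₀ * d) with hκ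
  set l₄ := -44473 * B / (5 / 4096 * denTen r₀) with hl₄
  set l₅ := 3003 * B / (-(21 / 1024) * denTwenty r₀ / denTen r₀) with hl₅
  set r : ℝ → ℝ := fun s => r₀ + κ * s with hrdef
  have hrc : Continuous r := by fun_prop
  have hr0 : r 0 = r₀ := by simp [hrdef]
  have hEc : Continuous denTen := by unfold denTen; fun_prop
  have hDc : Continuous denTwenty := by unfold denTwenty; fun_prop
  have hNc : Continuous numTwenty := by unfold numTwenty; fun_prop
  have h1c : Continuous tenOne := by unfold tenOne; fun_prop
  have h2c : Continuous tenTwo := by unfold tenTwo; fun_prop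
  have h6c : Continuous sixthFactor := by unfold sixthFactor; fun_prop
  have h7c : Continuous seventhValue := by unfold seventhValue; fun_prop
  have hrt : Tendsto r (𝓝[>] 0) (𝓝 r₀) := by
    rw [← hr0]
    exact hrc.continuousAt.tendsto.mono_left nhdsWithin_le_nhds
  have hE0 : ∀ᶠ s in 𝓝[>] (0 : ℝ), denTen (r s) ≠ 0 :=
    (hEc.continuousAt.tendsto.comp hrt).eventually_ne hE
  have hD0 : ∀ᶠ s in 𝓝[>] (0 : ℝ), denTwenty (r s) ≠ 0 :=
    (hDc.continuousAt.tendsto.comp hrt).eventually_ne hD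
  have hid : Tendsto (fun s : ℝ => s) (𝓝[>] 0) (𝓝 0) := nhdsWithin_le_nhds
  have hEt := hEc.continuousAt.tendsto.comp hrt
  have hDt := hDc.continuousAt.tendsto.comp hrt
  have h6t := h6c.continuousAt.tendsto.comp hrt
  have h7t := h7c.continuousAt.tendsto.comp hrt
  have hqt : Tendsto (fun s => quintic (r s) / s) (𝓝[>] 0) (𝓝 (κ * quinticDeriv r₀)) := by
    have h1 : HasDerivAt (fun s => quintic (r s)) (quinticDeriv r₀ * κ) 0 := by
      have h2 : HasDerivAt r κ 0 := by
        exact (((hasDerivAt_id' (0 : ℝ)).const_mul κ).const_add r₀).congr_deriv (mul_one κ)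
      exact (hr0 ▸ hasDerivAt_quintic (r 0) : HasDerivAt quintic (quinticDeriv r₀) (r 0)).comp 0 h2
    have h3 := h1.tendsto_slope_zero_right
    rw [mul_comm]
    refine h3.congr fun s => ?_
    simp [hr0, hr]
    ring
  have hev (m k e : ℕ) : Tendsto (fun s => evenMean m (r s) k e) (𝓝[>] 0) (𝓝 (evenMean m r₀ k e)) :=
    (continuous_evenMean m k e).continuousAt.tendsto.comp hrt
  have helim (m : ℕ) : Tendsto (fun s => elimTen (r s) (evenMean m (r s))) (𝓝[>] 0)
      (𝓝 (elimTen r₀ (evenMean m r₀))) :=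
    ((((hev m 1 0).sub (hev m 1 1)).sub (((hev m 3 0).div_const 3).const_mul _))).add
      (((hrt.const_mul 12).sub_const _).mul (((hev m 2 0).sub (hev m 2 1)).div_const 2))
  have helim' (m : ℕ) : Tendsto (fun s => elimTwo (r s) (evenMean m (r s))) (𝓝[>] 0)
      (𝓝 (elimTwo r₀ (evenMean m r₀))) :=
    (((((hev m 1 0).sub ((hev m 1 1).const_mul 2)).add (hev m 1 2)).sub ((hev m 3 0).div_const 3))).add
      (((hrt.const_mul 8).sub_const _).mul (((hev m 2 0).sub (hev m 2 1)).div_const 2))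
  have helimTwo (m : ℕ) : Tendsto (fun s => elimTwoNum (r s) (evenMean m (r s))) (𝓝[>] 0)
      (𝓝 (elimTwoNum r₀ (evenMean m r₀))) :=
    (hEt.mul (helim' m)).add
      (((h2c.continuousAt.tendsto.comp hrt).const_mul 2).mul (helim m))
  -- The factors 2, 8 and -32 invert the coefficients 1/2, 1/8 and -1/32 with which the defects of
  -- c₀₀, c₀₂ and c₁₁ enter the first three focal values. The defect assigned to the m-th value has
  -- size s^(7-m), so its effect on any later value is of higher order than that value and
  -- disappears in the limit.
  refine ⟨B, by simp only [hB]; positivity, r,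
    fun s => relCoeff (r s) d (2 * (518400 * B) * s ^ 6) (8 * (-773136 * B) * s ^ 5)
      (-32 * (296296 * B) * s ^ 4) (l₄ * s ^ 3) (l₅ * s ^ 2), hrt, ?_, ?_⟩
  · rw [show relCoeff r₀ d 0 0 0 0 0 = relCoeff (r 0) d (2 * (518400 * B) * 0 ^ 6)
      (8 * (-773136 * B) * 0 ^ 5) (-32 * (296296 * B) * 0 ^ 4) (l₄ * 0 ^ 3) (l₅ * 0 ^ 2) by simp [hr0]]
    have hEr : denTen (r 0) ≠ 0 := by rwa [hr0]
    have hDr : 2 * denTwenty (r 0) ≠ 0 := by rw [hr0]; positivity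
    refine Tendsto.mono_left (ContinuousAt.tendsto ?_) nhdsWithin_le_nhds
    have hc20 : ContinuousAt (fun s => numTwenty (r s) / (2 * denTwenty (r s)) * d + l₅ * s ^ 2) 0 := by
      fun_prop (disch := assumption)
    have hc10 : ContinuousAt (fun s => 2 / denTen (r s) * (tenOne (r s) * d + tenTwo (r s) *
        (numTwenty (r s) / (2 * denTwenty (r s)) * d + l₅ * s ^ 2)) + l₄ * s ^ 3) 0 := by
      fun_prop (disch := assumption)
    refine continuousAt_pi.2 fun i => ?_
    fin_cases i
    · simp [relCoeff]; fun_prop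
    · exact hc10
    · exact continuousAt_const
    · exact (((hc10.const_mul _).add continuousAt_const).sub hc20).add (by fun_prop)
    · exact (((ContinuousAt.mul (by fun_prop) hc10).add (by fun_prop)).add
        (ContinuousAt.mul (by fun_prop) hc20)).add (by fun_prop)
    · exact hc20
  · set c : ℝ → Fin 6 → ℝ := fun s => relCoeff (r s) d (2 * (518400 * B) * s ^ 6)
      (8 * (-773136 * B) * s ^ 5) (-32 * (296296 * B) * s ^ 4) (l₄ * s ^ 3) (l₅ * s ^ 2) with hc
    -- It suffices to factor s^j out of the m-th focal value for small s > 0, where both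
    -- denominators are nonzero.
    have hmain (m : ℕ) (G : ℝ → ℝ) (b : ℝ) (hG : Tendsto G (𝓝[>] 0) (𝓝 b)) (j : ℕ)
        (h : ∀ s, 0 < s → denTen (r s) ≠ 0 → denTwenty (r s) ≠ 0 →
          evenMean m (r s) 1 0 * (2 * (518400 * B) * s ^ 6) +
          evenMean m (r s) 3 0 / 3 * (8 * (-773136 * B) * s ^ 5) +
          (evenMean m (r s) 2 0 - evenMean m (r s) 2 1) / 2 * (-32 * (296296 * B) * s ^ 4) +
          elimTen (r s) (evenMean m (r s)) * (l₄ * s ^ 3) +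
          elimTwoNum (r s) (evenMean m (r s)) / denTen (r s) * (l₅ * s ^ 2) +
          elimNum (r s) (evenMean m (r s)) / (2 * denTwenty (r s) * denTen (r s)) * d =
            s ^ j * G s) :
        Tendsto (fun s => linComb (c s) (evenMean m (r s)) / s ^ j) (𝓝[>] 0) (𝓝 b) := by
      refine hG.congr' ?_
      filter_upwards [hE0, hD0, self_mem_nhdsWithin] with s h1 h2 h3
      rw [hc, linComb_relCoeff h1 h2, h s h3 h1 h2, mul_div_cancel_left₀ _ (pow_ne_zero _ h3.ne')]
    have hlim {G : ℝ → ℝ} {b b' : ℝ} (h : Tendsto G (𝓝[>] 0) (𝓝 b)) (e : b = b') :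
        Tendsto G (𝓝[>] 0) (𝓝 b') := e ▸ h
    intro i
    fin_cases i
    · refine hmain 1 (fun _ => B * 518400) _ tendsto_const_nhds 6 fun s _ _ _ => ?_
      simp only [elimNum, elimTwoNum, elimTen, elimOne, elimTwo, evenMean, Nat.reduceMul,
        meanPoly_1_0_2, meanPoly_1_1_2, meanPoly_1_2_2, meanPoly_2_0_2, meanPoly_2_1_2, meanPoly_3_0_2]
      ring
    · refine hmain 2 (fun s => evenMean 2 (r s) 1 0 * (2 * (518400 * B)) * s + B * -773136) _ ?_ 5
        fun s _ _ _ => ?_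
      · simpa [sixRootCoeff] using (((hev 2 1 0).mul_const (2 * (518400 * B))).mul hid).add_const (B * -773136)
      · simp only [elimNum, elimTwoNum, elimTen_two, elimOne_two, elimTwo_two]
        simp only [evenMean, Nat.reduceMul, meanPoly_2_0_4, meanPoly_2_1_4, meanPoly_3_0_4]
        ring
    · refine hmain 3 (fun s => evenMean 3 (r s) 1 0 * (2 * (518400 * B)) * s ^ 2 +
        evenMean 3 (r s) 3 0 / 3 * (8 * (-773136 * B)) * s + B * 296296) _ ?_ 4 fun s _ _ _ => ?_
      · simpa [sixRootCoeff] using ((((hev 3 1 0).mul_const (2 * (518400 * B))).mul (hid.pow 2)).add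
          ((((hev 3 3 0).div_const 3).mul_const (8 * (-773136 * B))).mul hid)).add_const (B * 296296)
      · simp only [elimNum, elimTwoNum, elimTen_three, elimOne_three, elimTwo_three]
        simp only [evenMean, Nat.reduceMul, meanPoly_2_0_6, meanPoly_2_1_6]
        ring
    · refine hmain 4 (fun s => evenMean 4 (r s) 1 0 * (2 * (518400 * B)) * s ^ 3 +
        evenMean 4 (r s) 3 0 / 3 * (8 * (-773136 * B)) * s ^ 2 +
        (evenMean 4 (r s) 2 0 - evenMean 4 (r s) 2 1) / 2 * (-32 * (296296 * B)) * s +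
        5 / 4096 * denTen (r s) * l₄) _ ?_ 3 fun s _ _ _ => ?_
      · have h := (((((hev 4 1 0).mul_const (2 * (518400 * B))).mul (hid.pow 3)).add
          ((((hev 4 3 0).div_const 3).mul_const (8 * (-773136 * B))).mul (hid.pow 2))).add
          (((((hev 4 2 0).sub (hev 4 2 1)).div_const 2).mul_const (-32 * (296296 * B))).mul hid)).add
          ((hEt.const_mul (5 / 4096)).mul_const l₄)
        refine hlim h ?_
        simp [sixRootCoeff, hl₄]
        field_simp
      · simp only [elimTen_four, elimTwoNum_four, elimNum_four]
        ring
    · refine hmain 5 (fun s => evenMean 5 (r s) 1 0 * (2 * (518400 * B)) * s ^ 4 +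
        evenMean 5 (r s) 3 0 / 3 * (8 * (-773136 * B)) * s ^ 3 +
        (evenMean 5 (r s) 2 0 - evenMean 5 (r s) 2 1) / 2 * (-32 * (296296 * B)) * s ^ 2 +
        elimTen (r s) (evenMean 5 (r s)) * l₄ * s +
        -(21 / 1024) * denTwenty (r s) / denTen (r s) * l₅) _ ?_ 2 fun s _ _ _ => ?_
      · have h := ((((((hev 5 1 0).mul_const (2 * (518400 * B))).mul (hid.pow 4)).add
          ((((hev 5 3 0).div_const 3).mul_const (8 * (-773136 * B))).mul (hid.pow 3))).add
          (((((hev 5 2 0).sub (hev 5 2 1)).div_const 2).mul_const (-32 * (296296 * B))).mul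
            (hid.pow 2))).add (((helim 5).mul_const l₄).mul hid)).add
          (((hDt.const_mul (-(21 / 1024))).div hEt hE).mul_const l₅)
        refine hlim h ?_
        simp [sixRootCoeff, hl₅]
        field_simp
      · simp only [elimTwoNum_five, elimNum_five]
        ring
    · refine hmain 6 (fun s => evenMean 6 (r s) 1 0 * (2 * (518400 * B)) * s ^ 5 +
        evenMean 6 (r s) 3 0 / 3 * (8 * (-773136 * B)) * s ^ 4 +
        (evenMean 6 (r s) 2 0 - evenMean 6 (r s) 2 1) / 2 * (-32 * (296296 * B)) * s ^ 3 +
        elimTen (r s) (evenMean 6 (r s)) * l₄ * s ^ 2 +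
        elimTwoNum (r s) (evenMean 6 (r s)) / denTen (r s) * l₅ * s +
        quintic (r s) / s * sixthFactor (r s) / (2 * denTwenty (r s) * denTen (r s)) * d) _ ?_ 1
          fun s hs _ _ => ?_
      · have h := (((((((hev 6 1 0).mul_const (2 * (518400 * B))).mul (hid.pow 5)).add
          ((((hev 6 3 0).div_const 3).mul_const (8 * (-773136 * B))).mul (hid.pow 4))).add
          (((((hev 6 2 0).sub (hev 6 2 1)).div_const 2).mul_const (-32 * (296296 * B))).mul
            (hid.pow 3))).add (((helim 6).mul_const l₄).mul (hid.pow 2))).add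
          ((((helimTwo 6).div hEt hE).mul_const l₅).mul hid)).add
          (((hqt.mul h6t).div ((hDt.const_mul 2).mul hEt) (by positivity)).mul_const d)
        refine hlim h ?_
        simp [sixRootCoeff, hκ]
        field_simp
      · simp only [elimNum_six]
        field_simp
    · refine hmain 7 (fun s => evenMean 7 (r s) 1 0 * (2 * (518400 * B)) * s ^ 6 +
        evenMean 7 (r s) 3 0 / 3 * (8 * (-773136 * B)) * s ^ 5 +
        (evenMean 7 (r s) 2 0 - evenMean 7 (r s) 2 1) / 2 * (-32 * (296296 * B)) * s ^ 4 +
        elimTen (r s) (evenMean 7 (r s)) * l₄ * s ^ 3 +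
        elimTwoNum (r s) (evenMean 7 (r s)) / denTen (r s) * l₅ * s ^ 2 +
        seventhValue (r s) / (2 * denTwenty (r s) * denTen (r s)) * d) _ ?_ 0
          fun s hs _ _ => ?_
      · have h := (((((((hev 7 1 0).mul_const (2 * (518400 * B))).mul (hid.pow 6)).add
          ((((hev 7 3 0).div_const 3).mul_const (8 * (-773136 * B))).mul (hid.pow 5))).add
          (((((hev 7 2 0).sub (hev 7 2 1)).div_const 2).mul_const (-32 * (296296 * B))).mul
            (hid.pow 4))).add (((helim 7).mul_const l₄).mul (hid.pow 3))).add
          ((((helimTwo 7).div hEt hE).mul_const l₅).mul (hid.pow 2))).add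
          ((h7t.div ((hDt.const_mul 2).mul hEt) (by positivity)).mul_const d)
        refine hlim h ?_
        simp [sixRootCoeff, hB]
      · simp only [elimNum_seven]
        ring

/-! ### Six simple zeros of the Melnikov function -/

lemma eventually_exists_simple_zero {ι : Type*} {l : Filter ι} {N N' : ι → ℝ → ℝ} {Q Q' : ℝ → ℝ}
    {a δ : ℝ} (hδ : 0 < δ) (hQ : ∀ x, HasDerivAt Q (Q' x) x) (hQ' : Continuous Q') (ha : Q a = 0)
    (ha' : Q' a ≠ 0) (hN : ∀ x, |x - a| ≤ δ → Tendsto (fun i => N i x) l (𝓝 (Q x)))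
    (hN' : ∀ κ > 0, ∀ᶠ i in l, ∀ x, |x - a| ≤ δ → HasDerivAt (N i) (N' i x) x ∧ |N' i x - Q' x| < κ) :
    ∀ᶠ i in l, ∃ x, |x - a| ≤ δ ∧ N i x = 0 ∧ N' i x ≠ 0 ∧ HasDerivAt (N i) (N' i x) x := by
  wlog hpos : 0 < Q' a generalizing N N' Q Q'
  · have h := this (N := fun i x => -N i x) (N' := fun i x => -N' i x) (Q := fun x => -Q x)
      (Q' := fun x => -Q' x) (fun x => (hQ x).fun_neg) hQ'.neg (by simp [ha]) (by simpa using ha')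
      (fun x hx => (hN x hx).neg) (fun κ hκ => (hN' κ hκ).mono fun i hi x hx =>
        ⟨(hi x hx).1.fun_neg, by
          rw [neg_sub_neg, abs_sub_comm]
          exact (hi x hx).2⟩)
      (by
        have := lt_of_le_of_ne (not_lt.1 hpos) ha'
        simpa using this)
    refine h.mono fun i ⟨x, hx, hx0, hx1, hx2⟩ => ⟨x, hx, neg_eq_zero.1 hx0, neg_ne_zero.1 hx1, ?_⟩
    simpa using hx2.fun_neg
  obtain ⟨δ₁, hδ₁, hQδ⟩ := Metric.continuous_iff.1 hQ' a (Q' a / 2) (by positivity)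
  -- On this interval Q' > Q'(a)/2, so Q has opposite signs at the endpoints. A derivative error
  -- below Q'(a)/2 keeps N' positive at the zero found by the intermediate value theorem.
  set e := min δ (δ₁ / 2) with he
  have he0 : 0 < e := lt_min hδ (by positivity)
  have hQpos : ∀ x, |x - a| ≤ e → Q' a / 2 < Q' x := fun x hx => by
    have := hQδ x (by
      rw [Real.dist_eq]
      exact hx.trans_lt ((min_le_right _ _).trans_lt (by linarith)))
    rw [Real.dist_eq] at this
    linarith [(abs_lt.1 this).1]
  have hmono : StrictMonoOn Q (Icc (a - e) (a + e)) := by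
    refine strictMonoOn_of_deriv_pos (convex_Icc _ _) (fun x _ => (hQ x).continuousAt.continuousWithinAt)
      fun x hx => ?_
    rw [interior_Icc] at hx
    rw [(hQ x).deriv]
    have := hQpos x (abs_le.2 ⟨by linarith [hx.1], by linarith [hx.2]⟩)
    linarith
  have h1 : Q (a - e) < 0 := by
    rw [← ha]
    exact hmono ⟨le_rfl, by linarith⟩ ⟨by linarith, by linarith⟩ (by linarith)
  have h2 : 0 < Q (a + e) := by
    rw [← ha]
    exact hmono ⟨by linarith, by linarith⟩ ⟨by linarith, le_rfl⟩ (by linarith)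
  have hle : e ≤ δ := min_le_left _ _
  filter_upwards [(hN (a - e) (by simpa [abs_of_pos he0] using hle)).eventually_lt_const h1,
    (hN (a + e) (by simpa [abs_of_pos he0] using hle)).eventually_const_lt h2,
    hN' (Q' a / 2) (by positivity)] with i hi1 hi2 hi3
  have hcont : ContinuousOn (N i) (Icc (a - e) (a + e)) := fun x hx =>
    (hi3 x ((abs_le.2 ⟨by linarith [hx.1], by linarith [hx.2]⟩))).1.continuousAt.continuousWithinAt
  obtain ⟨x, hx, hx0⟩ := intermediate_value_Icc (by linarith) hcont ⟨hi1.le, hi2.le⟩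
  have hxe : |x - a| ≤ e := abs_le.2 ⟨by linarith [hx.1], by linarith [hx.2]⟩
  refine ⟨x, hxe.trans hle, hx0, ?_, (hi3 x (hxe.trans hle)).1⟩
  have h3 := hQpos x hxe
  have h4 := (abs_lt.1 (hi3 x (hxe.trans hle)).2).1
  have : 0 < N' i x := by linarith
  exact this.ne'

/-- The absolute weights of the six terms add up to 1 + 2 + 1/2 + 1/3 + 1 + 4 < 9. -/
lemma abs_linComb_le (c : Fin 6 → ℝ) {g : ℕ → ℕ → ℝ} {A : ℝ}
    (h : ∀ k ∈ ({1, 2, 3} : Finset ℕ), ∀ e ∈ Finset.range 3, |g k e| ≤ A) :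
    |linComb c g| ≤ 9 * ‖c‖ * A := by
  have hA : 0 ≤ A := (abs_nonneg _).trans (h 1 (by simp) 0 (by simp))
  have hc (i : Fin 6) (x : ℝ) (K : ℝ) (hx : |x| ≤ K) : |c i * x| ≤ ‖c‖ * K := by
    rw [abs_mul]
    exact mul_le_mul (norm_le_pi_norm c i) hx (abs_nonneg _) (norm_nonneg _)
  have h10 := abs_le.1 (h 1 (by simp) 0 (by simp))
  have h11 := abs_le.1 (h 1 (by simp) 1 (by simp))
  have h12 := abs_le.1 (h 1 (by simp) 2 (by simp))
  have h20 := abs_le.1 (h 2 (by simp) 0 (by simp))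
  have h21 := abs_le.1 (h 2 (by simp) 1 (by simp))
  have h30 := abs_le.1 (h 3 (by simp) 0 (by simp))
  have t0 := abs_le.1 (hc 0 (g 1 0) A (abs_le.2 h10))
  have t1 := abs_le.1 (hc 1 (g 1 0 - g 1 1) (2 * A) (abs_le.2 ⟨by linarith, by linarith⟩))
  have t2 := abs_le.1 (hc 2 (g 2 0 / 2) (A / 2) (abs_le.2 ⟨by linarith, by linarith⟩))
  have t3 := abs_le.1 (hc 3 (g 3 0 / 3) (A / 3) (abs_le.2 ⟨by linarith, by linarith⟩))
  have t4 := abs_le.1 (hc 4 ((g 2 0 - g 2 1) / 2) A (abs_le.2 ⟨by linarith, by linarith⟩))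
  have t5 := abs_le.1 (hc 5 (g 1 0 - 2 * g 1 1 + g 1 2) (4 * A) (abs_le.2 ⟨by linarith, by linarith⟩))
  have hcA : 0 ≤ ‖c‖ * A := by positivity
  rw [linComb]
  exact abs_le.2 ⟨by linarith, by linarith⟩

lemma hasDerivAt_linComb (c : Fin 6 → ℝ) {g : ℕ → ℕ → ℝ → ℝ} {g' : ℕ → ℕ → ℝ} {x : ℝ}
    (h : ∀ k ∈ ({1, 2, 3} : Finset ℕ), ∀ e ∈ Finset.range 3, HasDerivAt (g k e) (g' k e) x) :
    HasDerivAt (fun x => linComb c fun k e => g k e x) (linComb c g') x := by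
  have h10 := h 1 (by simp) 0 (by simp)
  have h11 := h 1 (by simp) 1 (by simp)
  have h12 := h 1 (by simp) 2 (by simp)
  have h20 := h 2 (by simp) 0 (by simp)
  have h21 := h 2 (by simp) 1 (by simp)
  have h30 := h 3 (by simp) 0 (by simp)
  exact ((((((h10.const_mul (c 0)).fun_add ((h10.fun_sub h11).const_mul (c 1))).fun_add
    ((h20.div_const 2).const_mul (c 2))).fun_add ((h30.div_const 3).const_mul (c 3))).fun_add
    (((h20.fun_sub h21).div_const 2).const_mul (c 4))).fun_add
    (((h10.fun_sub (h11.const_mul 2)).fun_add h12).const_mul (c 5)))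

/-- The first order Melnikov function. -/
noncomputable def melnikov (c : Fin 6 → ℝ) (r σ : ℝ) : ℝ :=
  ∫ t in 0..2 * Real.pi, linComb c fun k e => basicIntegrand k e (σ, t, r)

lemma continuous_basicIntegrand {ρ R : ℝ} (hρ : ρ ≤ 1 / 4)
    (h : ∀ x ∈ polarDomain ρ R,
      (polarY x * polarZ x, x.2.2 * polarZ x ^ 2) ∈ Metric.ball (0 : ℝ × ℝ) radialRadius)
    (k e : ℕ) {σ r : ℝ} (hσ : |σ| < ρ) (hr : |r| < R) :
    Continuous fun t => basicIntegrand k e (σ, t, r) := by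
  have hm : ∀ t, (σ, t, r) ∈ polarDomain ρ R := fun t => ⟨hσ, hr⟩
  have hY : Continuous fun t => polarY (σ, t, r) :=
    (contDiffOn_polarY hρ).continuousOn.comp_continuous (by fun_prop) hm
  have hX : Continuous fun t => polarX (σ, t, r) :=
    (contDiffOn_polarX hρ h).continuousOn.comp_continuous (by fun_prop) hm
  have hZ : Continuous fun t => polarZ (σ, t, r) := contDiff_polarZ.continuous.comp (by fun_prop)
  have hY0 : ∀ t, polarY (σ, t, r) ≠ 0 := fun t => (polarY_spec (hσ.trans_le hρ)).1.ne'
  exact ((hZ.pow _).mul (hX.pow _)).mul ((hY.pow _).div hY hY0)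

/-- Both sides vanish at b = a and have the same derivative in the upper limit, so no termwise
splitting of the integral is needed. -/
lemma linComb_integral (c : Fin 6 → ℝ) {g : ℕ → ℕ → ℝ → ℝ} (h : ∀ k e, Continuous (g k e)) (a b : ℝ) :
    ∫ t in a..b, linComb c (fun k e => g k e t) = linComb c fun k e => ∫ t in a..b, g k e t := by
  have hd (x : ℝ) : HasDerivAt (fun x => linComb c fun k e => ∫ t in a..x, g k e t)
      (linComb c fun k e => g k e x) x :=
    hasDerivAt_linComb c fun k _ e _ => intervalIntegral.integral_hasDerivAt_right
      ((h k e).intervalIntegrable _ _) (h k e).stronglyMeasurable.stronglyMeasurableAtFilter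
      (h k e).continuousAt
  have hc : Continuous fun x => linComb c fun k e => g k e x := by
    unfold linComb
    fun_prop
  rw [intervalIntegral.integral_eq_sub_of_hasDerivAt (fun x _ => hd x) (hc.intervalIntegrable _ _)]
  simp [linComb]

lemma linComb_sub_sum (c : Fin 6 → ℝ) (r σ : ℝ) (I : ℕ → ℕ → ℝ) :
    (linComb c fun k e => I k e - 2 * Real.pi * ∑ d ∈ Finset.range 15, meanPoly k e d r * σ ^ d) =
      linComb c I - 2 * Real.pi * ∑ i : Fin 7, linComb c (evenMean (i + 1) r) * σ ^ (2 * (i + 1 : ℕ)) := by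
  have h (k e : ℕ) (h : (k, e) ∈ ({(1, 0), (1, 1), (1, 2), (2, 0), (2, 1), (3, 0)} : Finset (ℕ × ℕ))) :=
    sum_meanPoly_eq h r σ
  simp only [linComb]
  rw [h 1 0 (by decide), h 1 1 (by decide), h 1 2 (by decide), h 2 0 (by decide), h 2 1 (by decide),
    h 3 0 (by decide)]
  rw [Fin.sum_univ_eq_sum_range (fun i => (c 0 * evenMean (i + 1) r 1 0 +
    c 1 * (evenMean (i + 1) r 1 0 - evenMean (i + 1) r 1 1) + c 2 * (evenMean (i + 1) r 2 0 / 2) +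
    c 3 * (evenMean (i + 1) r 3 0 / 3) + c 4 * ((evenMean (i + 1) r 2 0 - evenMean (i + 1) r 2 1) / 2) +
    c 5 * (evenMean (i + 1) r 1 0 - 2 * evenMean (i + 1) r 1 1 + evenMean (i + 1) r 1 2)) *
      σ ^ (2 * (i + 1)))]
  simp only [Finset.sum_range_succ, Finset.sum_range_zero, evenMean]
  ring

/-- The expansion of the Melnikov function to order `14`, with a remainder controlled in `C¹`. -/
lemma melnikov_expansion (R : ℝ) : ∃ ρ, 0 < ρ ∧ ρ ≤ 1 / 4 ∧
    (∀ x ∈ polarDomain ρ R,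
      (polarY x * polarZ x, x.2.2 * polarZ x ^ 2) ∈ Metric.ball (0 : ℝ × ℝ) radialRadius) ∧
    ∃ C, 0 ≤ C ∧ ∀ c : Fin 6 → ℝ, ∀ r, |r| < R → ∀ σ, |σ| < ρ →
      |melnikov c r σ -
        2 * Real.pi * ∑ i : Fin 7, linComb c (evenMean (i + 1) r) * σ ^ (2 * (i + 1 : ℕ))| ≤
          C * ‖c‖ * |σ| ^ 15 ∧
      ∃ D, HasDerivAt (fun σ => melnikov c r σ -
        2 * Real.pi * ∑ i : Fin 7, linComb c (evenMean (i + 1) r) * σ ^ (2 * (i + 1 : ℕ))) D σ ∧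
          |D| ≤ C * ‖c‖ * |σ| ^ 14 := by
  obtain ⟨ρ, hρ, hρ4, hrad, hexp⟩ := basicIntegral_expansion R
  choose! C hC0 hC using hexp
  have hCle : ∀ k ∈ ({1, 2, 3} : Finset ℕ), ∀ e ∈ Finset.range 3,
      C k e ≤ ∑ k ∈ ({1, 2, 3} : Finset ℕ), ∑ e ∈ Finset.range 3, C k e := fun k hk e he =>
    (Finset.single_le_sum (fun e _ => hC0 k hk e) he).trans
      (Finset.single_le_sum (f := fun k => ∑ e ∈ Finset.range 3, C k e)
        (fun k hk => Finset.sum_nonneg fun e _ => hC0 k hk e) hk)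
  set A := ∑ k ∈ ({1, 2, 3} : Finset ℕ), ∑ e ∈ Finset.range 3, C k e with hA
  have hA0 : 0 ≤ A := Finset.sum_nonneg fun k hk => Finset.sum_nonneg fun e _ => hC0 k hk e
  refine ⟨ρ, hρ, hρ4, hrad, 9 * A, by positivity, fun c r hr σ hσ => ?_⟩
  have heq : ∀ σ, |σ| < ρ → melnikov c r σ -
        2 * Real.pi * ∑ i : Fin 7, linComb c (evenMean (i + 1) r) * σ ^ (2 * (i + 1 : ℕ)) =
      linComb c fun k e => (∫ t in 0..2 * Real.pi, basicIntegrand k e (σ, t, r)) -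
        2 * Real.pi * ∑ d ∈ Finset.range 15, meanPoly k e d r * σ ^ d := by
    intro σ hσ
    rw [linComb_sub_sum, melnikov, linComb_integral c
      (fun k e => continuous_basicIntegrand hρ4 hrad k e hσ hr)]
  have hall (k : ℕ) (hk : k ∈ ({1, 2, 3} : Finset ℕ)) (e : ℕ) := hC k hk e r hr σ hσ
  choose! D hD hDle using fun k hk e => (hall k hk e).2
  refine ⟨?_, linComb c D, ?_, ?_⟩
  · rw [heq σ hσ]
    refine (abs_linComb_le c fun k hk e he => (hall k hk e).1.trans
      (mul_le_mul_of_nonneg_right (hCle k hk e he) (by positivity))).trans_eq (by ring)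
  · refine (hasDerivAt_linComb c fun k hk e _ => hD k hk e).congr_of_eventuallyEq ?_
    filter_upwards [(isOpen_lt continuous_abs continuous_const).mem_nhds hσ] with x hx
    exact heq x hx
  · refine (abs_linComb_le c fun k hk e he => (hDle k hk e).trans
      (mul_le_mul_of_nonneg_right (hCle k hk e he) (by positivity))).trans_eq (by ring)

lemma tendsto_sq_nhdsGT_zero : Tendsto (fun τ : ℝ => τ ^ 2) (𝓝[>] 0) (𝓝[>] 0) := by
  refine tendsto_nhdsWithin_iff.2 ⟨?_, ?_⟩
  · have : Tendsto (fun τ : ℝ => τ ^ 2) (𝓝 0) (𝓝 (0 ^ 2)) := (continuous_pow 2).tendsto 0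
    simpa using this.mono_left nhdsWithin_le_nhds
  · filter_upwards [self_mem_nhdsWithin] with τ hτ
    exact pow_pos (mem_Ioi.1 hτ) 2

/-- A suitable small parameter produces a Melnikov function with six simple zeros. -/
lemma exists_six_simple_zeros {r₀ d : ℝ} (hr : quintic r₀ = 0) (hd : d ≠ 0) {η ρ₁ : ℝ} (hη : 0 < η)
    (hρ₁ : 0 < ρ₁) :
    ∃ (r : ℝ) (c : Fin 6 → ℝ), |r - r₀| < η ∧ (∀ i, |c i - relCoeff r₀ d 0 0 0 0 0 i| < η) ∧
      ∃ σ : Fin 6 → ℝ, StrictMono σ ∧ ∀ j, 0 < σ j ∧ σ j < ρ₁ ∧ melnikov c r (σ j) = 0 ∧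
        ∃ m, m ≠ 0 ∧ HasDerivAt (melnikov c r) m (σ j) := by
  obtain ⟨B, hB, r, c, hrt, hct, hlim⟩ := exists_focal_family hr hd
  obtain ⟨ρ, hρ, hρ4, -, C, hC, hexp⟩ := melnikov_expansion (|r₀| + 1)
  -- With s = τ² and σ = τξ, the term of degree 2(i + 1) becomes τ^14 `b i τ` ξ^(2(i + 1)), so a
  -- single power of τ can be divided out.
  set b : Fin 7 → ℝ → ℝ := fun i τ =>
    linComb (c (τ ^ 2)) (evenMean (i + 1) (r (τ ^ 2))) / (τ ^ 2) ^ (6 - i : ℕ) with hb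
  have hbt (i : Fin 7) : Tendsto (b i) (𝓝[>] 0) (𝓝 (B * sixRootCoeff i)) :=
    (hlim i).comp tendsto_sq_nhdsGT_zero
  have hrt' := hrt.comp tendsto_sq_nhdsGT_zero
  have hct' := hct.comp tendsto_sq_nhdsGT_zero
  have hid : Tendsto (fun τ : ℝ => τ) (𝓝[>] 0) (𝓝 0) := nhdsWithin_le_nhds
  set A := ‖relCoeff r₀ d 0 0 0 0 0‖ + 1 with hA
  have hA0 : 0 ≤ A := by positivity
  have hcA : ∀ᶠ τ in 𝓝[>] (0 : ℝ), ‖c (τ ^ 2)‖ < A :=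
    hct'.norm.eventually_lt_const (by linarith)
  have hrR : ∀ᶠ τ in 𝓝[>] (0 : ℝ), |r (τ ^ 2)| < |r₀| + 1 :=
    hrt'.abs.eventually_lt_const (by linarith)
  -- The limit is B ξ² ∏ (ξ² - j²), whose zeros ξ = 1, …, 6 are simple.
  set Q : ℝ → ℝ := fun ξ => ∑ i : Fin 7, B * sixRootCoeff i * ξ ^ (2 * (i + 1 : ℕ)) with hQdef
  set Q' : ℝ → ℝ := fun ξ => ∑ i : Fin 7, B * sixRootCoeff i *
    ((2 * (i + 1 : ℕ) : ℕ) * ξ ^ (2 * (i + 1 : ℕ) - 1)) with hQ'def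
  set rem : ℝ → ℝ → ℝ := fun τ σ => melnikov (c (τ ^ 2)) (r (τ ^ 2)) σ - 2 * Real.pi *
    ∑ i : Fin 7, linComb (c (τ ^ 2)) (evenMean (i + 1) (r (τ ^ 2))) * σ ^ (2 * (i + 1 : ℕ)) with hrem
  set N : ℝ → ℝ → ℝ := fun τ ξ => melnikov (c (τ ^ 2)) (r (τ ^ 2)) (τ * ξ) / (2 * Real.pi * τ ^ 14)
    with hN
  set N' : ℝ → ℝ → ℝ := fun τ ξ => (∑ i : Fin 7, b i τ *
    ((2 * (i + 1 : ℕ) : ℕ) * ξ ^ (2 * (i + 1 : ℕ) - 1))) +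
      deriv (rem τ) (τ * ξ) * τ / (2 * Real.pi * τ ^ 14) with hN'
  have hNeq : ∀ τ, 0 < τ → ∀ ξ, N τ ξ = (∑ i : Fin 7, b i τ * ξ ^ (2 * (i + 1 : ℕ))) +
      rem τ (τ * ξ) / (2 * Real.pi * τ ^ 14) := by
    intro τ hτ ξ
    have h1 : ∑ i : Fin 7, b i τ * ξ ^ (2 * (i + 1 : ℕ)) = (∑ i : Fin 7,
        linComb (c (τ ^ 2)) (evenMean (i + 1) (r (τ ^ 2))) * (τ * ξ) ^ (2 * (i + 1 : ℕ))) / τ ^ 14 := by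
      rw [Finset.sum_div]
      refine Finset.sum_congr rfl fun i _ => ?_
      have h2 : τ ^ 14 = (τ ^ 2) ^ (6 - i : ℕ) * τ ^ (2 * (i + 1 : ℕ)) := by
        rw [← pow_mul, ← pow_add]
        congr 1
        omega
      rw [h2, mul_pow]
      simp only [hb]
      field_simp
    rw [h1]
    simp only [hN, hrem]
    field_simp
    ring
  have hpi := Real.pi_pos
  have hpi3 := Real.pi_gt_three
  -- The remainder is O(σ^15) and its derivative O(σ^14), so after division by τ^14 both contribute
  -- O(τ). The bound 7 covers the windows of radius 1/4 around 1, …, 6.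
  have hremB : ∀ᶠ τ in 𝓝[>] (0 : ℝ), ∀ ξ, |ξ| ≤ 7 →
      |rem τ (τ * ξ) / (2 * Real.pi * τ ^ 14)| ≤ C * A * 7 ^ 15 * τ ∧
      HasDerivAt (rem τ) (deriv (rem τ) (τ * ξ)) (τ * ξ) ∧
      |deriv (rem τ) (τ * ξ) * τ / (2 * Real.pi * τ ^ 14)| ≤ C * A * 7 ^ 15 * τ := by
    filter_upwards [hcA, hrR, self_mem_nhdsWithin,
      (hid.mul_const 7).eventually_lt_const (by simpa using hρ)] with τ h1 h2 (h3 : 0 < τ) h4 ξ hξ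
    have h5 : |τ * ξ| ≤ τ * 7 := by
      rw [abs_mul, abs_of_pos h3]
      gcongr
    obtain ⟨h6, D, h7, h8⟩ := hexp (c (τ ^ 2)) _ h2 (τ * ξ) (h5.trans_lt h4)
    have hcn := norm_nonneg (c (τ ^ 2))
    have hden : 0 < 2 * Real.pi * τ ^ 14 := by positivity
    have h9 : C * A * τ ^ 14 ≤ C * A * τ ^ 14 * (2 * Real.pi) :=
      le_mul_of_one_le_right (by positivity) (by linarith)
    refine ⟨?_, by rw [h7.deriv]; exact h7, ?_⟩
    · rw [abs_div, abs_of_pos hden, div_le_iff₀ hden]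
      calc |rem τ (τ * ξ)| ≤ C * ‖c (τ ^ 2)‖ * |τ * ξ| ^ 15 := h6
        _ ≤ C * A * (τ * 7) ^ 15 := by gcongr
        _ = 7 ^ 15 * τ * (C * A * τ ^ 14) := by ring
        _ ≤ 7 ^ 15 * τ * (C * A * τ ^ 14 * (2 * Real.pi)) := by gcongr
        _ = _ := by ring
    · rw [h7.deriv, abs_div, abs_of_pos hden, div_le_iff₀ hden, abs_mul, abs_of_pos h3]
      calc |D| * τ ≤ C * ‖c (τ ^ 2)‖ * |τ * ξ| ^ 14 * τ := by gcongr
        _ ≤ C * A * (τ * 7) ^ 14 * τ := by gcongr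
        _ = 7 ^ 14 * τ * (C * A * τ ^ 14) := by ring
        _ ≤ 7 ^ 15 * τ * (C * A * τ ^ 14 * (2 * Real.pi)) := by gcongr <;> norm_num
        _ = _ := by ring
  have hK : Tendsto (fun τ : ℝ => C * A * 7 ^ 15 * τ) (𝓝[>] 0) (𝓝 0) := by
    simpa using hid.const_mul (C * A * 7 ^ 15)
  have hzero (j : Fin 6) : ∀ᶠ τ in 𝓝[>] (0 : ℝ), ∃ ξ : ℝ, |ξ - (j + 1 : ℕ)| ≤ 1 / 4 ∧ N τ ξ = 0 ∧
      N' τ ξ ≠ 0 ∧ HasDerivAt (N τ) (N' τ ξ) ξ := by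
    have hj7 : ∀ x : ℝ, |x - (j + 1 : ℕ)| ≤ 1 / 4 → |x| ≤ 7 := by
      intro x hx
      have h1 := abs_le.1 hx
      have h2 : ((j + 1 : ℕ) : ℝ) ≤ 6 := by
        have : (j + 1 : ℕ) ≤ 6 := by omega
        exact_mod_cast this
      have h3 : (0 : ℝ) ≤ (j + 1 : ℕ) := Nat.cast_nonneg _
      exact abs_le.2 ⟨by linarith, by linarith⟩
    refine eventually_exists_simple_zero (Q := Q) (Q' := Q') (by norm_num) (fun x => ?_) ?_ ?_ ?_ ?_ ?_
    · exact HasDerivAt.fun_sum fun i _ => (hasDerivAt_pow _ x).const_mul _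
    · fun_prop
    · fin_cases j <;> simp [hQdef, sixRootCoeff, Fin.sum_univ_succ] <;> ring
    · have h : Q' (j + 1 : ℕ) = B * ∑ i : Fin 7, sixRootCoeff i *
        ((2 * (i + 1 : ℕ) : ℕ) * ((j + 1 : ℕ) : ℝ) ^ (2 * (i + 1 : ℕ) - 1)) := by
        simp only [hQ'def, Finset.mul_sum, mul_assoc]
      rw [h]
      refine mul_ne_zero hB ?_
      fin_cases j <;> norm_num [sixRootCoeff, Fin.sum_univ_succ]
    · intro x hx
      have h1 : Tendsto (fun τ => (∑ i : Fin 7, b i τ * x ^ (2 * (i + 1 : ℕ))) +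
          rem τ (τ * x) / (2 * Real.pi * τ ^ 14)) (𝓝[>] 0) (𝓝 (Q x + 0)) := by
        refine (tendsto_finsetSum _ fun i _ => (hbt i).mul_const _).add ?_
        refine squeeze_zero_norm' ?_ hK
        filter_upwards [hremB] with τ hτ
        exact (hτ x (hj7 x hx)).1
      rw [add_zero] at h1
      refine h1.congr' ?_
      filter_upwards [self_mem_nhdsWithin] with τ hτ
      exact (hNeq τ hτ x).symm
    · intro κ hκ
      have hsum : Tendsto (fun τ => (∑ i : Fin 7, |b i τ - B * sixRootCoeff i| *
          ((2 * (i + 1 : ℕ) : ℕ) * 7 ^ (2 * (i + 1 : ℕ) - 1))) + C * A * 7 ^ 15 * τ)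
          (𝓝[>] 0) (𝓝 0) := by
        have h1 (i : Fin 7) : Tendsto (fun τ => |b i τ - B * sixRootCoeff i| *
          (((2 * (i + 1 : ℕ) : ℕ) : ℝ) * 7 ^ (2 * (i + 1 : ℕ) - 1))) (𝓝[>] 0) (𝓝 0) := by
          simpa using (((hbt i).sub_const (B * sixRootCoeff i)).abs).mul_const
            (((2 * (i + 1 : ℕ) : ℕ) : ℝ) * 7 ^ (2 * (i + 1 : ℕ) - 1))
        simpa using (tendsto_finsetSum Finset.univ fun i _ => h1 i).add hK
      filter_upwards [hremB, hsum.eventually_lt_const hκ, self_mem_nhdsWithin] with τ h1 h2 (h3 : 0 < τ) x hx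
      obtain ⟨-, h4, h5⟩ := h1 x (hj7 x hx)
      constructor
      · have h6 : HasDerivAt (fun ξ => rem τ (τ * ξ)) (deriv (rem τ) (τ * x) * τ) x := by
          have := (hasDerivAt_id' x).const_mul τ
          rw [mul_one] at this
          exact h4.comp x this
        have h7 : HasDerivAt (fun ξ => (∑ i : Fin 7, b i τ * ξ ^ (2 * (i + 1 : ℕ))) +
          rem τ (τ * ξ) / (2 * Real.pi * τ ^ 14)) (N' τ x) x :=
          (HasDerivAt.fun_sum fun i _ => (hasDerivAt_pow _ x).const_mul _).fun_add (h6.div_const _)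
        exact h7.congr_of_eventuallyEq (Eventually.of_forall fun ξ => hNeq τ h3 ξ)
      · refine lt_of_le_of_lt ?_ h2
        have h8 : N' τ x - Q' x = (∑ i : Fin 7, (b i τ - B * sixRootCoeff i) *
            (((2 * (i + 1 : ℕ) : ℕ) : ℝ) * x ^ (2 * (i + 1 : ℕ) - 1))) +
            deriv (rem τ) (τ * x) * τ / (2 * Real.pi * τ ^ 14) := by
          simp only [hN', hQ'def, sub_mul, Finset.sum_sub_distrib]
          ring
        rw [h8]
        refine (abs_add_le _ _).trans (add_le_add ((Finset.abs_sum_le_sum_abs _ _).trans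
          (Finset.sum_le_sum fun i _ => ?_)) h5)
        rw [abs_mul, abs_mul, abs_pow, Nat.abs_cast]
        gcongr
        exact hj7 x hx
  have hcη : ∀ᶠ τ in 𝓝[>] (0 : ℝ), ∀ i, |c (τ ^ 2) i - relCoeff r₀ d 0 0 0 0 0 i| < η := by
    filter_upwards [(Metric.tendsto_nhds.1 hct') η hη] with τ hτ i
    exact (dist_le_pi_dist (c (τ ^ 2)) _ i).trans_lt hτ
  have hrη : ∀ᶠ τ in 𝓝[>] (0 : ℝ), |r (τ ^ 2) - r₀| < η := (Metric.tendsto_nhds.1 hrt') η hη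
  obtain ⟨τ, hτz, hτc, hτr, hτ0, hτ7⟩ := ((eventually_all.2 hzero).and (hcη.and (hrη.and
    (eventually_mem_nhdsWithin.and
      ((hid.mul_const 7).eventually_lt_const (by simpa using hρ₁)))))).exists
  replace hτ0 : 0 < τ := hτ0
  choose ξ hξ hξ0 hξ' hξd using hτz
  have hden : 2 * Real.pi * τ ^ 14 ≠ 0 := by positivity
  -- The zeros are ordered because the windows of radius 1/4 around consecutive integers are
  -- disjoint.
  refine ⟨r (τ ^ 2), c (τ ^ 2), hτr, hτc, fun j => τ * ξ j, fun i j hij => ?_, fun j => ?_⟩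
  · refine mul_lt_mul_of_pos_left ?_ hτ0
    have h1 := (abs_le.1 (hξ i)).2
    have h2 := (abs_le.1 (hξ j)).1
    have h3 : ((i + 1 : ℕ) : ℝ) + 1 ≤ (j + 1 : ℕ) := by
      have : (i : ℕ) + 1 + 1 ≤ j + 1 := by
        have : (i : ℕ) < j := hij
        omega
      exact_mod_cast this
    linarith
  · have h1 := abs_le.1 (hξ j)
    have h2 : ((j + 1 : ℕ) : ℝ) ≤ 6 := by
      have : (j + 1 : ℕ) ≤ 6 := by omega
      exact_mod_cast this
    have h3 : (1 : ℝ) ≤ (j + 1 : ℕ) := by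
      have : 1 ≤ (j + 1 : ℕ) := by omega
      exact_mod_cast this
    refine ⟨mul_pos hτ0 (by linarith), lt_of_le_of_lt ?_ hτ7,
      (div_eq_zero_iff.1 (hξ0 j)).resolve_right hden,
      N' τ (ξ j) * τ⁻¹ * (2 * Real.pi * τ ^ 14), mul_ne_zero (mul_ne_zero (hξ' j) (inv_ne_zero hτ0.ne')) hden, ?_⟩
    · exact mul_le_mul_of_nonneg_left (by linarith) hτ0.le
    · have h4 : HasDerivAt (fun σ => σ * τ⁻¹) τ⁻¹ (τ * ξ j) := by
        simpa using (hasDerivAt_id' (τ * ξ j)).mul_const τ⁻¹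
      have h5 : HasDerivAt (N τ) (N' τ (ξ j)) (τ * ξ j * τ⁻¹) := by
        convert! hξd j using 1
        field_simp
      have h6 := (h5.comp (τ * ξ j) h4).mul_const (2 * Real.pi * τ ^ 14)
      refine h6.congr_of_eventuallyEq (Eventually.of_forall fun σ => ?_)
      simp only [hN, Function.comp]
      rw [div_mul_cancel₀ _ hden]
      congr 1
      field_simp

/-! ### Normal coordinates for the Hamiltonian -/

/-- The first normal coordinate `w = u - u ^ 2 / 2`. -/
noncomputable def normalW (u : ℝ) : ℝ := u - u ^ 2 / 2

/-- The quotient `(z / v) ^ 2`. -/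
noncomputable def normalS (r u v : ℝ) : ℝ := 1 + 2 * (1 - u) * v + 2 * r * v ^ 2

/-- The second normal coordinate `z`; the Hamiltonian is `(w ^ 2 + z ^ 2) / 2`. -/
noncomputable def normalZ (r u v : ℝ) : ℝ := v * √(normalS r u v)

/-- The partial derivative of `normalZ` with respect to `u`. -/
noncomputable def normalZu (r u v : ℝ) : ℝ := -v ^ 2 / √(normalS r u v)

/-- The partial derivative of `normalZ` with respect to `v`. -/
noncomputable def normalZv (r u v : ℝ) : ℝ :=
  √(normalS r u v) + v * (1 - u + 2 * r * v) / √(normalS r u v)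

/-- The derivative of the Hamiltonian with respect to `u`. -/
noncomputable def hamU (u v : ℝ) : ℝ := u - 3 / 2 * u ^ 2 + u ^ 3 / 2 - v ^ 3

/-- The derivative of the Hamiltonian with respect to `v`. -/
noncomputable def hamV (r u v : ℝ) : ℝ := v + 3 * (1 - u) * v ^ 2 + 4 * r * v ^ 3

/-- Twice the Hamiltonian. -/
noncomputable def energy (r u v : ℝ) : ℝ := normalW u ^ 2 + v ^ 2 * normalS r u v

/-- Differentiating H = (w² + z²)/2 gives H_v = z z_v, as w does not involve v; the next lemma is
the analogue H_u = w w_u + z z_u. -/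
lemma hamV_eq {r u v : ℝ} (h : 0 < normalS r u v) : hamV r u v = normalZ r u v * normalZv r u v := by
  have h1 := Real.sqrt_pos.2 h
  have h2 := Real.sq_sqrt h.le
  rw [normalZ, normalZv, hamV]
  field_simp
  rw [h2, normalS]
  ring

lemma hamU_eq {r u v : ℝ} (h : 0 < normalS r u v) :
    hamU u v = (1 - u) * normalW u + normalZ r u v * normalZu r u v := by
  have h1 := Real.sqrt_pos.2 h
  rw [normalZ, normalZu, hamU, normalW]
  field_simp
  ring

lemma energy_eq {r u v : ℝ} (h : 0 < normalS r u v) :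
    energy r u v = normalW u ^ 2 + normalZ r u v ^ 2 := by
  rw [energy, normalZ, mul_pow, Real.sq_sqrt h.le]

lemma hasDerivAt_normalW {u : ℝ → ℝ} {u' t : ℝ} (hu : HasDerivAt u u' t) :
    HasDerivAt (fun t => normalW (u t)) ((1 - u t) * u') t := by
  refine (hu.fun_sub ((hu.fun_pow 2).div_const 2)).congr_deriv ?_
  simp
  ring

lemma hasDerivAt_normalZ {r : ℝ} {u v : ℝ → ℝ} {u' v' t : ℝ} (hu : HasDerivAt u u' t)
    (hv : HasDerivAt v v' t) (h : 0 < normalS r (u t) (v t)) :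
    HasDerivAt (fun t => normalZ r (u t) (v t))
      (normalZu r (u t) (v t) * u' + normalZv r (u t) (v t) * v') t := by
  have h1 := Real.sqrt_pos.2 h
  have hS : HasDerivAt (fun t => normalS r (u t) (v t))
      (2 * (-u') * v t + 2 * (1 - u t) * v' + 2 * r * (2 * v t * v')) t := by
    refine ((((hu.const_sub 1).const_mul 2).fun_mul hv).const_add 1 |>.fun_add
      ((hv.fun_pow 2).const_mul (2 * r))).congr_deriv ?_
    simp
  refine (hv.fun_mul (hS.sqrt h.ne')).congr_deriv ?_
  rw [normalZu, normalZv]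
  field_simp
  ring

lemma eval_pderiv_hamiltonian (r u v : ℝ) :
    MvPolynomial.eval ![u, v] (MvPolynomial.pderiv 0 (hamiltonian r)) = hamU u v ∧
    MvPolynomial.eval ![u, v] (MvPolynomial.pderiv 1 (hamiltonian r)) = hamV r u v := by
  constructor <;> simp [hamiltonian, hamU, hamV, MvPolynomial.pderiv_X] <;> ring

lemma nearHamiltonianField_eq (r : ℝ) (p q : MvPolynomial (Fin 2) ℝ) (ε : ℝ) (x : ℝ × ℝ) :
    nearHamiltonianField (hamiltonian r) p q ε x =
      (hamV r x.1 x.2 + ε * MvPolynomial.eval ![x.1, x.2] p,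
        -hamU x.1 x.2 + ε * MvPolynomial.eval ![x.1, x.2] q) := by
  rw [nearHamiltonianField, map_add, map_add, map_neg, (eval_pderiv_hamiltonian r _ _).1,
    (eval_pderiv_hamiltonian r _ _).2]
  simp

/-- The coordinate `u` in polar normal coordinates. -/
noncomputable def polarU (x : ℝ × ℝ × ℝ) : ℝ := 1 - polarY x

/-- The coordinate `v` in polar normal coordinates. -/
noncomputable def polarV (x : ℝ × ℝ × ℝ) : ℝ := polarZ x * polarX x

/-- For v = zX and 1 - u = y the defining equation of X reads X² `normalS` = 1; hence v √`normalS` =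
z, and the polar formulas invert the passage to normal coordinates. -/
lemma polar_spec {x : ℝ × ℝ × ℝ} (hx : |x.1| < 1 / 4)
    (h : (polarY x * polarZ x, x.2.2 * polarZ x ^ 2) ∈ Metric.ball (0 : ℝ × ℝ) radialRadius) :
    normalW (polarU x) = polarW x ∧ √(normalS x.2.2 (polarU x) (polarV x)) = (polarX x)⁻¹ ∧
      0 < normalS x.2.2 (polarU x) (polarV x) ∧ normalZ x.2.2 (polarU x) (polarV x) = polarZ x := by
  obtain ⟨hX1, -, hX⟩ := radialFactor_spec h
  obtain ⟨-, -, hY⟩ := polarY_spec hx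
  have hX0 : 0 < polarX x := by
    rw [polarX]
    linarith
  have hS : normalS x.2.2 (polarU x) (polarV x) = (polarX x)⁻¹ ^ 2 := by
    rw [inv_pow]
    refine eq_inv_of_mul_eq_one_left ?_
    rw [← hX, normalS, polarU, polarV, polarX]
    ring
  have hr : √(normalS x.2.2 (polarU x) (polarV x)) = (polarX x)⁻¹ := by
    rw [hS, Real.sqrt_sq (by positivity)]
  refine ⟨?_, hr, by rw [hS]; positivity, ?_⟩
  · rw [normalW, polarU]
    linarith
  · rw [normalZ, hr, polarV]
    field_simp

/-- From u = 1 - y and 1 - y² = 2w one gets u (1 + y) = 2w, with 1 + y > 1. -/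
lemma abs_polarU_le {x : ℝ × ℝ × ℝ} (hx : |x.1| < 1 / 4) : |polarU x| ≤ 2 * |x.1| := by
  obtain ⟨h0, -, hY⟩ := polarY_spec hx
  have h1 := abs_polarW_le x
  have h2 : polarU x * (1 + polarY x) = 2 * polarW x := by
    rw [polarU]
    linarith
  have h3 : |polarU x| * (1 + polarY x) = 2 * |polarW x| := by
    rw [← abs_of_pos (show 0 < 1 + polarY x by linarith), ← abs_mul, h2, abs_mul, abs_two]
  nlinarith [abs_nonneg (polarU x)]

lemma abs_polarV_le {x : ℝ × ℝ × ℝ}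
    (h : (polarY x * polarZ x, x.2.2 * polarZ x ^ 2) ∈ Metric.ball (0 : ℝ × ℝ) radialRadius) :
    |polarV x| ≤ 2 * |x.1| := by
  obtain ⟨h1, h2, -⟩ := radialFactor_spec h
  rw [polarV, abs_mul, polarX, abs_of_pos (by linarith : (0:ℝ) < radialFactor _), mul_comm]
  exact mul_le_mul h2.le (abs_polarZ_le x) (abs_nonneg _) (by norm_num)

/-- A point close to the origin is recovered from its normal coordinates. -/
lemma exists_box (R : ℝ) : ∃ ρ, 0 < ρ ∧ ∀ r u v, |r| < R → |u| < ρ → |v| < ρ →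
    u < 1 ∧ 0 < normalS r u v ∧ ∀ σ φ, normalW u = σ * Real.sin φ → normalZ r u v = σ * Real.cos φ →
      polarU (σ, φ, r) = u ∧ polarV (σ, φ, r) = v := by
  obtain ⟨d, hd, h⟩ := radialFactor_mul_sqrt
  refine ⟨min (1 / 2) (d / (2 + |R|)), by positivity, fun r u v hr hu hv => ?_⟩
  have hu1 : u < 1 := (abs_lt.1 (hu.trans_le (min_le_left _ _))).2.trans (by norm_num)
  have hu2 : -(1 / 2) < u := (abs_lt.1 (hu.trans_le (min_le_left _ _))).1
  have hv1 : |v| < 1 / 2 := hv.trans_le (min_le_left _ _)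
  have hv2 : |v| * (2 + |R|) < d := by
    rw [← lt_div_iff₀ (by positivity)]
    exact hv.trans_le (min_le_right _ _)
  have hR : |r| < |R| := hr.trans_le (le_abs_self R)
  have h0v := abs_nonneg v
  have h0r := abs_nonneg r
  -- These are the parameters (aX, bX²) of the radial factor at the point (u, v); smallness places
  -- them where the local solution X is the one attached to this point.
  have hq : ((1 - u) * v, r * v ^ 2) ∈ Metric.ball (0 : ℝ × ℝ) d := by
    rw [mem_ball_zero_iff, Prod.norm_mk, max_lt_iff, Real.norm_eq_abs, Real.norm_eq_abs, abs_mul,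
      abs_mul, abs_pow, abs_of_pos (by linarith : 0 < 1 - u)]
    constructor
    · nlinarith
    · have : |r| * |v| ^ 2 ≤ |R| * |v| :=
        mul_le_mul hR.le (by nlinarith) (by positivity) (abs_nonneg R)
      nlinarith
  obtain ⟨hS, -, hX⟩ := h _ hq
  have hSe : normalS r u v = 1 + 2 * ((1 - u) * v) + 2 * (r * v ^ 2) := by
    rw [normalS]
    ring
  simp only at hS hX
  rw [← hSe] at hS hX
  refine ⟨hu1, hS, fun σ φ hw hz => ?_⟩
  have hY : polarY (σ, φ, r) = 1 - u := by
    rw [polarY, polarW, ← hw, normalW, show 1 - 2 * (u - u ^ 2 / 2) = (1 - u) ^ 2 by ring,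
      Real.sqrt_sq (by linarith)]
  have hZ : polarZ (σ, φ, r) = v * √(normalS r u v) := hz.symm
  refine ⟨by rw [polarU, hY]; ring, ?_⟩
  have hX' : polarX (σ, φ, r) * √(normalS r u v) = 1 := by
    rw [← hX, polarX, hY, hZ]
    congr 3
    · ring
    · simp only
      rw [mul_pow, Real.sq_sqrt hS.le]
      ring
  rw [polarV, hZ, mul_assoc, mul_comm (√_), hX', mul_one]

/-- In polar terms z_v = 1/X + (yz) X² + 2 (rz²) X³. With 1/2 < X < 2 and |yz|, |rz²| < 1/100 this
is at least 1/2 - 4/100 - 16/100 > 1/4. Together with 1 - u = y > 0 it keeps the coordinate change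
nondegenerate. -/
lemma exists_polarDomain_normalZv (R : ℝ) : ∃ ρ, 0 < ρ ∧ ρ ≤ 1 / 4 ∧ ∀ x ∈ polarDomain ρ R,
      (polarY x * polarZ x, x.2.2 * polarZ x ^ 2) ∈ Metric.ball (0 : ℝ × ℝ) radialRadius ∧
      1 / 4 ≤ normalZv x.2.2 (polarU x) (polarV x) := by
  have hd : 0 < min radialRadius (1 / 100) := lt_min radialRadius_pos (by norm_num)
  obtain ⟨ρ, hρ, hρ4, h⟩ := exists_polarDomain_small hd R
  refine ⟨ρ, hρ, hρ4, fun x hx => ?_⟩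
  have hb := Metric.ball_subset_ball (min_le_left _ (1 / 100)) (h x hx).2.2
  refine ⟨hb, ?_⟩
  have hb' := Metric.ball_subset_ball (min_le_right radialRadius _) (h x hx).2.2
  rw [mem_ball_zero_iff, Prod.norm_mk, max_lt_iff, Real.norm_eq_abs, Real.norm_eq_abs] at hb'
  obtain ⟨-, hS, -, -⟩ := polar_spec (hx.1.trans_le hρ4) hb
  obtain ⟨hX1, hX2, -⟩ := radialFactor_spec hb
  rw [normalZv, hS]
  rw [← polarX] at hX1 hX2
  have h1 := abs_lt.1 hb'.1
  have h2 := abs_lt.1 hb'.2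
  set X := polarX x
  have h3 : X⁻¹ + polarV x * (1 - polarU x + 2 * x.2.2 * polarV x) / X⁻¹ =
      X⁻¹ + (polarY x * polarZ x) * X ^ 2 + 2 * (x.2.2 * polarZ x ^ 2) * X ^ 3 := by
    rw [polarV, polarU]
    field_simp
    ring
  have h4 : 1 / 2 < X⁻¹ := by
    rw [lt_inv_comm₀ (by norm_num) (by linarith)]
    norm_num
    exact hX2
  have h5 : X ^ 2 ≤ 4 := by nlinarith
  have h6 : X ^ 3 ≤ 8 := by nlinarith
  have h7 : 0 ≤ X ^ 2 := by positivity
  have h8 : 0 ≤ X ^ 3 := pow_nonneg (by linarith) 3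
  rw [h3]
  nlinarith

/-! ### Polynomial perturbations and the exact-differential argument -/

lemma contDiff_eval_pair (p : MvPolynomial (Fin 2) ℝ) {n : WithTop ℕ∞} :
    ContDiff ℝ n fun x : ℝ × ℝ => MvPolynomial.eval ![x.1, x.2] p := by
  induction p using MvPolynomial.induction_on with
  | C a => simpa using contDiff_const
  | add p q hp hq => simpa using hp.add hq
  | mul_X p i hp =>
    fin_cases i
    · simpa using hp.mul contDiff_fst
    · simpa using hp.mul contDiff_snd

lemma hasDerivAt_eval_pair (p : MvPolynomial (Fin 2) ℝ) {u v : ℝ → ℝ} {u' v' t : ℝ}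
    (hu : HasDerivAt u u' t) (hv : HasDerivAt v v' t) :
    HasDerivAt (fun t => MvPolynomial.eval ![u t, v t] p)
      (MvPolynomial.eval ![u t, v t] (MvPolynomial.pderiv 0 p) * u' +
        MvPolynomial.eval ![u t, v t] (MvPolynomial.pderiv 1 p) * v') t := by
  induction p using MvPolynomial.induction_on with
  | C a => simpa using hasDerivAt_const t a
  | add p q hp hq =>
    simp only [map_add]
    exact (hp.fun_add hq).congr_deriv (by ring)
  | mul_X p i hp =>
    fin_cases i
    · simp only [map_mul, MvPolynomial.eval_X]
      refine (hp.fun_mul hu).congr_deriv ?_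
      simp [MvPolynomial.pderiv_X]
      ring
    · simp only [map_mul, MvPolynomial.eval_X]
      refine (hp.fun_mul hv).congr_deriv ?_
      simp [MvPolynomial.pderiv_X]
      ring

/-- Monomials have monomial primitives. Polynomial primitives supply the potential whose
differential vanishes around a closed curve. -/
lemma exists_pderiv_eq (i : Fin 2) (p : MvPolynomial (Fin 2) ℝ) :
    ∃ k, MvPolynomial.pderiv i k = p := by
  induction p using MvPolynomial.induction_on' with
  | monomial s a =>
    refine ⟨MvPolynomial.monomial (s + Finsupp.single i 1) (a / (s i + 1)), ?_⟩
    rw [MvPolynomial.pderiv_monomial]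
    have : (s i : ℝ) + 1 ≠ 0 := by positivity
    simp
    congr 1
    field_simp
  | add p q hp hq =>
    obtain ⟨k, hk⟩ := hp
    obtain ⟨l, hl⟩ := hq
    exact ⟨k + l, by rw [map_add, hk, hl]⟩

lemma pderiv_comm_pair (p : MvPolynomial (Fin 2) ℝ) :
    MvPolynomial.pderiv 0 (MvPolynomial.pderiv 1 p) = MvPolynomial.pderiv 1 (MvPolynomial.pderiv 0 p) := by
  induction p using MvPolynomial.induction_on with
  | C a => simp
  | add p q hp hq => simp [hp, hq]
  | mul_X p i hp =>
    fin_cases i <;> simp [hp, MvPolynomial.pderiv_X] <;> ring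

lemma eval_eq_of_pderiv_one_eq_zero {p : MvPolynomial (Fin 2) ℝ} (hp : MvPolynomial.pderiv 1 p = 0)
    (u v : ℝ) : MvPolynomial.eval ![u, v] p = MvPolynomial.eval ![u, 0] p := by
  have h : ∀ t, HasDerivAt (fun t => MvPolynomial.eval ![u, t] p) 0 t := fun t => by
    have := hasDerivAt_eval_pair p (hasDerivAt_const t u) (hasDerivAt_id' t)
    rw [hp] at this
    simpa using this
  exact is_const_of_deriv_eq_zero (fun t => (h t).differentiableAt) (fun t => (h t).deriv) v 0

/-- The derivatives of the coordinates along a curve given in polar normal coordinates. -/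
lemma hasDerivAt_polar {ρ R : ℝ} (hρ : ρ ≤ 1 / 4) (h : ∀ x ∈ polarDomain ρ R,
      (polarY x * polarZ x, x.2.2 * polarZ x ^ 2) ∈ Metric.ball (0 : ℝ × ℝ) radialRadius ∧
      1 / 4 ≤ normalZv x.2.2 (polarU x) (polarV x))
    {r : ℝ} (hr : |r| < R) {y : ℝ → ℝ} {y' t : ℝ} (hy : HasDerivAt y y' t) (hyρ : |y t| < ρ) :
    ∃ u' v', HasDerivAt (fun t => polarU (y t, t, r)) u' t ∧ HasDerivAt (fun t => polarV (y t, t, r)) v' t ∧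
      (1 - polarU (y t, t, r)) * u' = y' * Real.sin t + y t * Real.cos t ∧
      normalZu r (polarU (y t, t, r)) (polarV (y t, t, r)) * u' +
        normalZv r (polarU (y t, t, r)) (polarV (y t, t, r)) * v' =
          y' * Real.cos t - y t * Real.sin t := by
  have hmem : (y t, t, r) ∈ polarDomain ρ R := ⟨hyρ, hr⟩
  have hO := (isOpen_polarDomain ρ R).mem_nhds hmem
  have hcurve : HasDerivAt (fun t => (y t, t, r)) (y', 1, 0) t :=
    hy.prodMk ((hasDerivAt_id' t).prodMk (hasDerivAt_const t r))
  have hev : ∀ᶠ s in 𝓝 t, (y s, s, r) ∈ polarDomain ρ R := hcurve.continuousAt.eventually_mem hO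
  have hUd : DifferentiableAt ℝ polarU (y t, t, r) :=
    ((contDiffOn_const.sub (contDiffOn_polarY hρ)).contDiffAt hO).differentiableAt one_ne_zero
  have hVd : DifferentiableAt ℝ polarV (y t, t, r) :=
    ((contDiff_polarZ.contDiffOn.mul (contDiffOn_polarX hρ fun x hx => (h x hx).1)).contDiffAt
      hO).differentiableAt one_ne_zero
  have hU := hUd.hasFDerivAt.comp_hasDerivAt t hcurve
  have hV := hVd.hasFDerivAt.comp_hasDerivAt t hcurve
  have hs : ∀ s, (y s, s, r) ∈ polarDomain ρ R → _ := fun s hs =>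
    polar_spec (hs.1.trans_le hρ) (h _ hs).1
  -- The derivatives u', v' are only known to exist; the two relations come from differentiating w =
  -- y sin t and z = y cos t in two ways, which avoids any formula for the derivative of X.
  refine ⟨_, _, hU, hV, ?_, ?_⟩
  · refine (hasDerivAt_normalW hU).unique ?_
    refine ((hy.fun_mul (Real.hasDerivAt_sin t))).congr_of_eventuallyEq ?_
    filter_upwards [hev] with s hs'
    exact (hs s hs').1
  · refine (hasDerivAt_normalZ hU hV (hs t hmem).2.2.1).unique ?_
    refine ((hy.fun_mul (Real.hasDerivAt_cos t)).congr_deriv (by ring)).congr_of_eventuallyEq ?_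
    filter_upwards [hev] with s hs'
    exact (hs s hs').2.2.2

lemma polar_add_two_pi (σ φ r : ℝ) : polarU (σ, φ + 2 * Real.pi, r) = polarU (σ, φ, r) ∧
    polarV (σ, φ + 2 * Real.pi, r) = polarV (σ, φ, r) := by
  simp [polarU, polarV, polarX, polarY, polarZ, polarW]

/-- The product of the perturbation with the gradient of the Hamiltonian. -/
noncomputable def perturbDot (p q : MvPolynomial (Fin 2) ℝ) (r u v : ℝ) : ℝ :=
  hamU u v * MvPolynomial.eval ![u, v] p + hamV r u v * MvPolynomial.eval ![u, v] q

/-- The angular part of the perturbation in normal coordinates. -/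
noncomputable def perturbCross (p q : MvPolynomial (Fin 2) ℝ) (r u v : ℝ) : ℝ :=
  (1 - u) * MvPolynomial.eval ![u, v] p * normalZ r u v -
    normalW u * (normalZu r u v * MvPolynomial.eval ![u, v] p + normalZv r u v * MvPolynomial.eval ![u, v] q)

/-- Used with n = 0 for continuity along orbits and with n = 1 for smooth dependence on (ε, φ, σ).
-/
lemma contDiffOn_plane {E : Type*} [NormedAddCommGroup E] [NormedSpace ℝ E] {n : WithTop ℕ∞} {s : Set E}
    {r : ℝ} {u v : E → ℝ} (hu : ContDiffOn ℝ n u s) (hv : ContDiffOn ℝ n v s)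
    (hS : ∀ x ∈ s, 0 < normalS r (u x) (v x)) (p q : MvPolynomial (Fin 2) ℝ) :
    ContDiffOn ℝ n (fun x => normalZv r (u x) (v x)) s ∧
    ContDiffOn ℝ n (fun x => perturbDot p q r (u x) (v x)) s ∧
    ContDiffOn ℝ n (fun x => perturbCross p q r (u x) (v x)) s := by
  have hp := fun p => (contDiff_eval_pair p (n := n)).comp_contDiffOn (hu.prodMk hv)
  have hS1 : ContDiffOn ℝ n (fun x => √(normalS r (u x) (v x))) s := by
    refine ContDiffOn.sqrt ?_ fun x hx => (hS x hx).ne'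
    unfold normalS
    fun_prop
  have hS0 : ∀ x ∈ s, √(normalS r (u x) (v x)) ≠ 0 := fun x hx => (Real.sqrt_pos.2 (hS x hx)).ne'
  have hZv : ContDiffOn ℝ n (fun x => normalZv r (u x) (v x)) s :=
    hS1.add (ContDiffOn.div (by fun_prop) hS1 hS0)
  have hZu : ContDiffOn ℝ n (fun x => normalZu r (u x) (v x)) s :=
    ContDiffOn.div (by fun_prop) hS1 hS0
  have hZ : ContDiffOn ℝ n (fun x => normalZ r (u x) (v x)) s := hv.mul hS1
  have hU : ContDiffOn ℝ n (fun x => hamU (u x) (v x)) s := by unfold hamU; fun_prop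
  have hV : ContDiffOn ℝ n (fun x => hamV r (u x) (v x)) s := by unfold hamV; fun_prop
  have hW : ContDiffOn ℝ n (fun x => normalW (u x)) s := by unfold normalW; fun_prop
  exact ⟨hZv, (hU.mul (hp p)).add (hV.mul (hp q)),
    (((contDiffOn_const.sub hu).mul (hp p)).mul hZ).sub (hW.mul ((hZu.mul (hp p)).add (hZv.mul (hp q))))⟩

/-- The divergence polynomial with a vector of coefficients, integrated in `v`. -/
noncomputable def divergencePrimitive (c : Fin 6 → ℝ) : MvPolynomial (Fin 2) ℝ :=
  MvPolynomial.C (c 0) * MvPolynomial.X 1 +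
    MvPolynomial.C (c 1) * MvPolynomial.X 0 * MvPolynomial.X 1 +
    MvPolynomial.C (c 2 / 2) * MvPolynomial.X 1 ^ 2 + MvPolynomial.C (c 3 / 3) * MvPolynomial.X 1 ^ 3 +
    MvPolynomial.C (c 4 / 2) * MvPolynomial.X 0 * MvPolynomial.X 1 ^ 2 +
    MvPolynomial.C (c 5) * MvPolynomial.X 0 ^ 2 * MvPolynomial.X 1

lemma pderiv_divergencePrimitive (c : Fin 6 → ℝ) :
    MvPolynomial.pderiv 1 (divergencePrimitive c) =
      divergencePoly (c 0) (c 1) (c 2) (c 3) (c 4) (c 5) := by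
  refine MvPolynomial.funext fun x => ?_
  simp [divergencePrimitive, divergencePoly, MvPolynomial.pderiv_X]
  ring

/-- The first order Melnikov integral depends only on the divergence of the perturbation. -/
lemma integral_perturbDot {ρ R : ℝ} (hρ : ρ ≤ 1 / 4) (h : ∀ x ∈ polarDomain ρ R,
      (polarY x * polarZ x, x.2.2 * polarZ x ^ 2) ∈ Metric.ball (0 : ℝ × ℝ) radialRadius ∧
      1 / 4 ≤ normalZv x.2.2 (polarU x) (polarV x))
    {r : ℝ} (hr : |r| < R) {σ : ℝ} (hσ : |σ| < ρ) {p q : MvPolynomial (Fin 2) ℝ} {c : Fin 6 → ℝ}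
    (hdiv : MvPolynomial.pderiv 0 p + MvPolynomial.pderiv 1 q =
      divergencePoly (c 0) (c 1) (c 2) (c 3) (c 4) (c 5)) :
    ∫ t in 0..2 * Real.pi, perturbDot p q r (polarU (σ, t, r)) (polarV (σ, t, r)) /
      ((1 - polarU (σ, t, r)) * normalZv r (polarU (σ, t, r)) (polarV (σ, t, r))) = melnikov c r σ := by
  -- With k_v = p, the polynomial q + k_u has v-derivative equal to the divergence. It therefore
  -- differs from the v-primitive of the divergence by a polynomial g in u alone.
  obtain ⟨k, hk⟩ := exists_pderiv_eq 1 p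
  set g := q + MvPolynomial.pderiv 0 k - divergencePrimitive c with hg
  have hg1 : MvPolynomial.pderiv 1 g = 0 := by
    rw [hg, map_sub, map_add, ← pderiv_comm_pair, hk, pderiv_divergencePrimitive, ← hdiv]
    ring
  obtain ⟨l, hl⟩ := exists_pderiv_eq 0 g
  set u : ℝ → ℝ := fun t => polarU (σ, t, r) with hu
  set v : ℝ → ℝ := fun t => polarV (σ, t, r) with hv
  have hmem : ∀ t, (σ, t, r) ∈ polarDomain ρ R := fun t => ⟨hσ, hr⟩
  have hder : ∀ t, HasDerivAt u (polarZ (σ, t, r) / (1 - u t)) t ∧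
      HasDerivAt v (-(hamU (u t) (v t)) / ((1 - u t) * normalZv r (u t) (v t))) t := by
    intro t
    obtain ⟨u', v', h1, h2, h3, h4⟩ := hasDerivAt_polar hρ h hr (hasDerivAt_const t σ) hσ
    obtain ⟨s1, -, s2, s3⟩ := polar_spec ((hmem t).1.trans_le hρ) (h _ (hmem t)).1
    have hy : 0 < 1 - u t := by
      simpa [hu, polarU] using (polarY_spec ((hmem t).1.trans_le hρ)).1
    have hz : 0 < normalZv r (u t) (v t) := lt_of_lt_of_le (by norm_num) (h _ (hmem t)).2
    have hu' : u' = polarZ (σ, t, r) / (1 - u t) := by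
      rw [eq_div_iff hy.ne', mul_comm, h3, polarZ]
      ring
    refine ⟨hu' ▸ h1, ?_⟩
    have hv' : v' = -(hamU (u t) (v t)) / ((1 - u t) * normalZv r (u t) (v t)) := by
      rw [eq_div_iff (by positivity), hamU_eq s2]
      simp only at s1 s3
      rw [s1, s3]
      change normalZu r (u t) (v t) * u' + normalZv r (u t) (v t) * v' = 0 * Real.cos t - σ * Real.sin t at h4
      have h5 : (1 - u t) * u' = polarZ (σ, t, r) := by
        rw [hu']
        field_simp
      rw [← h5, polarW]
      linear_combination (1 - u t) * h4
    exact hv' ▸ h2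
  -- On the level curve the integrand is q u' - p v', and subtracting (v-primitive of the
  -- divergence) · u' leaves the derivative of -k(u, v) + l(u, 0), where l_u = g. This function is
  -- 2π-periodic, so the two integrals agree.
  set K : ℝ → ℝ := fun t => -MvPolynomial.eval ![u t, v t] k + MvPolynomial.eval ![u t, 0] l with hKdef
  have hK : ∀ t, HasDerivAt K (perturbDot p q r (u t) (v t) / ((1 - u t) * normalZv r (u t) (v t)) -
      linComb c fun k e => basicIntegrand k e (σ, t, r)) t := by
    intro t
    obtain ⟨s1, -, s2, s3⟩ := polar_spec ((hmem t).1.trans_le hρ) (h _ (hmem t)).1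
    have hy : 0 < 1 - u t := by
      simpa [hu, polarU] using (polarY_spec ((hmem t).1.trans_le hρ)).1
    have hz : 0 < normalZv r (u t) (v t) := lt_of_lt_of_le (by norm_num) (h _ (hmem t)).2
    refine ((hasDerivAt_eval_pair k (hder t).1 (hder t).2).fun_neg.fun_add
      (hasDerivAt_eval_pair l (hder t).1 (hasDerivAt_const t 0))).congr_deriv ?_
    rw [hk, hl, ← eval_eq_of_pderiv_one_eq_zero hg1 _ (v t), perturbDot, hamV_eq s2]
    simp only at s1 s3
    rw [s3]
    have hlin : (linComb c fun k e => basicIntegrand k e (σ, t, r)) = polarZ (σ, t, r) / (1 - u t) *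
        MvPolynomial.eval ![u t, v t] (divergencePrimitive c) := by
      have hY : polarY (σ, t, r) = 1 - u t := by simp [hu, polarU]
      simp only [linComb, basicIntegrand, divergencePrimitive, hY]
      simp only [hv, polarV]
      simp
      field_simp
      ring
    rw [hlin]
    simp only [hg, map_sub, map_add]
    field_simp
    ring
  have hcu : Continuous u := continuous_iff_continuousAt.2 fun t => (hder t).1.continuousAt
  have hcv : Continuous v := continuous_iff_continuousAt.2 fun t => (hder t).2.continuousAt
  have hper : K (2 * Real.pi) = K 0 := by
    have h1 := polar_add_two_pi σ 0 r
    rw [zero_add] at h1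
    simp only [hKdef, hu, hv, h1.1, h1.2]
  have hcb : Continuous fun t => linComb c fun k e => basicIntegrand k e (σ, t, r) := by
    have := fun k e => continuous_basicIntegrand hρ (fun x hx => (h x hx).1) k e hσ hr
    unfold linComb
    fun_prop
  have hcN : Continuous fun t =>
      perturbDot p q r (u t) (v t) / ((1 - u t) * normalZv r (u t) (v t)) := by
    have hS : ∀ t ∈ univ, 0 < normalS r (u t) (v t) := fun t _ =>
      (polar_spec ((hmem t).1.trans_le hρ) (h _ (hmem t)).1).2.2.1
    obtain ⟨h1, h2, -⟩ := contDiffOn_plane (n := 0) (contDiffOn_zero.2 hcu.continuousOn)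
      (contDiffOn_zero.2 hcv.continuousOn) hS p q
    refine (continuousOn_univ.1 h2.continuousOn).div
      ((continuous_const.sub hcu).mul (continuousOn_univ.1 h1.continuousOn)) fun t => ?_
    have hy : 0 < 1 - u t := by
      simpa [hu, polarU] using (polarY_spec ((hmem t).1.trans_le hρ)).1
    have hz : 0 < normalZv r (u t) (v t) := lt_of_lt_of_le (by norm_num) (h _ (hmem t)).2
    positivity
  have hinteg := intervalIntegral.integral_eq_sub_of_hasDerivAt (fun t _ => hK t)
    ((hcN.sub hcb).intervalIntegrable 0 (2 * Real.pi))
  rw [intervalIntegral.integral_sub (hcN.intervalIntegrable _ _) (hcb.intervalIntegrable _ _), hper,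
    sub_self, sub_eq_zero] at hinteg
  exact hinteg

/-! ### Periodic changes of time -/

lemma exists_pos_le_of_periodic {h : ℝ → ℝ} {P : ℝ} (hP : 0 < P) (hc : Continuous h)
    (hper : ∀ t, h (t + P) = h t) (hpos : ∀ t, 0 < h t) : ∃ m, 0 < m ∧ ∀ t, m ≤ h t := by
  obtain ⟨a, -, ha⟩ := isCompact_Icc.exists_isMinOn (nonempty_Icc.2 hP.le) hc.continuousOn
  refine ⟨h a, hpos a, fun t => ?_⟩
  obtain ⟨b, hb, hbt⟩ := (show Function.Periodic h P from hper).exists_mem_Ico₀ hP t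
  rw [hbt]
  exact ha (Ico_subset_Icc_self hb)

lemma surjective_of_le_deriv {f f' : ℝ → ℝ} {m : ℝ} (hf : ∀ t, HasDerivAt f (f' t) t) (hm : 0 < m)
    (h : ∀ t, m ≤ f' t) : StrictMono f ∧ Function.Surjective f := by
  have hmono : Monotone fun t => f t - m * t := by
    have hd : ∀ t, HasDerivAt (fun t => f t - m * t) (f' t - m) t := fun t =>
      ((hf t).fun_sub ((hasDerivAt_id' t).const_mul m)).congr_deriv (by ring)
    refine monotone_of_deriv_nonneg (fun t => (hd t).differentiableAt) fun t => ?_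
    rw [(hd t).deriv]
    linarith [h t]
  have hcont : Continuous f := continuous_iff_continuousAt.2 fun t => (hf t).continuousAt
  refine ⟨fun a b hab => ?_, hcont.surjective ?_ ?_⟩
  · have := hmono hab.le
    simp only at this
    nlinarith
  · have h1 : Tendsto (fun t => f 0 + m * t) atTop atTop :=
      tendsto_atTop_add_const_left _ _ (tendsto_id.const_mul_atTop hm)
    refine tendsto_atTop_mono' _ ?_ h1
    filter_upwards [eventually_ge_atTop 0] with t ht
    have := hmono ht
    simp only at this
    linarith
  · have h1 : Tendsto (fun t => f 0 + m * t) atBot atBot :=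
      tendsto_atBot_add_const_left _ _ (tendsto_id.const_mul_atBot hm)
    refine tendsto_atBot_mono' _ ?_ h1
    filter_upwards [eventually_le_atBot 0] with t ht
    have := hmono ht
    simp only at this
    linarith

/-- The time change that turns the speed `1` into the periodic positive speed `h`. -/
lemma exists_time_change {h : ℝ → ℝ} {P : ℝ} (hP : 0 < P) (hc : Continuous h)
    (hper : ∀ t, h (t + P) = h t) (hpos : ∀ t, 0 < h t) :
    ∃ (φ : ℝ → ℝ) (T : ℝ), 0 < T ∧ (∀ t, HasDerivAt φ (h (φ t)) t) ∧ (∀ t, φ (t + T) = φ t + P) ∧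
      Function.Surjective φ := by
  set k : ℝ → ℝ := fun t => (h t)⁻¹ with hk
  have hkc : Continuous k := hc.inv₀ fun t => (hpos t).ne'
  have hkper : ∀ t, k (t + P) = k t := fun t => by simp only [hk, hper]
  obtain ⟨m, hm, hmk⟩ := exists_pos_le_of_periodic hP hkc hkper fun t => inv_pos.2 (hpos t)
  -- `f` is the time needed to reach x at speed `h`; its inverse is the required time change.
  set f : ℝ → ℝ := fun x => ∫ t in 0..x, k t with hf
  have hfd : ∀ x, HasDerivAt f (k x) x := fun x => hkc.integral_hasStrictDerivAt 0 x |>.hasDerivAt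
  obtain ⟨hmono, hsurj⟩ := surjective_of_le_deriv hfd hm hmk
  set e := hmono.orderIsoOfSurjective f hsurj with he
  have hef : ∀ x, e x = f x := fun x => rfl
  have hfper : ∀ x, f (x + P) = f x + f P := by
    intro x
    have h1 : ∀ x, HasDerivAt (fun x => f (x + P) - f x) 0 x := fun x =>
      (((hfd (x + P)).comp_add_const x P).fun_sub (hfd x)).congr_deriv (by rw [hkper, sub_self])
    have h2 := is_const_of_deriv_eq_zero (fun x => (h1 x).differentiableAt) (fun x => (h1 x).deriv) x 0
    have h3 : f 0 = 0 := by simp [hf]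
    simp only [zero_add, h3] at h2
    linarith
  have hfP : 0 < f P := by
    have := hmono hP
    simpa [hf] using this
  refine ⟨e.symm, f P, hfP, fun t => ?_, fun t => ?_, e.symm.surjective⟩
  · have h1 := HasDerivAt.of_local_left_inverse (f := e) (g := e.symm) (a := t) (f' := k (e.symm t))
      e.symm.continuous.continuousAt (hfd _) (inv_pos.2 (hpos _)).ne'
      (Eventually.of_forall fun y => e.apply_symm_apply y)
    simpa [hk] using h1
  · rw [OrderIso.symm_apply_eq, hef, hfper, ← hef (e.symm t), OrderIso.apply_symm_apply]

/-! ### Periodic orbits and periodic solutions of the polar equation -/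

/-- The area swept per unit time in normal coordinates. -/
noncomputable def angular (p q : MvPolynomial (Fin 2) ℝ) (r ε u v : ℝ) : ℝ :=
  energy r u v * ((1 - u) * normalZv r u v) + ε * perturbCross p q r u v

/-- Here f and g are the velocities of u and v, so the left sides are z ẇ - w ż = σ² φ̇ and w ẇ + z
ż = σ σ̇. The Hamiltonian part drops out of the second because H is conserved, which makes σ a slow
variable. -/
lemma normal_kinematics {r u v : ℝ} (h : 0 < normalS r u v) (p q : MvPolynomial (Fin 2) ℝ) (ε : ℝ) {f g : ℝ}
    (hf : f = hamV r u v + ε * MvPolynomial.eval ![u, v] p)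
    (hg : g = -hamU u v + ε * MvPolynomial.eval ![u, v] q) :
    normalZ r u v * ((1 - u) * f) - normalW u * (normalZu r u v * f + normalZv r u v * g) =
      angular p q r ε u v ∧
    normalW u * ((1 - u) * f) + normalZ r u v * (normalZu r u v * f + normalZv r u v * g) =
      ε * perturbDot p q r u v := by
  rw [angular, perturbDot, perturbCross, energy_eq h, hf, hg, hamV_eq h, hamU_eq h]
  constructor <;> ring

/-- The right hand side of the equation for `σ` as a function of the angle. -/
noncomputable def polarField (p q : MvPolynomial (Fin 2) ℝ) (r ε φ σ : ℝ) : ℝ :=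
  σ * perturbDot p q r (polarU (σ, φ, r)) (polarV (σ, φ, r)) /
    angular p q r ε (polarU (σ, φ, r)) (polarV (σ, φ, r))

/-- Here (A, B) is the velocity of (w, z) in time. Moving along the graph of a solution of the polar
equation at unit angular speed gives this velocity multiplied by the reciprocal y²/G of the angular
speed. -/
lemma polar_velocity {y s c A B G : ℝ} (hG : G ≠ 0) (hsc : s ^ 2 + c ^ 2 = 1)
    (h : y * c * A - y * s * B = G) :
    y * (y * s * A + y * c * B) / G * s + y * c = y ^ 2 / G * A ∧
    y * (y * s * A + y * c * B) / G * c - y * s = y ^ 2 / G * B := by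
  rw [div_mul_eq_mul_div, div_mul_eq_mul_div, div_mul_eq_mul_div, div_mul_eq_mul_div,
    div_add' _ _ _ hG, div_sub' hG, div_left_inj' hG, div_left_inj' hG]
  constructor
  · linear_combination y ^ 2 * A * hsc - y * c * h
  · linear_combination y ^ 2 * B * hsc + y * s * h

/-- A periodic solution of the polar equation gives a periodic orbit of the system. -/
lemma isPeriodicOrbit_polar {ρ R : ℝ} (hρ : ρ ≤ 1 / 4) (h : ∀ x ∈ polarDomain ρ R,
      (polarY x * polarZ x, x.2.2 * polarZ x ^ 2) ∈ Metric.ball (0 : ℝ × ℝ) radialRadius ∧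
      1 / 4 ≤ normalZv x.2.2 (polarU x) (polarV x))
    {r : ℝ} (hr : |r| < R) {p q : MvPolynomial (Fin 2) ℝ} {ε : ℝ} {y : ℝ → ℝ}
    (hy : ∀ t, HasDerivAt y (ε * polarField p q r ε t (y t)) t)
    (hper : ∀ t, y (t + 2 * Real.pi) = y t) (hy0 : ∀ t, 0 < y t) (hyρ : ∀ t, y t < ρ)
    (hang : ∀ t, 0 < angular p q r ε (polarU (y t, t, r)) (polarV (y t, t, r))) :
    IsPeriodicOrbit (nearHamiltonianField (hamiltonian r) p q ε)
      (range fun t => (polarU (y t, t, r), polarV (y t, t, r))) := by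
  set u : ℝ → ℝ := fun t => polarU (y t, t, r) with hu
  set v : ℝ → ℝ := fun t => polarV (y t, t, r) with hv
  set G : ℝ → ℝ := fun t => angular p q r ε (u t) (v t) with hG
  have hyρ' : ∀ t, |y t| < ρ := fun t => by rw [abs_of_pos (hy0 t)]; exact hyρ t
  have hmem : ∀ t, (y t, t, r) ∈ polarDomain ρ R := fun t => ⟨hyρ' t, hr⟩
  have hspec : ∀ t, normalW (u t) = y t * Real.sin t ∧ 0 < normalS r (u t) (v t) ∧
      normalZ r (u t) (v t) = y t * Real.cos t := fun t =>
    let s := polar_spec ((hmem t).1.trans_le hρ) (h _ (hmem t)).1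
    ⟨s.1, s.2.2.1, s.2.2.2⟩
  have hder : ∀ t, HasDerivAt u (y t ^ 2 / G t * (hamV r (u t) (v t) + ε * MvPolynomial.eval ![u t, v t] p)) t ∧
      HasDerivAt v (y t ^ 2 / G t * (-hamU (u t) (v t) + ε * MvPolynomial.eval ![u t, v t] q)) t := by
    intro t
    obtain ⟨u', v', h1, h2, h3, h4⟩ := hasDerivAt_polar hρ h hr (hy t) (hyρ' t)
    obtain ⟨s1, s2, s3⟩ := hspec t
    have hY : 0 < 1 - u t := by
      simpa [hu, polarU] using (polarY_spec ((hmem t).1.trans_le hρ)).1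
    have hZ : 0 < normalZv r (u t) (v t) := lt_of_lt_of_le (by norm_num) (h _ (hmem t)).2
    set f := hamV r (u t) (v t) + ε * MvPolynomial.eval ![u t, v t] p with hf
    set g := -hamU (u t) (v t) + ε * MvPolynomial.eval ![u t, v t] q with hg
    obtain ⟨k1, k2⟩ := normal_kinematics s2 p q ε hf hg
    have hGt : 0 < G t := hang t
    have hF : ε * polarField p q r ε t (y t) = y t * (ε * perturbDot p q r (u t) (v t)) / G t := by
      rw [polarField]
      ring
    rw [hF, ← k2] at h3 h4
    change _ = G t at k1
    rw [s1, s3] at k1 h3 h4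
    have hsc := Real.sin_sq_add_cos_sq t
    obtain ⟨e1, e2⟩ := polar_velocity hGt.ne' hsc k1
    rw [e1] at h3
    rw [e2] at h4
    have hu' : u' = y t ^ 2 / G t * f :=
      mul_left_cancel₀ hY.ne' (h3.trans (by ring))
    refine ⟨hu' ▸ h1, ?_⟩
    have hv' : v' = y t ^ 2 / G t * g := by
      change normalZu r (u t) (v t) * u' + normalZv r (u t) (v t) * v' = _ at h4
      refine mul_left_cancel₀ hZ.ne' ?_
      rw [hu'] at h4
      linear_combination h4
    exact hv' ▸ h2
  have hcu : Continuous u := continuous_iff_continuousAt.2 fun t => (hder t).1.continuousAt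
  have hcv : Continuous v := continuous_iff_continuousAt.2 fun t => (hder t).2.continuousAt
  have hcy : Continuous y := continuous_iff_continuousAt.2 fun t => (hy t).continuousAt
  have hGc : Continuous G := by
    obtain ⟨h1, -, h2⟩ := contDiffOn_plane (n := 0) (contDiffOn_zero.2 hcu.continuousOn)
      (contDiffOn_zero.2 hcv.continuousOn) (fun t (_ : t ∈ univ) => (hspec t).2.1) p q
    have h1' := continuousOn_univ.1 h1.continuousOn
    have h2' := continuousOn_univ.1 h2.continuousOn
    have h3 : Continuous fun t => energy r (u t) (v t) := by
      unfold energy normalW normalS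
      fun_prop
    exact (h3.mul ((continuous_const.sub hcu).mul h1')).add (continuous_const.mul h2')
  have huper : ∀ t, u (t + 2 * Real.pi) = u t := fun t => by
    simp only [hu, hper, (polar_add_two_pi _ _ _).1]
  have hvper : ∀ t, v (t + 2 * Real.pi) = v t := fun t => by
    simp only [hv, hper, (polar_add_two_pi _ _ _).2]
  -- G/y² is the actual angular speed; reparametrising by it turns the curve over the angle into a
  -- solution of the system.
  obtain ⟨φ, T, hT, hφ, hφT, hφs⟩ := exists_time_change (h := fun t => G t / y t ^ 2) Real.two_pi_pos
    (hGc.div (hcy.pow 2) fun t => (pow_pos (hy0 t) 2).ne')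
    (fun t => by simp only [hG, huper, hvper, hper]) (fun t => div_pos (hang t) (pow_pos (hy0 t) 2))
  have hcancel : ∀ t, ∀ a, y t ^ 2 / G t * a * (G t / y t ^ 2) = a := fun t a => by
    have h1 := (hang t).ne'
    have h2 := (hy0 t).ne'
    change G t ≠ 0 at h1
    field_simp
  refine ⟨fun t => (u (φ t), v (φ t)), T, hT, fun t => ?_, fun t => ?_, ?_, ?_⟩
  · rw [nearHamiltonianField_eq]
    have h1 := (hder (φ t)).1.comp t (hφ t)
    have h2 := (hder (φ t)).2.comp t (hφ t)
    rw [hcancel] at h1 h2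
    exact h1.prodMk h2
  · simp only [hφT, huper, hvper]
  -- A constant curve would have the same w at the angles π/2 and -π/2, where w = y > 0 and w = -y <
  -- 0.
  · by_contra! hcon
    obtain ⟨a, ha⟩ := hφs (Real.pi / 2)
    obtain ⟨b, hb⟩ := hφs (-(Real.pi / 2))
    have h1 : u (Real.pi / 2) = u (-(Real.pi / 2)) := by
      have := (Prod.ext_iff.1 ((hcon a).trans (hcon b).symm)).1
      simpa [ha, hb] using this
    have h2 := (hspec (Real.pi / 2)).1
    have h3 := (hspec (-(Real.pi / 2))).1
    rw [h1, h3] at h2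
    simp at h2
    linarith [hy0 (Real.pi / 2), hy0 (-(Real.pi / 2))]
  · exact (hφs.range_comp fun t => (u t, v t)).symm

lemma exists_polar_angle {w z σ : ℝ} (hσ : 0 < σ) (h : w ^ 2 + z ^ 2 = σ ^ 2) :
    ∃ φ, w = σ * Real.sin φ ∧ z = σ * Real.cos φ := by
  have hn : ‖(⟨z, w⟩ : ℂ)‖ = σ := by
    rw [Complex.norm_def, Complex.normSq_mk, show z * z + w * w = σ ^ 2 by linarith, Real.sqrt_sq hσ.le]
  refine ⟨Complex.arg ⟨z, w⟩, ?_, ?_⟩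
  · have := Complex.norm_mul_sin_arg ⟨z, w⟩
    rw [hn] at this
    exact this.symm
  · have := Complex.norm_mul_cos_arg ⟨z, w⟩
    rw [hn] at this
    exact this.symm

/-- If the polar angle of a plane curve is integrated from its angular velocity, it stays a polar
angle. -/
lemma polar_lift {W Z A B σ φ : ℝ → ℝ} (hW : ∀ t, HasDerivAt W (A t) t) (hZ : ∀ t, HasDerivAt Z (B t) t)
    (hσ : ∀ t, 0 < σ t) (hσ2 : ∀ t, W t ^ 2 + Z t ^ 2 = σ t ^ 2)
    (hσd : ∀ t, HasDerivAt σ ((W t * A t + Z t * B t) / σ t) t)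
    (hφ : ∀ t, HasDerivAt φ ((Z t * A t - W t * B t) / σ t ^ 2) t)
    (h0 : W 0 = σ 0 * Real.sin (φ 0)) (h1 : Z 0 = σ 0 * Real.cos (φ 0)) (t : ℝ) :
    W t = σ t * Real.sin (φ t) ∧ Z t = σ t * Real.cos (φ t) := by
  -- The velocity splits into the radial part (σ̇/σ)(W, Z) and the rotational part φ̇ (Z, -W).
  have hA : ∀ t, A t = (W t * A t + Z t * B t) / σ t ^ 2 * W t +
      (Z t * A t - W t * B t) / σ t ^ 2 * Z t := fun t => by
    have := (hσ t).ne'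
    field_simp
    rw [← hσ2 t]
    ring
  have hB : ∀ t, B t = (W t * A t + Z t * B t) / σ t ^ 2 * Z t -
      (Z t * A t - W t * B t) / σ t ^ 2 * W t := fun t => by
    have := (hσ t).ne'
    field_simp
    rw [← hσ2 t]
    ring
  -- In the frame rotating by φ each component satisfies f' = (σ̇/σ) f, so its quotient by σ is
  -- constant and equal to its initial value.
  have hquot : ∀ {f f' : ℝ → ℝ}, (∀ t, HasDerivAt f (f' t) t) →
      (∀ t, f' t = (W t * A t + Z t * B t) / σ t ^ 2 * f t) → ∀ t, f t / σ t = f 0 / σ 0 := by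
    intro f f' hf hf' t
    have hd : ∀ t, HasDerivAt (fun t => f t / σ t) 0 t := fun t => by
      refine ((hf t).fun_div (hσd t) (hσ t).ne').congr_deriv ?_
      have := (hσ t).ne'
      rw [hf' t]
      field_simp
      ring
    exact is_const_of_deriv_eq_zero (fun t => (hd t).differentiableAt) (fun t => (hd t).deriv) t 0
  have ha := hquot (f := fun t => W t * Real.sin (φ t) + Z t * Real.cos (φ t)) (fun t =>
    ((hW t).fun_mul (hφ t).sin).fun_add ((hZ t).fun_mul (hφ t).cos)) (fun t => by
      linear_combination Real.sin (φ t) * hA t + Real.cos (φ t) * hB t) t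
  have hb := hquot (f := fun t => W t * Real.cos (φ t) - Z t * Real.sin (φ t)) (fun t =>
    ((hW t).fun_mul (hφ t).cos).fun_sub ((hZ t).fun_mul (hφ t).sin)) (fun t => by
      linear_combination Real.cos (φ t) * hA t - Real.sin (φ t) * hB t) t
  have hs0 := Real.sin_sq_add_cos_sq (φ 0)
  have hst := Real.sin_sq_add_cos_sq (φ t)
  have h0' := (hσ 0).ne'
  have ha' : W t * Real.sin (φ t) + Z t * Real.cos (φ t) = σ t := by
    have h2 : W 0 * Real.sin (φ 0) + Z 0 * Real.cos (φ 0) = σ 0 := by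
      rw [h0, h1]
      linear_combination σ 0 * hs0
    rw [h2, div_self h0', div_eq_one_iff_eq (hσ t).ne'] at ha
    exact ha
  have hb' : W t * Real.cos (φ t) - Z t * Real.sin (φ t) = 0 := by
    have h2 : W 0 * Real.cos (φ 0) - Z 0 * Real.sin (φ 0) = 0 := by
      rw [h0, h1]
      ring
    rw [h2, zero_div, div_eq_zero_iff] at hb
    exact hb.resolve_right (hσ t).ne'
  constructor
  · linear_combination Real.sin (φ t) * ha' + Real.cos (φ t) * hb' - W t * hst
  · linear_combination Real.cos (φ t) * ha' - Real.sin (φ t) * hb' - Z t * hst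

lemma exists_eq_add_of_sin_cos_eq {a b : ℝ} (hs : Real.sin b = Real.sin a) (hc : Real.cos b = Real.cos a)
    (hab : a < b) : ∃ n : ℕ, 0 < n ∧ b = a + n * (2 * Real.pi) := by
  have h := Real.Angle.cos_sin_inj hc hs
  obtain ⟨k, hk⟩ := Real.Angle.angle_eq_iff_two_pi_dvd_sub.1 h
  have hpos : (0 : ℝ) < k := by
    by_contra hcon
    have := mul_nonpos_of_nonneg_of_nonpos Real.two_pi_pos.le (not_lt.1 hcon)
    linarith
  have hk0 : 0 < k := by exact_mod_cast hpos
  refine ⟨k.toNat, by omega, ?_⟩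
  have : ((k.toNat : ℕ) : ℝ) = k := by
    have : ((k.toNat : ℕ) : ℤ) = k := Int.toNat_of_nonneg hk0.le
    exact_mod_cast this
  rw [this]
  linarith

/-- Periodic orbits in a thin annulus come from the periodic solution of the polar equation. -/
lemma eq_range_polar_of_isPeriodicOrbit {r ρ₂ : ℝ}
    (hbox : ∀ u v, |u| < ρ₂ → |v| < ρ₂ → u < 1 ∧ 0 < normalS r u v ∧
      ∀ σ φ, normalW u = σ * Real.sin φ → normalZ r u v = σ * Real.cos φ →
        polarU (σ, φ, r) = u ∧ polarV (σ, φ, r) = v)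
    {p q : MvPolynomial (Fin 2) ℝ} {ε x₀ δ : ℝ} (hδ : δ ≤ x₀)
    (hang : ∀ φ σ, |σ - x₀| < δ → 0 < angular p q r ε (polarU (σ, φ, r)) (polarV (σ, φ, r)))
    {y : ℝ → ℝ}
    (huniq : ∀ (φ σ κ : ℝ → ℝ) (T : ℝ) (n : ℕ), (∀ t, HasDerivAt φ (κ t) t) → (∀ t, 0 < κ t) →
      (∀ t, HasDerivAt σ (κ t * (ε * polarField p q r ε (φ t) (σ t))) t) → (∀ t, |σ t - x₀| < δ) →
      0 < n → φ T = φ 0 + n * (2 * Real.pi) → σ T = σ 0 → ∀ t, σ t = y (φ t))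
    {Γ : Set (ℝ × ℝ)} (hΓ : IsPeriodicOrbit (nearHamiltonianField (hamiltonian r) p q ε) Γ)
    (hΓU : Γ ⊆ {x | |x.1| < ρ₂ ∧ |x.2| < ρ₂ ∧ |√(energy r x.1 x.2) - x₀| < δ}) :
    Γ = range fun t => (polarU (y t, t, r), polarV (y t, t, r)) := by
  obtain ⟨γ, T, hT, hγ, hγT, -, rfl⟩ := hΓ
  set u : ℝ → ℝ := fun t => (γ t).1 with hu
  set v : ℝ → ℝ := fun t => (γ t).2 with hv
  have hU : ∀ t, |u t| < ρ₂ ∧ |v t| < ρ₂ ∧ |√(energy r (u t) (v t)) - x₀| < δ := fun t =>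
    hΓU ⟨t, rfl⟩
  have hb : ∀ t, _ := fun t => hbox (u t) (v t) (hU t).1 (hU t).2.1
  set f : ℝ → ℝ := fun t => hamV r (u t) (v t) + ε * MvPolynomial.eval ![u t, v t] p with hf
  set g : ℝ → ℝ := fun t => -hamU (u t) (v t) + ε * MvPolynomial.eval ![u t, v t] q with hg
  have hγ' : ∀ t, HasDerivAt γ (f t, g t) t := fun t => by
    have := hγ t
    rwa [nearHamiltonianField_eq] at this
  have hud : ∀ t, HasDerivAt u (f t) t := fun t => (hγ' t).fst
  have hvd : ∀ t, HasDerivAt v (g t) t := fun t => (hγ' t).snd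
  set W : ℝ → ℝ := fun t => normalW (u t) with hWdef
  set Z : ℝ → ℝ := fun t => normalZ r (u t) (v t) with hZdef
  set A : ℝ → ℝ := fun t => (1 - u t) * f t with hA
  set B : ℝ → ℝ := fun t => normalZu r (u t) (v t) * f t + normalZv r (u t) (v t) * g t with hB
  have hW : ∀ t, HasDerivAt W (A t) t := fun t => hasDerivAt_normalW (hud t)
  have hZ : ∀ t, HasDerivAt Z (B t) t := fun t => hasDerivAt_normalZ (hud t) (hvd t) (hb t).2.1
  set σ : ℝ → ℝ := fun t => √(energy r (u t) (v t)) with hσdef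
  have hσ : ∀ t, 0 < σ t := fun t => by linarith [(abs_lt.1 (hU t).2.2).1]
  have hE : ∀ t, 0 < energy r (u t) (v t) := fun t => Real.sqrt_pos.1 (hσ t)
  have hσ2 : ∀ t, W t ^ 2 + Z t ^ 2 = σ t ^ 2 := fun t => by
    rw [hσdef, Real.sq_sqrt (hE t).le, energy_eq (hb t).2.1]
  have hσeq : σ = fun t => √(W t ^ 2 + Z t ^ 2) := funext fun t => by
    rw [hσ2 t, Real.sqrt_sq (hσ t).le]
  have hσd : ∀ t, HasDerivAt σ ((W t * A t + Z t * B t) / σ t) t := fun t => by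
    have h1 := (((hW t).fun_pow 2).fun_add ((hZ t).fun_pow 2)).sqrt
      (by rw [hσ2 t]; exact (pow_pos (hσ t) 2).ne')
    rw [hσ2 t, Real.sqrt_sq (hσ t).le, ← hσeq] at h1
    refine h1.congr_deriv ?_
    have := (hσ t).ne'
    field_simp
    simp
    ring
  have hkin : ∀ t, _ := fun t => normal_kinematics (hb t).2.1 p q ε (f := f t) (g := g t) rfl rfl
  set κ : ℝ → ℝ := fun t => angular p q r ε (u t) (v t) / σ t ^ 2 with hκ
  -- The positivity hypothesis is stated in polar form; any polar angle of the point transfers it to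
  -- (u, v).
  have hκpos : ∀ t, 0 < κ t := fun t => by
    obtain ⟨φ, h1, h2⟩ := exists_polar_angle (hσ t) (hσ2 t)
    obtain ⟨h3, h4⟩ := (hb t).2.2 _ _ h1 h2
    have h5 := hang φ (σ t) (hU t).2.2
    rw [h3, h4] at h5
    exact div_pos h5 (pow_pos (hσ t) 2)
  have hcu : Continuous u := continuous_iff_continuousAt.2 fun t => (hud t).continuousAt
  have hcv : Continuous v := continuous_iff_continuousAt.2 fun t => (hvd t).continuousAt
  have hcσ : Continuous σ := continuous_iff_continuousAt.2 fun t => (hσd t).continuousAt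
  have hcE : Continuous fun t => energy r (u t) (v t) := by
    unfold energy normalW normalS
    fun_prop
  have hcκ : Continuous κ := by
    obtain ⟨h1, -, h2⟩ := contDiffOn_plane (n := 0) (contDiffOn_zero.2 hcu.continuousOn)
      (contDiffOn_zero.2 hcv.continuousOn) (fun t (_ : t ∈ univ) => (hb t).2.1) p q
    have h1' := continuousOn_univ.1 h1.continuousOn
    have h2' := continuousOn_univ.1 h2.continuousOn
    exact ((hcE.mul ((continuous_const.sub hcu).mul h1')).add (continuous_const.mul h2')).div
      (hcσ.pow 2) fun t => (pow_pos (hσ t) 2).ne'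
  have huT : ∀ t, u (t + T) = u t := fun t => by simp only [hu, hγT]
  have hvT : ∀ t, v (t + T) = v t := fun t => by simp only [hv, hγT]
  have hσT : ∀ t, σ (t + T) = σ t := fun t => by simp only [hσdef, huT, hvT]
  obtain ⟨m, hm, hmκ⟩ := exists_pos_le_of_periodic hT hcκ
    (fun t => by simp only [hκ, huT, hvT, hσT]) hκpos
  obtain ⟨φ₀, h01, h02⟩ := exists_polar_angle (hσ 0) (hσ2 0)
  set φ : ℝ → ℝ := fun t => φ₀ + ∫ s in 0..t, κ s with hφdef
  have hφ : ∀ t, HasDerivAt φ (κ t) t := fun t =>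
    (hcκ.integral_hasStrictDerivAt 0 t).hasDerivAt.const_add φ₀
  have hφ0 : φ 0 = φ₀ := by simp [hφdef]
  obtain ⟨hφm, hφs⟩ := surjective_of_le_deriv hφ hm hmκ
  have hlift := polar_lift hW hZ hσ hσ2 hσd (fun t => by
    rw [(hkin t).1]
    exact hφ t) (by rw [hφ0]; exact h01) (by rw [hφ0]; exact h02)
  have hpt : ∀ t, polarU (σ t, φ t, r) = u t ∧ polarV (σ t, φ t, r) = v t := fun t =>
    (hb t).2.2 _ _ (hlift t).1 (hlift t).2
  have hT0 : u T = u 0 ∧ v T = v 0 ∧ σ T = σ 0 := by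
    have h1 := huT 0
    have h2 := hvT 0
    have h3 := hσT 0
    rw [zero_add] at h1 h2 h3
    exact ⟨h1, h2, h3⟩
  -- One period of the orbit may wind several times around the origin, and `huniq` covers every n >
  -- 0.
  obtain ⟨n, hn, hφT⟩ := exists_eq_add_of_sin_cos_eq (a := φ 0) (b := φ T) (by
      have h1 := (hlift T).1
      rw [hT0.2.2, show W T = W 0 by simp only [hWdef, hT0.1], (hlift 0).1] at h1
      exact (mul_left_cancel₀ (hσ 0).ne' h1).symm) (by
      have h1 := (hlift T).2
      rw [hT0.2.2, show Z T = Z 0 by simp only [hZdef, hT0.1, hT0.2.1], (hlift 0).2] at h1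
      exact (mul_left_cancel₀ (hσ 0).ne' h1).symm) (hφm hT)
  have hσy := huniq φ σ κ T n hφ hκpos (fun t => by
    refine (hσd t).congr_deriv ?_
    rw [polarField, (hpt t).1, (hpt t).2, (hkin t).2]
    have h1 := (hσ t).ne'
    have h2 : angular p q r ε (u t) (v t) ≠ 0 := fun h => by
      have := hκpos t
      simp only [hκ, h, zero_div, lt_irrefl] at this
    simp only [hκ]
    field_simp) (fun t => (hU t).2.2) hn hφT hT0.2.2
  have hγφ : γ = (fun t => (polarU (y t, t, r), polarV (y t, t, r))) ∘ φ := funext fun t => by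
    simp only [Function.comp, ← hσy t, (hpt t).1, (hpt t).2, hu, hv]
  rw [hγφ, hφs.range_comp]

/-! ### From a simple zero of the Melnikov function to a limit cycle -/

lemma polar_energy {x : ℝ × ℝ × ℝ} (hx : |x.1| < 1 / 4)
    (h : (polarY x * polarZ x, x.2.2 * polarZ x ^ 2) ∈ Metric.ball (0 : ℝ × ℝ) radialRadius) :
    energy x.2.2 (polarU x) (polarV x) = x.1 ^ 2 := by
  obtain ⟨h1, -, h2, h3⟩ := polar_spec hx h
  rw [energy_eq h2, h1, h3, polarW, polarZ]
  linear_combination x.1 ^ 2 * Real.sin_sq_add_cos_sq x.2.1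

/-- A simple zero of the Melnikov function produces a limit cycle. -/
lemma exists_limitCycle_of_simple_zero {ρ R ρ₂ : ℝ} (hρ : ρ ≤ 1 / 4) (h : ∀ x ∈ polarDomain ρ R,
      (polarY x * polarZ x, x.2.2 * polarZ x ^ 2) ∈ Metric.ball (0 : ℝ × ℝ) radialRadius ∧
      1 / 4 ≤ normalZv x.2.2 (polarU x) (polarV x))
    {r : ℝ} (hr : |r| < R) (hbox : ∀ u v, |u| < ρ₂ → |v| < ρ₂ → u < 1 ∧ 0 < normalS r u v ∧
      ∀ σ φ, normalW u = σ * Real.sin φ → normalZ r u v = σ * Real.cos φ →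
        polarU (σ, φ, r) = u ∧ polarV (σ, φ, r) = v)
    {p q : MvPolynomial (Fin 2) ℝ} {c : Fin 6 → ℝ}
    (hdiv : MvPolynomial.pderiv 0 p + MvPolynomial.pderiv 1 q =
      divergencePoly (c 0) (c 1) (c 2) (c 3) (c 4) (c 5))
    {x₀ m : ℝ} (hx₀ : 0 < x₀) (hxρ : x₀ < ρ) (hxρ₂ : 2 * x₀ < ρ₂) (hM : melnikov c r x₀ = 0)
    (hM' : HasDerivAt (melnikov c r) m x₀) (hm : m ≠ 0) {δ₀ : ℝ} (hδ₀ : 0 < δ₀) :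
    ∃ ε₀, 0 < ε₀ ∧ ∀ ε, 0 < ε → ε < ε₀ → ∃ Γ,
      IsLimitCycle (nearHamiltonianField (hamiltonian r) p q ε) Γ ∧ Γ.Nonempty ∧
      ∀ x ∈ Γ, |x.1| < 2 * (x₀ + δ₀) ∧ |x.2| < 2 * (x₀ + δ₀) ∧ |√(energy r x.1 x.2) - x₀| < δ₀ := by
  have hdom : ∀ {σ : ℝ}, 0 < σ → σ < ρ → ∀ φ, (σ, φ, r) ∈ polarDomain ρ R := fun h1 h2 φ =>
    ⟨by rw [abs_of_pos h1]; exact h2, hr⟩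
  set D : Set (ℝ × ℝ × ℝ) := univ ×ˢ univ ×ˢ Ioo 0 ρ with hD
  have hmap : ContDiff ℝ 1 fun x : ℝ × ℝ × ℝ => (x.2.2, x.2.1, r) := by fun_prop
  have hmaps : MapsTo (fun x : ℝ × ℝ × ℝ => (x.2.2, x.2.1, r)) D (polarDomain ρ R) := fun x hx =>
    hdom hx.2.2.1 hx.2.2.2 _
  have hu : ContDiffOn ℝ 1 (fun x : ℝ × ℝ × ℝ => polarU (x.2.2, x.2.1, r)) D :=
    (contDiffOn_const.sub (contDiffOn_polarY hρ)).comp hmap.contDiffOn hmaps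
  have hv : ContDiffOn ℝ 1 (fun x : ℝ × ℝ × ℝ => polarV (x.2.2, x.2.1, r)) D :=
    (contDiff_polarZ.contDiffOn.mul (contDiffOn_polarX hρ fun x hx => (h x hx).1)).comp
      hmap.contDiffOn hmaps
  have hS : ∀ x ∈ D, 0 < normalS r (polarU (x.2.2, x.2.1, r)) (polarV (x.2.2, x.2.1, r)) := fun x hx =>
    (polar_spec ((hmaps hx).1.trans_le hρ) (h _ (hmaps hx)).1).2.2.1
  obtain ⟨hZv, hN, hC⟩ := contDiffOn_plane hu hv hS p q
  have hG : ContDiffOn ℝ 1 (fun x : ℝ × ℝ × ℝ =>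
      angular p q r x.1 (polarU (x.2.2, x.2.1, r)) (polarV (x.2.2, x.2.1, r))) D := by
    unfold angular energy normalW normalS
    fun_prop
  have hGper : ∀ ε t x, angular p q r ε (polarU (x, t + 2 * Real.pi, r)) (polarV (x, t + 2 * Real.pi, r)) =
      angular p q r ε (polarU (x, t, r)) (polarV (x, t, r)) := fun ε t x => by
    rw [(polar_add_two_pi x t r).1, (polar_add_two_pi x t r).2]
  -- For ε = 0 the angular quantity is σ² y z_v, with y ≥ 1/2 because w ≤ 1/4, and z_v ≥ 1/4.
  -- Uniform continuity then keeps it positive for small ε and σ near x₀.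
  have hG0 : ∀ t, x₀ ^ 2 / 8 ≤ angular p q r 0 (polarU (x₀, t, r)) (polarV (x₀, t, r)) := by
    intro t
    have hm := hdom hx₀ hxρ t
    have h1 := polar_energy (hm.1.trans_le hρ) (h _ hm).1
    have h2 := (h _ hm).2
    obtain ⟨h3, -, h4⟩ := polarY_spec (hm.1.trans_le hρ)
    have h5 := abs_le.1 ((abs_polarW_le (x₀, t, r)).trans (hm.1.trans_le hρ).le)
    have h6 : 1 / 2 ≤ polarY (x₀, t, r) := by nlinarith
    simp only at h1 h2
    rw [angular, h1, zero_mul, add_zero, polarU, sub_sub_cancel, ← polarU]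
    have h7 : (1 / 2 : ℝ) * (1 / 4) ≤
        polarY (x₀, t, r) * normalZv r (polarU (x₀, t, r)) (polarV (x₀, t, r)) :=
      mul_le_mul h6 h2 (by norm_num) h3.le
    nlinarith [sq_nonneg x₀]
  obtain ⟨ε₁, hε₁, -, hball, hclose⟩ := exists_uniform_bound
    (G := fun ε t x => angular p q r ε (polarU (x, t, r)) (polarV (x, t, r))) Real.two_pi_pos one_pos
    isOpen_Ioo (hG.continuousOn.mono (prod_mono (subset_univ _) le_rfl)) hGper
    (x₀ := x₀) ⟨hx₀, hxρ⟩ (ν := x₀ ^ 2 / 16) (by positivity)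
  have hGpos : ∀ ε t x, |ε| ≤ ε₁ → |x - x₀| ≤ ε₁ →
      0 < angular p q r ε (polarU (x, t, r)) (polarV (x, t, r)) := fun ε t x h1 h2 => by
    have h3 := (abs_le.1 (hclose ε t x h1 h2)).1
    have h4 := hG0 t
    have h5 := pow_pos hx₀ 2
    linarith
  set s : Set ℝ := Ioo (x₀ - ε₁) (x₀ + ε₁) with hs
  have hsρ : s ⊆ Ioo 0 ρ := fun x hx => hball (by
    rw [Metric.mem_closedBall, Real.dist_eq]
    exact abs_le.2 ⟨by linarith [hx.1], by linarith [hx.2]⟩)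
  have hsub : Ioo (-ε₁) ε₁ ×ˢ univ ×ˢ s ⊆ D := prod_mono (subset_univ _) (prod_mono le_rfl hsρ)
  have hO : IsOpen (Ioo (-ε₁) ε₁ ×ˢ (univ : Set ℝ) ×ˢ s) :=
    isOpen_Ioo.prod (isOpen_univ.prod isOpen_Ioo)
  have hF : ContDiffOn ℝ 1 (fun x : ℝ × ℝ × ℝ => polarField p q r x.1 x.2.1 x.2.2)
      (Ioo (-ε₁) ε₁ ×ˢ univ ×ˢ s) := by
    refine ContDiffOn.div (contDiff_snd.snd.contDiffOn.mul (hN.mono hsub)) (hG.mono hsub)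
      fun x hx => (hGpos _ _ _ (abs_le.2 ⟨hx.1.1.le, hx.1.2.le⟩) (abs_le.2 ?_)).ne'
    exact ⟨by linarith [hx.2.2.1], by linarith [hx.2.2.2]⟩
  have hFd : ∀ ε t x, (ε, t, x) ∈ Ioo (-ε₁) ε₁ ×ˢ (univ : Set ℝ) ×ˢ s →
      HasDerivAt (polarField p q r ε t)
        (fderiv ℝ (fun x : ℝ × ℝ × ℝ => polarField p q r x.1 x.2.1 x.2.2) (ε, t, x) (0, 0, 1)) x := by
    intro ε t x hx
    have h1 := ((hF.contDiffAt (hO.mem_nhds hx)).differentiableAt one_ne_zero).hasFDerivAt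
    have h2 : HasDerivAt (fun x : ℝ => (ε, t, x)) (0, 0, 1) x :=
      (hasDerivAt_const x ε).prodMk ((hasDerivAt_const x t).prodMk (hasDerivAt_id' x))
    exact h1.comp_hasDerivAt x h2
  have hFper : ∀ ε t x, polarField p q r ε (t + 2 * Real.pi) x = polarField p q r ε t x := fun ε t x => by
    rw [polarField, hGper, (polar_add_two_pi x t r).1, (polar_add_two_pi x t r).2, polarField]
  -- For ε = 0 the denominator is σ² (1 - u) z_v; one factor σ cancels, so the averaged function is
  -- the Melnikov function divided by σ and has the same simple zeros.
  have hinteg : ∀ x ∈ s, ∫ t in 0..2 * Real.pi, polarField p q r 0 t x = melnikov c r x / x := by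
    intro x hx
    have hx' := hsρ hx
    rw [← integral_perturbDot hρ h hr (by rw [abs_of_pos hx'.1]; exact hx'.2) hdiv,
      ← intervalIntegral.integral_div]
    refine intervalIntegral.integral_congr fun t _ => ?_
    have hm := hdom hx'.1 hx'.2 t
    have h1 := polar_energy (hm.1.trans_le hρ) (h _ hm).1
    have h2 : x ≠ 0 := hx'.1.ne'
    simp only at h1 ⊢
    rw [polarField, angular, h1, zero_mul, add_zero]
    field_simp
  have hx₀s : x₀ ∈ s := ⟨by linarith, by linarith⟩
  have hF' : ContinuousOn (fun x : ℝ × ℝ × ℝ => deriv (polarField p q r x.1 x.2.1) x.2.2)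
      (Ioo (-ε₁) ε₁ ×ˢ univ ×ˢ s) := by
    have hc : ContinuousOn (fun x : ℝ × ℝ × ℝ =>
        fderiv ℝ (fun x : ℝ × ℝ × ℝ => polarField p q r x.1 x.2.1 x.2.2) x (0, 0, 1))
        (Ioo (-ε₁) ε₁ ×ˢ univ ×ˢ s) :=
      (hF.continuousOn_fderiv_of_isOpen hO le_rfl).clm_apply continuousOn_const
    exact hc.congr fun x hx => (hFd x.1 x.2.1 x.2.2 hx).deriv
  have hmd : HasDerivAt (fun x => ∫ t in 0..2 * Real.pi, polarField p q r 0 t x) (m / x₀) x₀ := by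
    have h1 : HasDerivAt (fun x => melnikov c r x / x) (m / x₀) x₀ := by
      refine (hM'.fun_div (hasDerivAt_id' x₀) hx₀.ne').congr_deriv ?_
      rw [hM]
      field_simp
      ring
    refine h1.congr_of_eventuallyEq ?_
    filter_upwards [isOpen_Ioo.mem_nhds hx₀s] with x hx
    exact hinteg x hx
  -- The bound ρ₂/2 - x₀ on δ keeps the orbit, of extent less than 2(x₀ + δ), inside the box where
  -- points are determined by their normal coordinates.
  obtain ⟨δ, hδ, hδδ₀, hδs, ε₀, hε₀, hε₀₁, hmain⟩ := exists_periodic_solution_of_averaged_simple_zero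
    (F := polarField p q r) (F' := fun ε t x => deriv (polarField p q r ε t) x) Real.two_pi_pos hε₁
    isOpen_Ioo hF.continuousOn hF' (fun ε hε t x hx => by
      have := hFd ε t x ⟨hε, trivial, hx⟩
      rwa [← this.deriv] at this) hFper (fun ε t x => by
      have : polarField p q r ε (t + 2 * Real.pi) = polarField p q r ε t := funext (hFper ε t)
      rw [this]) hx₀s (by rw [hinteg x₀ hx₀s, hM, zero_div]) hmd (div_ne_zero hm hx₀.ne')
    (δ₀ := min δ₀ (ρ₂ / 2 - x₀)) (lt_min hδ₀ (by linarith))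
  refine ⟨ε₀, hε₀, fun ε hε hεε₀ => ?_⟩
  obtain ⟨y, hy, hyper, hyx, huniq⟩ := hmain ε hε hεε₀
  have hδa : δ ≤ δ₀ := hδδ₀.trans (min_le_left _ _)
  have hδb : δ ≤ ρ₂ / 2 - x₀ := hδδ₀.trans (min_le_right _ _)
  have hεabs : |ε| ≤ ε₁ := by
    rw [abs_of_pos hε]
    linarith
  have hδx : ∀ x, |x - x₀| ≤ δ → x ∈ s := fun x hx => hδs (by
    rw [Metric.mem_closedBall, Real.dist_eq]
    exact hx)
  have hangs : ∀ φ, ∀ x ∈ s, 0 < angular p q r ε (polarU (x, φ, r)) (polarV (x, φ, r)) := fun φ x hx =>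
    hGpos ε φ x hεabs (abs_le.2 ⟨by linarith [hx.1], by linarith [hx.2]⟩)
  have hys : ∀ t, 0 < y t ∧ y t < ρ := fun t => hsρ (hδx _ (hyx t).le)
  have hper := isPeriodicOrbit_polar hρ h hr hy hyper (fun t => (hys t).1) (fun t => (hys t).2)
    (fun t => hangs t _ (hδx _ (hyx t).le))
  have hδx₀ : δ ≤ x₀ := by
    have := (hsρ (hδx (x₀ - δ) (by rw [sub_sub_cancel_left, abs_neg, abs_of_pos hδ]))).1
    linarith
  have hloc : ∀ x ∈ range fun t => (polarU (y t, t, r), polarV (y t, t, r)),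
      |x.1| < 2 * (x₀ + δ) ∧ |x.2| < 2 * (x₀ + δ) ∧ |√(energy r x.1 x.2) - x₀| < δ := by
    rintro x ⟨t, rfl⟩
    have hm := hdom (hys t).1 (hys t).2 t
    have h1 := abs_polarU_le (hm.1.trans_le hρ)
    have h2 := abs_polarV_le (h _ hm).1
    have h3 := polar_energy (hm.1.trans_le hρ) (h _ hm).1
    have h4 := (abs_lt.1 (hyx t)).2
    simp only [abs_of_pos (hys t).1] at h1 h2 h3 ⊢
    rw [h3, Real.sqrt_sq (hys t).1.le]
    exact ⟨by linarith, by linarith, hyx t⟩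
  -- The isolating neighbourhood is the energy annulus around x₀ cut down to the box; any periodic
  -- orbit inside it comes from the unique periodic solution y.
  refine ⟨range fun t => (polarU (y t, t, r), polarV (y t, t, r)), ⟨hper,
    {x | |x.1| < ρ₂ ∧ |x.2| < ρ₂ ∧ |√(energy r x.1 x.2) - x₀| < δ}, ?_, ?_, ?_⟩, range_nonempty _, ?_⟩
  · refine IsOpen.and (isOpen_lt continuous_fst.abs continuous_const)
      (IsOpen.and (isOpen_lt continuous_snd.abs continuous_const) (isOpen_lt ?_ continuous_const))
    unfold energy normalW normalS
    fun_prop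
  · intro x hx
    obtain ⟨h1, h2, h3⟩ := hloc x hx
    exact ⟨by linarith, by linarith, h3⟩
  · intro Γ' hΓ' hΓU
    exact eq_range_polar_of_isPeriodicOrbit hbox hδx₀ (fun φ σ hσ => hangs φ σ (hδx σ hσ.le)) huniq
      hΓ' hΓU
  · intro x hx
    obtain ⟨h1, h2, h3⟩ := hloc x hx
    exact ⟨by linarith, by linarith, by linarith⟩

/-! ### Assembly of the six limit cycles -/

lemma relCoeff_eq {r d10 d01 d02 d11 d20 : ℝ}
    (h02 : d02 = -(3 / 2) * d10 + 3 * d01 - d20)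
    (h11 : d11 = (12 * r - 191 / 4) * d10 + (40 * r + 3) * d01 + (8 * r - 47 / 2) * d20)
    (h10 : d10 = 2 / (17680 * r - 43347) *
      ((1792 * r ^ 2 - 17328 * r - 696) * d01 + (11107 - 5680 * r) * d20))
    (h20 : d20 = (6544683 + 11682846 * r + 30378720 * r ^ 2 - 40278528 * r ^ 3
        - 21471232 * r ^ 4) /
      (2 * (2770317 - 11417834 * r + 11442688 * r ^ 2 + 442880 * r ^ 3)) * d01) :
    relCoeff r d01 0 0 0 0 0 = ![0, d10, d01, d02, d11, d20] := by
  have e20 : numTwenty r / (2 * denTwenty r) * d01 = d20 := h20.symm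
  have e10 : 2 / denTen r * (tenOne r * d01 + tenTwo r * d20) = d10 := h10.symm
  simp only [relCoeff, add_zero, e20, e10, h02, h11]

theorem theorem7 (r₀ d00 d10 d01 d02 d11 d20 : ℝ)
    (hr : quintic r₀ = 0)
    (h00 : d00 = 0)
    (h02 : d02 = -(3 / 2) * d10 + 3 * d01 - d20)
    (h01 : d01 ≠ 0)
    (h11 : d11 = (12 * r₀ - 191 / 4) * d10 + (40 * r₀ + 3) * d01 + (8 * r₀ - 47 / 2) * d20)
    (h10 : d10 = 2 / (17680 * r₀ - 43347) *
      ((1792 * r₀ ^ 2 - 17328 * r₀ - 696) * d01 + (11107 - 5680 * r₀) * d20))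
    (h20 : d20 = (6544683 + 11682846 * r₀ + 30378720 * r₀ ^ 2 - 40278528 * r₀ ^ 3
        - 21471232 * r₀ ^ 4) /
      (2 * (2770317 - 11417834 * r₀ + 11442688 * r₀ ^ 2 + 442880 * r₀ ^ 3)) * d01) :
    ∀ η : ℝ, 0 < η → ∃ r c00 c10 c01 c02 c11 c20 : ℝ,
      |r - r₀| < η ∧ |c00 - d00| < η ∧ |c10 - d10| < η ∧ |c01 - d01| < η ∧
      |c02 - d02| < η ∧ |c11 - d11| < η ∧ |c20 - d20| < η ∧
      ∀ p q : MvPolynomial (Fin 2) ℝ, p.totalDegree ≤ 3 → q.totalDegree ≤ 3 →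
        MvPolynomial.pderiv 0 p + MvPolynomial.pderiv 1 q =
          divergencePoly c00 c10 c01 c02 c11 c20 →
        ∃ ε : ℝ, 0 < ε ∧ ε < η ∧
          6 ≤ {Γ : Set (ℝ × ℝ) | IsLimitCycle (nearHamiltonianField (hamiltonian r) p q ε) Γ ∧
            Γ ⊆ Metric.ball 0 η}.encard := by
  intro η hη
  -- The radii are chosen uniformly for |r| < |r₀| + 1, before r itself is known.
  obtain ⟨ρ, hρ0, hρ, hdom⟩ := exists_polarDomain_normalZv (|r₀| + 1)
  obtain ⟨ρ₂, hρ₂, hbox⟩ := exists_box (|r₀| + 1)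
  -- The bound ρ₂/2 is what the cycle construction requires of the zeros. The bound η/4, with 2e <
  -- η/2 below, places the cycles inside the η-neighbourhood because 2(σ_j + e) < η.
  obtain ⟨r, c, hrη, hcη, σ, hσ, hzero⟩ := exists_six_simple_zeros hr h01 (η := min η 1)
    (ρ₁ := min ρ (min (ρ₂ / 2) (η / 4))) (by positivity) (by positivity)
  rw [relCoeff_eq h02 h11 h10 h20] at hcη
  have hrR : |r| < |r₀| + 1 := by
    have h1 := abs_sub_abs_le_abs_sub r r₀
    have h2 := hrη.trans_le (min_le_right _ _)
    linarith
  have hc : ∀ i, |c i - ![0, d10, d01, d02, d11, d20] i| < η := fun i =>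
    (hcη i).trans_le (min_le_left _ _)
  refine ⟨r, c 0, c 1, c 2, c 3, c 4, c 5, hrη.trans_le (min_le_left _ _), by simpa [h00] using hc 0,
    hc 1, hc 2, hc 3, hc 4, hc 5, fun p q _ _ hdiv => ?_⟩
  have hid : Tendsto (fun e : ℝ => 2 * e) (𝓝[>] 0) (𝓝 0) := by
    have : Tendsto (fun e : ℝ => 2 * e) (𝓝 0) (𝓝 (2 * 0)) :=
      (continuous_const.mul continuous_id).tendsto 0
    rw [mul_zero] at this
    exact this.mono_left nhdsWithin_le_nhds
  -- The gap condition makes the annuli of half-width e around the σ_j disjoint, so the six cycles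
  -- are distinct.
  obtain ⟨e, he, he0, heη⟩ : ∃ e, (∀ i j, i < j → 2 * e < σ j - σ i) ∧ 0 < e ∧ 2 * e < η / 2 :=
    ((eventually_all.2 fun i => eventually_all.2 fun j => eventually_imp_distrib_left.2 fun hij =>
      hid.eventually_lt_const (sub_pos.2 (hσ hij))).and
      (eventually_mem_nhdsWithin.and (hid.eventually_lt_const (by positivity)))).exists
  have hcyc : ∀ j, ∃ ε₀, 0 < ε₀ ∧ ∀ ε, 0 < ε → ε < ε₀ → ∃ Γ,
      IsLimitCycle (nearHamiltonianField (hamiltonian r) p q ε) Γ ∧ Γ.Nonempty ∧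
      ∀ x ∈ Γ, |x.1| < 2 * (σ j + e) ∧ |x.2| < 2 * (σ j + e) ∧ |√(energy r x.1 x.2) - σ j| < e := by
    intro j
    obtain ⟨h1, h2, h3, m, h4, h5⟩ := hzero j
    have h6 := h2.trans_le ((min_le_right _ _).trans (min_le_left _ _))
    exact exists_limitCycle_of_simple_zero hρ hdom hrR (fun u v hu hv => hbox r u v hrR hu hv) hdiv h1
      (h2.trans_le (min_le_left _ _)) (by linarith) h3 h5 h4 he0
  choose ε₀ hε₀ hcyc using hcyc
  have hid' : Tendsto (fun e : ℝ => e) (𝓝[>] 0) (𝓝 0) := nhdsWithin_le_nhds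
  obtain ⟨ε, hεε₀, hε0, hεη⟩ : ∃ ε, (∀ j, ε < ε₀ j) ∧ 0 < ε ∧ ε < η :=
    ((eventually_all.2 fun j => hid'.eventually_lt_const (hε₀ j)).and
      (eventually_mem_nhdsWithin.and (hid'.eventually_lt_const hη))).exists
  choose Γ hΓ hΓne hΓloc using fun j => hcyc j ε hε0 (hεε₀ j)
  refine ⟨ε, hε0, hεη, ?_⟩
  have hne : ∀ i j, i < j → Γ i ≠ Γ j := by
    intro i j hij heq
    obtain ⟨x, hx⟩ := hΓne i
    have h1 := (abs_lt.1 (hΓloc i x hx).2.2).2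
    have h2 := (abs_lt.1 (hΓloc j x (heq ▸ hx)).2.2).1
    linarith [he i j hij]
  have hinj : Function.Injective Γ := fun i j hij => by
    rcases lt_trichotomy i j with h | h | h
    · exact absurd hij (hne i j h)
    · exact h
    · exact absurd hij.symm (hne j i h)
  have hcard : 6 ≤ (range Γ).encard := by simpa using hinj.encard_range
  refine hcard.trans (encard_le_encard ?_)
  rintro _ ⟨j, rfl⟩
  refine ⟨hΓ j, fun x hx => ?_⟩
  obtain ⟨h1, h2, -⟩ := hΓloc j x hx
  have h3 := (hzero j).2.1.trans_le ((min_le_right _ _).trans (min_le_right _ _))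
  rw [mem_ball_zero_iff, Prod.norm_def, max_lt_iff, Real.norm_eq_abs, Real.norm_eq_abs]
  exact ⟨by linarith, by linarith⟩
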